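/- Let $M$ be a smooth four-dimensional manifold with a smooth Lorentzian metric $g$ of signature $(1,3)$ and a volume form $\tau_g$ (a smooth $4$-form with value $\pm1$ on orthonormal frames). Let $D$ be the Levi-Civita connection of $g$, and use the conventions $[D_\sigma,D_\rho]V^\mu=R^{\mu}{}_{\nu\sigma\rho}V^\nu$, $R_{\nu\sigma}=R^{\mu}{}_{\nu\sigma\mu}$, $R=g^{\nu\sigma}R_{\nu\sigma}$, $G^\alpha_\beta=R^\alpha_\beta-\tfrac12\delta^\alpha_\beta R$. Let $\star$ be the Hodge star, given by $\eta\wedge\star\omega=(\eta\cdot\omega)\,\tau_g$, let $\delta_g\omega=(-1)^p\star^{-1}d\star\omega$ for $p$-forms $\omega$, and let $\square\omega=g^{\alpha\beta}D_\alpha D_\beta\omega$ be the covariant D'Alembertian on $1$-forms. Let $T=(T^\alpha_\beta)$ be a $(1,1)$ tensor field such that the Einstein equation $G^\alpha_\beta=-T^\alpha_\beta$ holds on $M$; write $\operatorname{tr}T=T^\alpha_\alpha$ and $T(\omega)=\omega_\alpha T^\alpha_\beta\,dx^\beta$ for a $1$-form $\omega$. Let $\mathbf A$ be an arbitrary smooth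 vector field on $M$, $A=g(\mathbf A,\cdot)$ and $F=dA$. Then $$\delta_gF=-J_A,\qquad J_A=-T(A)+\tfrac12(\operatorname{tr}T)\,A+d\,\delta_gA+\square A,\qquad \delta_gJ_A=0 .$$ If $\mathbf A$ is a Killing vector field (that is, the Lie derivative of $g$ along $\mathbf A$ vanishes), then $$J_A=-2\,T(A)+(\operatorname{tr}T)\,A ,$$ and the charge $$\mathcal E(V)=\frac1{4\pi}\int_V\star\bigl(T(A)-\tfrac12(\operatorname{tr}T)\,A\bigr),$$ defined for smooth singular (cubical) $3$-chains $V$ in $M$, has the following properties. 1. $\mathcal E(V)=\frac1{8\pi}\int_{\partial V}\star F$ for every $V$. 2. $\mathcal E$ is conserved: $\mathcal E(\partial N)=0$ for every smooth singular $4$-chain $N$. Consequently, if $\partial N$ and $V_1-V_2+W$ give the same integrals of all smooth $3$-forms and $J_A$ vanishes on $W$, then $\mathcal E(V_1)=\mathcal E(V_2)$. 3. More generally, if for all $n$ the chains $\partial N_n$ and $V_{1,n}-V_{2,n}+W_n$ give the same integrals of all smooth $3$-forms, $\int_{W_n}\star J_A\to0$ and $\mathcal E(V_{1,n})\to e$ as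 $n\to\infty$, then $\mathcal E(V_{2,n})\to e$. -/

import Mathlib

open scoped Manifold ContDiff Matrix Topology
open MeasureTheory Filter

noncomputable section

namespace Komar

/-! ### Differential forms on a four-dimensional manifold -/

/-- The model space `ℝ⁴`. -/
abbrev E4 : Type := EuclideanSpace ℝ (Fin 4)

/-- The `μ`-th standard basis vector of `ℝ⁴`. Seen in the tangent space at `x`, it is the coordinate
vector `∂_μ` of the preferred chart at `x`. -/
def stdVec (μ : Fin 4) : E4 := EuclideanSpace.single μ (1 : ℝ)

section Forms

variable {M : Type*} [TopologicalSpace M] [ChartedSpace E4 M]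

/-- The tangent space of `M` at `x`. -/
abbrev TS (x : M) : Type := TangentSpace 𝓘(ℝ, E4) x

/-- The coordinate vector `∂_μ` at `x` of the preferred chart at `x`. -/
def coordVec (x : M) (μ : Fin 4) : TS x := stdVec μ

variable (M) in
/-- Fields of alternating `k`-linear forms on the tangent spaces of `M`. -/
abbrev Form (k : ℕ) : Type _ := ∀ x : M, TS x [⋀^Fin k]→L[ℝ] ℝ

/-- The differential of the inverse of the preferred chart at `x₀`, at the point `y` of `ℝ⁴`. -/
def chartSymmDeriv (x₀ : M) (y : E4) : E4 →L[ℝ] TS ((chartAt E4 x₀).symm y) :=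
  mfderiv 𝓘(ℝ, E4) 𝓘(ℝ, E4) (chartAt E4 x₀).symm y

/-- The expression of a form in the preferred chart at `x₀`: its pull-back by the inverse chart. -/
def Form.inChart {k : ℕ} (θ : Form M k) (x₀ : M) (y : E4) : E4 [⋀^Fin k]→L[ℝ] ℝ :=
  (θ ((chartAt E4 x₀).symm y)).compContinuousLinearMap (chartSymmDeriv x₀ y)

/-- A form is smooth if its expressions in the preferred charts are smooth. -/
def Form.IsSmooth {k : ℕ} (θ : Form M k) : Prop :=
  ∀ x₀ : M, ContDiffOn ℝ ∞ (θ.inChart x₀) (chartAt E4 x₀).target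

/-- The exterior derivative: at `x`, it is computed in the preferred chart at `x` (in which the
tangent space at `x` is `ℝ⁴` itself). -/
def Form.d {k : ℕ} (θ : Form M k) : Form M (k + 1) := fun x =>
  (extDeriv (θ.inChart x) (chartAt E4 x x) : E4 [⋀^Fin (k + 1)]→L[ℝ] ℝ)

/-- A vector field is smooth. -/
def IsSmoothVectorField [IsManifold 𝓘(ℝ, E4) ∞ M] (A : ∀ x : M, TS x) : Prop :=
  ContMDiff 𝓘(ℝ, E4) 𝓘(ℝ, E4).tangent ∞ (fun x => (⟨x, A x⟩ : TangentBundle 𝓘(ℝ, E4) M))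

/-- The components of a vector field in the preferred chart at `x₀`. -/
def vecInChart (A : ∀ x : M, TS x) (x₀ : M) (y : E4) : E4 :=
  mfderiv 𝓘(ℝ, E4) 𝓘(ℝ, E4) (chartAt E4 x₀) ((chartAt E4 x₀).symm y) (A ((chartAt E4 x₀).symm y))

end Forms

theorem append_update_right {V : Type*} {p q : ℕ} (m : Fin p → V) (v : Fin q → V) (i : Fin q)
    (x : V) : Fin.append m (Function.update v i x) =
      Function.update (Fin.append m v) (Fin.natAdd p i) x := by
  funext j
  refine Fin.addCases (fun l => ?_) (fun l => ?_) j
  · rw [Fin.append_left, Function.update_of_ne, Fin.append_left]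
    intro h
    have := congrArg Fin.val h
    simp at this
    omega
  · by_cases hl : l = i
    · subst hl; simp
    · rw [Fin.append_right, Function.update_of_ne hl, Function.update_of_ne, Fin.append_right]
      simpa using hl

/-- Insertion of `m₁, …, m_p` in the first `p` slots of an alternating form `τ`:
`(v₁, …, v_q) ↦ τ (m₁, …, m_p, v₁, …, v_q)`. -/
def contractFirst {V : Type*} [AddCommGroup V] [Module ℝ V] [TopologicalSpace V]
    {n p q : ℕ} (h : p + q = n) (τ : V [⋀^Fin n]→L[ℝ] ℝ) (m : Fin p → V) :
    V [⋀^Fin q]→L[ℝ] ℝ where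
  toFun v := τ (Fin.append m v ∘ Fin.cast h.symm)
  map_update_add' := by
    intro inst v i x y
    subst h
    rw [Subsingleton.elim inst (instDecidableEqFin q)]
    simp [append_update_right]
  map_update_smul' := by
    intro inst v i c x
    subst h
    rw [Subsingleton.elim inst (instDecidableEqFin q)]
    simp [append_update_right]
  map_eq_zero_of_eq' := by
    intro v i j hv hij
    subst h
    refine τ.map_eq_zero_of_eq _ (i := Fin.natAdd p i) (j := Fin.natAdd p j) ?_ ?_
    · simpa using hv
    · simpa using hij
  cont := by
    subst h
    refine τ.cont.comp (continuous_pi fun i => ?_)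
    refine Fin.addCases (fun j => ?_) (fun j => ?_) i
    · simpa using continuous_const
    · simpa using continuous_apply j

/-! ### Local coordinate expressions of the Levi-Civita connection and of its curvature -/

/-- The partial derivative `∂_μ f`. -/
def pd (μ : Fin 4) (f : E4 → ℝ) (y : E4) : ℝ := fderiv ℝ f y (stdVec μ)

/-- The Christoffel symbols `Γ^ρ_{μν}` of the Levi-Civita connection of the metric with components
`G`: `D_{∂_μ} ∂_ν = Γ^ρ_{μν} ∂_ρ`. -/
def christoffel (G : E4 → Matrix (Fin 4) (Fin 4) ℝ) (ρ μ ν : Fin 4) (y : E4) : ℝ :=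
  (1 / 2) * ∑ σ, (G y)⁻¹ ρ σ *
    (pd μ (fun z => G z σ ν) y + pd ν (fun z => G z σ μ) y - pd σ (fun z => G z μ ν) y)

/-- The components `R^μ_{ν σ ρ}` of the curvature, `[D_σ, D_ρ] V^μ = R^μ_{ν σ ρ} V^ν`. -/
def riemann (G : E4 → Matrix (Fin 4) (Fin 4) ℝ) (μ ν σ ρ : Fin 4) (y : E4) : ℝ :=
  pd σ (christoffel G μ ρ ν) y - pd ρ (christoffel G μ σ ν) y
    + ∑ κ, (christoffel G μ σ κ y * christoffel G κ ρ ν y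
      - christoffel G μ ρ κ y * christoffel G κ σ ν y)

/-- The components of the Ricci tensor, with the convention `R_{νσ} = R^μ_{νσμ}`. -/
def ricci (G : E4 → Matrix (Fin 4) (Fin 4) ℝ) (y : E4) : Matrix (Fin 4) (Fin 4) ℝ :=
  Matrix.of fun ν σ => ∑ μ, riemann G μ ν σ μ y

/-- The scalar curvature `R = g^{νσ} R_{νσ}`. -/
def scalarCurv (G : E4 → Matrix (Fin 4) (Fin 4) ℝ) (y : E4) : ℝ :=
  ∑ ν, ∑ σ, (G y)⁻¹ ν σ * ricci G y ν σ

/-- The mixed components `G^α_β = R^α_β - (1/2) R δ^α_β` of the Einstein tensor. -/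
def einsteinMixed (G : E4 → Matrix (Fin 4) (Fin 4) ℝ) (y : E4) : Matrix (Fin 4) (Fin 4) ℝ :=
  (G y)⁻¹ * ricci G y - (scalarCurv G y / 2) • (1 : Matrix (Fin 4) (Fin 4) ℝ)

/-- The components `D_β a_ρ` of the covariant derivative of the 1-form with components `a_ρ`. -/
def covD (G : E4 → Matrix (Fin 4) (Fin 4) ℝ) (a : Fin 4 → E4 → ℝ) (β ρ : Fin 4) (y : E4) : ℝ :=
  pd β (a ρ) y - ∑ κ, christoffel G κ β ρ y * a κ y

/-- The components `D_α D_β a_ρ` of the second covariant derivative of the 1-form with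
components `a_ρ`. -/
def covD2 (G : E4 → Matrix (Fin 4) (Fin 4) ℝ) (a : Fin 4 → E4 → ℝ) (α β ρ : Fin 4) (y : E4) : ℝ :=
  pd α (covD G a β ρ) y - ∑ κ, christoffel G κ α β y * covD G a κ ρ y
    - ∑ κ, christoffel G κ α ρ y * covD G a β κ y

/-! ### Oriented Lorentzian spacetimes -/

/-- The structure of an oriented Lorentzian spacetime on the four-dimensional manifold `M`: a smooth
metric of signature `(1,3)` and its volume form. -/
structure Spacetime (M : Type*) [TopologicalSpace M] [ChartedSpace E4 M]
    [IsManifold 𝓘(ℝ, E4) ∞ M] where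
  /-- the metric tensor -/
  g : ∀ x : M, TS x →L[ℝ] TS x →L[ℝ] ℝ
  symm : ∀ (x : M) (v w : TS x), g x v w = g x w v
  signature : ∀ x : M, ∃ b : Fin 4 → TS x, ∀ i j,
    g x (b i) (b j) = Matrix.diagonal ![1, -1, -1, -1] i j
  smooth : ContMDiff 𝓘(ℝ, E4) (𝓘(ℝ, E4).prod 𝓘(ℝ, E4 →L[ℝ] E4 →L[ℝ] ℝ)) ∞
    (fun x => Bundle.TotalSpace.mk' (E4 →L[ℝ] E4 →L[ℝ] ℝ)
      (E := fun x : M => TS x →L[ℝ] TS x →L[ℝ] ℝ) x (g x))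
  /-- the volume form: its value on orthonormal frames is `± 1` -/
  vol : Form M 4
  vol_smooth : vol.IsSmooth
  vol_sq : ∀ (x : M) (v : Fin 4 → TS x),
    (vol x v) ^ 2 = -(Matrix.of fun i j => g x (v i) (v j)).det

namespace Spacetime

variable {M : Type*} [TopologicalSpace M] [ChartedSpace E4 M] [IsManifold 𝓘(ℝ, E4) ∞ M]
  (S : Spacetime M)

/-- The components `g_{μν}` of the metric in the preferred chart at `x₀`. -/
def gChart (x₀ : M) (y : E4) : Matrix (Fin 4) (Fin 4) ℝ :=
  Matrix.of fun μ ν => S.g ((chartAt E4 x₀).symm y)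
    (chartSymmDeriv x₀ y (stdVec μ)) (chartSymmDeriv x₀ y (stdVec ν))

/-- The matrix of the metric at `x` in the basis `∂_μ` of the preferred chart at `x`. -/
def gram (x : M) : Matrix (Fin 4) (Fin 4) ℝ :=
  Matrix.of fun μ ν => S.g x (coordVec x μ) (coordVec x ν)

/-- The reciprocal basis `∂^ν = g^{νμ} ∂_μ` of the basis `∂_μ` of the tangent space at `x`. -/
def recipVec (x : M) (ν : Fin 4) : TS x := ∑ μ, (S.gram x)⁻¹ ν μ • coordVec x μ

/-- The Einstein tensor, as a field of endomorphisms `G^α_β` of the tangent spaces. -/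
def einstein (x : M) : TS x →L[ℝ] TS x :=
  (Matrix.toEuclideanCLM (n := Fin 4) (𝕜 := ℝ) (einsteinMixed (S.gChart x) (chartAt E4 x x)) :
    E4 →L[ℝ] E4)

/-- The Hodge star on `p`-forms,
`(⋆θ)(v₁, …, v_q) = (1/p!) θ(∂^{ν₁}, …, ∂^{ν_p}) τ(∂_{ν₁}, …, ∂_{ν_p}, v₁, …, v_q)`;
it is characterized by `η ∧ ⋆θ = (η · θ) τ`. -/
def hodge {p q : ℕ} (h : p + q = 4) (θ : Form M p) : Form M q := fun x =>
  ((p.factorial : ℝ)⁻¹) • ∑ ν : Fin p → Fin 4,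
    θ x (fun i => S.recipVec x (ν i)) • contractFirst h (S.vol x) (fun i => coordVec x (ν i))

/-- The inverse of the Hodge star, on `p`-forms: `⋆⁻¹ = (-1)^{p(4-p)} sgn(det g) ⋆`, where
`sgn(det g) = -1`. -/
def hodgeInv {p q : ℕ} (h : p + q = 4) (θ : Form M p) : Form M q :=
  ((-1 : ℝ) ^ (p * q) * (-1)) • S.hodge h θ

/-- The Hodge codifferential of `p`-forms with `p = k + 1`: `δθ = (-1)^p ⋆⁻¹ d ⋆ θ`. -/
def codiff (k : ℕ) {l : ℕ} (h : k + l + 1 = 4) (θ : Form M (k + 1)) : Form M k :=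
  ((-1 : ℝ) ^ (k + 1)) •
    S.hodgeInv (p := l + 1) (q := k) (by omega) (S.hodge (p := k + 1) (q := l) (by omega) θ).d

/-- The 1-form `A = g(𝐀, ·)` of the vector field `𝐀`. -/
def flat (A : ∀ x : M, TS x) : Form M 1 := fun x =>
  ContinuousAlternatingMap.ofSubsingleton ℝ (TS x) ℝ (0 : Fin 1) (S.g x (A x))

/-- The covariant D'Alembertian `□θ = g^{αβ} D_α D_β θ` on 1-forms. -/
def box (θ : Form M 1) : Form M 1 := fun x =>
  ContinuousAlternatingMap.ofSubsingleton ℝ (TS x) ℝ (0 : Fin 1)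
    (∑ ρ : Fin 4, (∑ α, ∑ β, (S.gram x)⁻¹ α β *
      covD2 (S.gChart x) (fun σ y => θ.inChart x y (fun _ => stdVec σ)) α β ρ (chartAt E4 x x)) •
      (EuclideanSpace.proj ρ : E4 →L[ℝ] ℝ))

/-- `𝐀` is a Killing vector field: the Lie derivative
`A^λ ∂_λ g_{μν} + g_{λν} ∂_μ A^λ + g_{μλ} ∂_ν A^λ` of the metric along `𝐀` vanishes. -/
def IsKilling (A : ∀ x : M, TS x) : Prop :=
  ∀ (x : M) (μ ν : Fin 4),
    ∑ κ, (vecInChart A x (chartAt E4 x x) κ * pd κ (fun y => S.gChart x y μ ν) (chartAt E4 x x)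
      + S.gChart x (chartAt E4 x x) κ ν * pd μ (fun y => vecInChart A x y κ) (chartAt E4 x x)
      + S.gChart x (chartAt E4 x x) μ κ * pd ν (fun y => vecInChart A x y κ) (chartAt E4 x x)) = 0

end Spacetime

section Energy

variable {M : Type*} [TopologicalSpace M] [ChartedSpace E4 M]

/-- The action `T(θ) = θ_α T^α_β dx^β` of a `(1,1)` tensor field on a 1-form. -/
def applyTensor (T : ∀ x : M, TS x →L[ℝ] TS x) (θ : Form M 1) : Form M 1 := fun x =>
  (θ x).compContinuousLinearMap (T x)

/-- The trace `T^α_α`. -/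
def trT (T : ∀ x : M, TS x →L[ℝ] TS x) (x : M) : ℝ :=
  LinearMap.trace ℝ (TS x) (T x : TS x →ₗ[ℝ] TS x)

/-- The product of a function and a form. -/
def fmul {k : ℕ} (f : M → ℝ) (θ : Form M k) : Form M k := fun x => f x • θ x

end Energy

/-- The current `J_A = -T(A) + (1/2) (tr T) A + d δ A + □ A`. -/
def Spacetime.komarCurrent {M : Type*} [TopologicalSpace M] [ChartedSpace E4 M]
    [IsManifold 𝓘(ℝ, E4) ∞ M] (S : Spacetime M) (T : ∀ x : M, TS x →L[ℝ] TS x)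
    (A : ∀ x : M, TS x) : Form M 1 :=
  -applyTensor T (S.flat A) + (1 / 2 : ℝ) • fmul (trT T) (S.flat A)
    + (S.codiff 0 (l := 3) rfl (S.flat A)).d + S.box (S.flat A)

/-! ### Integration over smooth singular chains -/

section Chains

variable (M : Type*) [TopologicalSpace M] [ChartedSpace E4 M]

/-- Smooth singular `k`-cubes in `M`: maps that are smooth at (hence near) each point of the closed
unit cube `[0,1]^k`. -/
structure SmoothCube (k : ℕ) where
  /-- the underlying map; only its restriction to `[0,1]^k` matters -/
  toFun : (Fin k → ℝ) → M
  smooth : ∀ t ∈ Set.Icc (0 : Fin k → ℝ) 1,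
    ContMDiffAt 𝓘(ℝ, Fin k → ℝ) 𝓘(ℝ, E4) ∞ toFun t

/-- Smooth singular `k`-chains: finite formal sums of cubes with integer coefficients. -/
abbrev SmoothChain (k : ℕ) : Type _ := SmoothCube M k →₀ ℤ

variable {M}

/-- The face `t ↦ c(t₁, …, t_i, ε, t_{i+1}, …, t_k)` of a cube, for `ε ∈ [0,1]`. -/
def SmoothCube.face {k : ℕ} (c : SmoothCube M (k + 1)) (i : Fin (k + 1)) (ε : ℝ)
    (hε : ε ∈ Set.Icc (0 : ℝ) 1) : SmoothCube M k where
  toFun t := c.toFun (i.insertNth ε t)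
  smooth t ht := by
    have hmem : (i.insertNth ε t : Fin (k + 1) → ℝ) ∈ Set.Icc (0 : Fin (k + 1) → ℝ) 1 := by
      constructor
      · intro j
        refine Fin.succAboveCases i ?_ (fun l => ?_) j
        · simpa using hε.1
        · simpa using ht.1 l
      · intro j
        refine Fin.succAboveCases i ?_ (fun l => ?_) j
        · simpa using hε.2
        · simpa using ht.2 l
    have hins : ContDiff ℝ ∞ (fun t : Fin k → ℝ => (i.insertNth ε t : Fin (k + 1) → ℝ)) := by
      rw [contDiff_pi]
      intro j
      refine Fin.succAboveCases i ?_ (fun l => ?_) j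
      · simpa using contDiff_const
      · simpa using contDiff_apply ℝ ℝ l
    exact ContMDiffAt.comp t (c.smooth _ hmem) hins.contMDiff.contMDiffAt

/-- The boundary `∑ᵢ (-1)^i (c|_{t_i = 1} - c|_{t_i = 0})`, `0 ≤ i ≤ k`, of a cube. -/
def SmoothCube.boundary {k : ℕ} (c : SmoothCube M (k + 1)) : SmoothChain M k :=
  ∑ i : Fin (k + 1), ((-1 : ℤ) ^ (i : ℕ)) •
    (Finsupp.single (c.face i 1 (by norm_num)) (1 : ℤ)
      - Finsupp.single (c.face i 0 (by norm_num)) (1 : ℤ))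

/-- The boundary of a chain. -/
def SmoothChain.boundary {k : ℕ} (N : SmoothChain M (k + 1)) : SmoothChain M k :=
  N.sum fun c n => n • c.boundary

/-- The integral of a `k`-form over a `k`-cube, i.e. of its pull-back over `[0,1]^k`. -/
def SmoothCube.integral {k : ℕ} (c : SmoothCube M k) (θ : Form M k) : ℝ :=
  ∫ t in Set.Icc (0 : Fin k → ℝ) 1, θ (c.toFun t) (fun i =>
    mfderiv 𝓘(ℝ, Fin k → ℝ) 𝓘(ℝ, E4) c.toFun t (Pi.single i (1 : ℝ) : Fin k → ℝ))

/-- The integral of a `k`-form over a `k`-chain. -/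
def SmoothChain.integral {k : ℕ} (N : SmoothChain M k) (θ : Form M k) : ℝ :=
  N.sum fun c n => (n : ℝ) * c.integral θ

/-- Two chains are equal as domains of integration of smooth forms. -/
def SmoothChain.Same {k : ℕ} (N N' : SmoothChain M k) : Prop :=
  ∀ θ : Form M k, θ.IsSmooth → N.integral θ = N'.integral θ

end Chains

/-- The charge `ℰ(V) = (1/4π) ∫_V ⋆(T(A) - (1/2) (tr T) A)` in the region described by the
3-chain `V`. -/
def Spacetime.charge {M : Type*} [TopologicalSpace M] [ChartedSpace E4 M]
    [IsManifold 𝓘(ℝ, E4) ∞ M] (S : Spacetime M) (T : ∀ x : M, TS x →L[ℝ] TS x)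
    (A : ∀ x : M, TS x) (V : SmoothChain M 3) : ℝ :=
  1 / (4 * Real.pi) * V.integral (S.hodge (p := 1) (q := 3) rfl
    (applyTensor T (S.flat A) - (1 / 2 : ℝ) • fmul (trT T) (S.flat A)))

end Komar

end

/-! Everything rests on one identity, `d⋆F = -⋆J_A` (`Spacetime.d_hodge_d_flat`), a Maxwell equation
that every vector field satisfies thanks to the Ricci identity. Let `a` be the components of `A` and
`v` the volume density, so that `v² = -det g`. In a chart, `⋆F` contracts the volume form with
`F^{ab}`, and its exterior derivative contracts the volume form with `-v⁻¹ ∂_a (v F^{ab})`. Since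
`∂_α v = v Γ^μ_{αμ}` and `Γ` is symmetric in its lower indices, this is minus a covariant divergence
(`IsMetricOn.sum_pd_volume_mul_two`); with the index lowered, the divergence is `g^{αμ} (D_α D_μ a_γ
- D_α D_γ a_μ)`. Commuting the derivatives in the second term brings in the Ricci tensor and yields
`□a - d(div a) + Ric(a)` (`IsMetricOn.sum_inv_covMat2`). Now `δA = -div a`, and in dimension four
the Einstein equation reads `Ric(A) = -T(A) + ½ (tr T) A`, so the result is exactly `J_A`.

The rest is formal. `⋆⋆ = 1` on 1-forms gives `δF = -J_A`, and `d⋆J_A = -dd⋆F = 0` gives `δJ_A = 0`.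
For a Killing field `D_β a_ρ` is skew; hence `div a = 0`, and the divergence above equals both `2□a`
and `□a + Ric(a)`, so that `J_A = 2 Ric(A)`. The integrand of the charge is then `-½ ⋆J_A = ½ d⋆F`,
and the three properties follow from Stokes' theorem for cubical chains (`SmoothChain.stokes`).

What remains is chart independence. The star, `d`, the Einstein tensor and the Killing equation are
given at each point in the preferred chart of that very point, while differentiation needs one
formula on a neighbourhood. `Form.IsSmooth.inChart_d`, `Spacetime.inChart_hodge`,
`Spacetime.div_chart_symm` and `Spacetime.IsKilling.sum_eq_zero` provide it where it is needed. -/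

noncomputable section

namespace Komar

/-! ### Pull-back of forms and the exterior derivative -/

section PullBack

variable {M : Type*} [TopologicalSpace M] [ChartedSpace E4 M]
  {E : Type*} [NormedAddCommGroup E] [NormedSpace ℝ E]

/-- The pull-back of a form on `M` by a map from a normed space. -/
def Form.pullBack {k : ℕ} (θ : Form M k) (f : E → M) (t : E) : E [⋀^Fin k]→L[ℝ] ℝ :=
  (θ (f t)).compContinuousLinearMap (mfderiv 𝓘(ℝ, E) 𝓘(ℝ, E4) f t)

theorem Form.IsSmooth.contDiffAt {k : ℕ} {θ : Form M k} (hθ : θ.IsSmooth) (x₀ : M) {y : E4}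
    (hy : y ∈ (chartAt E4 x₀).target) : ContDiffAt ℝ ∞ (θ.inChart x₀) y :=
  (hθ x₀).contDiffAt ((chartAt E4 x₀).open_target.mem_nhds hy)

theorem Form.d_smul {k : ℕ} (c : ℝ) (θ : Form M k) : (c • θ).d = c • θ.d := by
  funext x
  exact extDeriv_smul c (θ.inChart x)

theorem Form.IsSmooth.smul {k : ℕ} {θ : Form M k} (hθ : θ.IsSmooth) (c : ℝ) :
    (c • θ).IsSmooth := fun x₀ => (hθ x₀).const_smul c

theorem contDiffAt_extDeriv {k : ℕ} {η : E → E [⋀^Fin k]→L[ℝ] ℝ} {x : E}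
    (h : ContDiffAt ℝ ∞ η x) : ContDiffAt ℝ ∞ (extDeriv η) x := by
  have h1 : ContDiffAt ℝ ∞ (fun y => ContinuousAlternatingMap.alternatizeUncurryFinCLM (n := k)
      ℝ E ℝ (fderiv ℝ η y)) x :=
    ContDiffAt.continuousLinearMap_comp _ (h.fderiv_right (m := ∞) (by norm_cast))
  exact h1

variable [IsManifold 𝓘(ℝ, E4) ∞ M]

theorem isManifold_one : IsManifold 𝓘(ℝ, E4) 1 M := IsManifold.of_le (n := ∞) (by norm_cast)

theorem contMDiffAt_chart {x₀ z : M} (hz : z ∈ (chartAt E4 x₀).source) :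
    ContMDiffAt 𝓘(ℝ, E4) 𝓘(ℝ, E4) ∞ (chartAt E4 x₀) z :=
  contMDiffAt_of_mem_maximalAtlas (IsManifold.chart_mem_maximalAtlas x₀) hz

theorem contMDiffAt_chart_symm {x₀ : M} {y : E4} (hy : y ∈ (chartAt E4 x₀).target) :
    ContMDiffAt 𝓘(ℝ, E4) 𝓘(ℝ, E4) ∞ (chartAt E4 x₀).symm y :=
  contMDiffAt_symm_of_mem_maximalAtlas (IsManifold.chart_mem_maximalAtlas x₀) hy

/-- The tangent space at `x` is by construction the model space read through the preferred chart at
`x`. Hence values at `x` agree with chart expressions at the centre, with no Jacobian. -/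
theorem mfderiv_chart_self (x : M) :
    mfderiv 𝓘(ℝ, E4) 𝓘(ℝ, E4) (chartAt E4 x) x = ContinuousLinearMap.id ℝ E4 := by
  have := isManifold_one (M := M)
  rw [mfderiv_chartAt_eq_tangentCoordChange (mem_chart_source E4 x)]
  ext1 v
  exact tangentCoordChange_self (by simp)

theorem mfderiv_chart_symm_comp {x₀ z : M} (hz : z ∈ (chartAt E4 x₀).source) :
    (mfderiv 𝓘(ℝ, E4) 𝓘(ℝ, E4) (chartAt E4 x₀).symm (chartAt E4 x₀ z)).comp
      (mfderiv 𝓘(ℝ, E4) 𝓘(ℝ, E4) (chartAt E4 x₀) z) =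
        ContinuousLinearMap.id ℝ (TS z) := by
  have := isManifold_one (M := M)
  exact (mdifferentiable_chart x₀).symm_comp_deriv hz

theorem mfderiv_chart_comp_symm {x₀ : M} {y : E4} (hy : y ∈ (chartAt E4 x₀).target) :
    (mfderiv 𝓘(ℝ, E4) 𝓘(ℝ, E4) (chartAt E4 x₀) ((chartAt E4 x₀).symm y)).comp
      (chartSymmDeriv x₀ y) = ContinuousLinearMap.id ℝ E4 := by
  have := isManifold_one (M := M)
  exact (mdifferentiable_chart x₀).comp_symm_deriv hy

theorem mfderiv_chart_symm_self (x : M) (v : E4) :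
    mfderiv 𝓘(ℝ, E4) 𝓘(ℝ, E4) (chartAt E4 x).symm (chartAt E4 x x) v = v := by
  have h := congrArg (fun L => L v) (mfderiv_chart_symm_comp (mem_chart_source E4 x))
  rw [mfderiv_chart_self] at h
  exact h

theorem Form.apply_eq_inChart {k : ℕ} (θ : Form M k) (x : M) (v : Fin k → E4) :
    θ x v = θ.inChart x (chartAt E4 x x) v := by
  -- The point `symm (chart x)` equals `x` only propositionally, and the tangent space depends on
  -- it. Generalizing to a variable `z` lets `rfl` transport the fibre; the same device recurs
  -- below.
  have key : ∀ (z : M) (hz : z = x) (L : E4 →L[ℝ] TS z), (∀ w : E4, (L w : E4) = w) →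
      (θ z).compContinuousLinearMap L v = θ x v := by
    rintro z rfl L hL
    exact congrArg (θ z) (funext fun i => hL (v i))
  exact (key _ ((chartAt E4 x).left_inv (mem_chart_source E4 x)) _
    (mfderiv_chart_symm_self x)).symm

/-- In the preferred chart at `x₀`, a pulled-back form is the pull-back of the chart expression. -/
theorem Form.pullBack_eq {k : ℕ} (θ : Form M k) {f : E → M} {s : E} (x₀ : M)
    (hf : MDifferentiableAt 𝓘(ℝ, E) 𝓘(ℝ, E4) f s) (hs : f s ∈ (chartAt E4 x₀).source) :
    θ.pullBack f s = (θ.inChart x₀ (chartAt E4 x₀ (f s))).compContinuousLinearMap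
      (fderiv ℝ (chartAt E4 x₀ ∘ f) s) := by
  have := isManifold_one (M := M)
  have hc : MDifferentiableAt 𝓘(ℝ, E4) 𝓘(ℝ, E4) (chartAt E4 x₀) (f s) :=
    (mdifferentiable_chart x₀).mdifferentiableAt hs
  have h1 : fderiv ℝ (chartAt E4 x₀ ∘ f) s =
      (mfderiv 𝓘(ℝ, E4) 𝓘(ℝ, E4) (chartAt E4 x₀) (f s)).comp
        (mfderiv 𝓘(ℝ, E) 𝓘(ℝ, E4) f s) := by
    rw [← mfderiv_eq_fderiv]
    exact mfderiv_comp s hc hf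
  have key : ∀ (z : M) (_ : z = f s) (L : E4 →L[ℝ] TS z)
      (_ : ∀ w : TS (f s), (L (mfderiv 𝓘(ℝ, E4) 𝓘(ℝ, E4) (chartAt E4 x₀) (f s) w) : E4) = w),
      ((θ z).compContinuousLinearMap L).compContinuousLinearMap
        (fderiv ℝ (chartAt E4 x₀ ∘ f) s) = θ.pullBack f s := by
    rintro z rfl L hL
    ext v
    rw [h1]
    exact congrArg (θ (f s)) (funext fun i => hL _)
  exact (key _ ((chartAt E4 x₀).left_inv hs) _ fun w =>
    congrArg (fun L => L w) (mfderiv_chart_symm_comp hs)).symm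

theorem Form.pullBack_eventuallyEq {k : ℕ} (θ : Form M k) {f : E → M} {t : E} {x₀ : M}
    (hf : ContMDiffAt 𝓘(ℝ, E) 𝓘(ℝ, E4) ∞ f t) (ht : f t ∈ (chartAt E4 x₀).source) :
    θ.pullBack f =ᶠ[𝓝 t] fun s => (θ.inChart x₀ ((chartAt E4 x₀ ∘ f) s)).compContinuousLinearMap
      (fderiv ℝ (chartAt E4 x₀ ∘ f) s) := by
  -- Smoothness at a point spreads to a neighbourhood one finite order at a time, hence the drop
  -- from `∞` to `1`, which is enough for the chain rule.
  have h1 : ∀ᶠ s in 𝓝 t, ContMDiffAt 𝓘(ℝ, E) 𝓘(ℝ, E4) 1 f s :=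
    (contMDiffAt_iff_contMDiffAt_nhds (by simp)).1 (hf.of_le (by norm_cast))
  have h2 : ∀ᶠ s in 𝓝 t, f s ∈ (chartAt E4 x₀).source :=
    hf.continuousAt.eventually ((chartAt E4 x₀).open_source.mem_nhds ht)
  filter_upwards [h1, h2] with s hs1 hs2
  exact θ.pullBack_eq x₀ (hs1.mdifferentiableAt (by norm_num)) hs2

theorem contDiffAt_chart_comp {f : E → M} {t : E} {x₀ : M}
    (hf : ContMDiffAt 𝓘(ℝ, E) 𝓘(ℝ, E4) ∞ f t) (ht : f t ∈ (chartAt E4 x₀).source) :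
    ContDiffAt ℝ ∞ (chartAt E4 x₀ ∘ f) t :=
  ((contMDiffAt_chart ht).comp t hf).contDiffAt

theorem Form.IsSmooth.differentiableAt_pullBack {k : ℕ} {θ : Form M k} (hθ : θ.IsSmooth)
    {f : E → M} {t : E} (hf : ContMDiffAt 𝓘(ℝ, E) 𝓘(ℝ, E4) ∞ f t) :
    DifferentiableAt ℝ (θ.pullBack f) t := by
  have ht := mem_chart_source E4 (f t)
  refine DifferentiableAt.congr_of_eventuallyEq ?_ (θ.pullBack_eventuallyEq hf ht)
  have hc := contDiffAt_chart_comp hf ht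
  have h1 : DifferentiableAt ℝ (θ.inChart (f t) ∘ (chartAt E4 (f t) ∘ f)) t :=
    DifferentiableAt.comp t
      ((hθ.contDiffAt (f t) ((chartAt E4 (f t)).map_source ht)).differentiableAt (by norm_num))
      (hc.differentiableAt (by norm_num))
  exact h1.continuousAlternatingMapCompContinuousLinearMap
    ((hc.fderiv_right (m := 1) (by norm_cast)).differentiableAt (by norm_num))

/-- The exterior derivative commutes with pull-backs. -/
theorem Form.IsSmooth.extDeriv_pullBack {k : ℕ} {θ : Form M k} (hθ : θ.IsSmooth) {f : E → M}
    {t : E} (hf : ContMDiffAt 𝓘(ℝ, E) 𝓘(ℝ, E4) ∞ f t) :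
    extDeriv (θ.pullBack f) t = θ.d.pullBack f t := by
  have := isManifold_one (M := M)
  have ht := mem_chart_source E4 (f t)
  have h0 : DifferentiableAt ℝ (θ.inChart (f t)) ((chartAt E4 (f t) ∘ f) t) :=
    (hθ.contDiffAt (f t) ((chartAt E4 (f t)).map_source ht)).differentiableAt (by norm_num)
  rw [(θ.pullBack_eventuallyEq hf ht).extDeriv_eq, extDeriv_pullback (r := 2) h0
    ((contDiffAt_chart_comp hf ht).of_le (by norm_cast)) (by simp)]
  have h1 : fderiv ℝ (chartAt E4 (f t) ∘ f) t =
      (mfderiv 𝓘(ℝ, E4) 𝓘(ℝ, E4) (chartAt E4 (f t)) (f t)).comp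
        (mfderiv 𝓘(ℝ, E) 𝓘(ℝ, E4) f t) := by
    rw [← mfderiv_eq_fderiv]
    exact mfderiv_comp t ((mdifferentiable_chart (f t)).mdifferentiableAt ht)
      (hf.mdifferentiableAt (by norm_num))
  rw [h1, mfderiv_chart_self]
  rfl

/-- `Form.d` changes chart from point to point. Naturality under the inverse chart shows that one
chart computes it on its whole target, so `θ.d` can itself be differentiated. -/
theorem Form.IsSmooth.inChart_d {k : ℕ} {θ : Form M k} (hθ : θ.IsSmooth) {x₀ : M} {y : E4}
    (hy : y ∈ (chartAt E4 x₀).target) : θ.d.inChart x₀ y = extDeriv (θ.inChart x₀) y :=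
  (hθ.extDeriv_pullBack (contMDiffAt_chart_symm hy)).symm

theorem Form.IsSmooth.d {k : ℕ} {θ : Form M k} (hθ : θ.IsSmooth) : θ.d.IsSmooth := by
  intro x₀ y hy
  refine ContDiffAt.contDiffWithinAt (ContDiffAt.congr_of_eventuallyEq
    (contDiffAt_extDeriv (hθ.contDiffAt x₀ hy)) ?_)
  filter_upwards [(chartAt E4 x₀).open_target.mem_nhds hy] with z hz using hθ.inChart_d hz

theorem Form.IsSmooth.d_d {k : ℕ} {θ : Form M k} (hθ : θ.IsSmooth) : θ.d.d = 0 := by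
  funext x
  have hx := mem_chart_target E4 x
  have h : θ.d.inChart x =ᶠ[𝓝 (chartAt E4 x x)] extDeriv (θ.inChart x) := by
    filter_upwards [(chartAt E4 x).open_target.mem_nhds hx] with z hz using hθ.inChart_d hz
  exact h.extDeriv_eq.trans
    (extDeriv_extDeriv_apply (r := 2) ((hθ.contDiffAt x hx).of_le (by norm_cast)) (by simp))

end PullBack

/-! ### Stokes' theorem for smooth singular chains -/

section Stokes

variable {M : Type*} [TopologicalSpace M] [ChartedSpace E4 M]

/-- The integral of a form, as a homomorphism on chains. -/
def SmoothChain.integralHom {k : ℕ} (θ : Form M k) : SmoothChain M k →+ ℝ :=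
  Finsupp.liftAddHom fun c => (AddMonoidHom.mulRight (c.integral θ)).comp (Int.castAddHom ℝ)

theorem SmoothChain.integralHom_apply {k : ℕ} (θ : Form M k) (V : SmoothChain M k) :
    SmoothChain.integralHom θ V = V.integral θ := rfl

theorem SmoothChain.integralHom_single {k : ℕ} (θ : Form M k) (c : SmoothCube M k) (n : ℤ) :
    SmoothChain.integralHom θ (Finsupp.single c n) = n * c.integral θ := by
  simp [SmoothChain.integralHom]

theorem SmoothCube.integral_smul {k : ℕ} (c : SmoothCube M k) (a : ℝ) (θ : Form M k) :
    c.integral (a • θ) = a * c.integral θ :=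
  integral_const_mul a _

theorem SmoothChain.integral_smul {k : ℕ} (V : SmoothChain M k) (a : ℝ) (θ : Form M k) :
    V.integral (a • θ) = a * V.integral θ := by
  simp only [SmoothChain.integral, SmoothCube.integral_smul, Finsupp.sum, Finset.mul_sum]
  exact Finset.sum_congr rfl fun c _ => by ring

theorem SmoothChain.integral_eq_zero {k : ℕ} {V : SmoothChain M k} {θ : Form M k}
    (h : ∀ c ∈ V.support, ∀ t ∈ Set.Icc (0 : Fin k → ℝ) 1, θ (c.toFun t) = 0) :
    V.integral θ = 0 := by
  refine Finset.sum_eq_zero fun c hc => ?_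
  have : c.integral θ = ∫ _ in Set.Icc (0 : Fin k → ℝ) 1, (0 : ℝ) :=
    setIntegral_congr_fun measurableSet_Icc fun t ht => by simp [h c hc t ht]
  simp [this]

theorem SmoothChain.integral_zero {k : ℕ} (N : SmoothChain M k) :
    N.integral (0 : Form M k) = 0 :=
  SmoothChain.integral_eq_zero fun _ _ _ _ => rfl

theorem SmoothCube.boundary_integral {k : ℕ} (c : SmoothCube M (k + 1)) (θ : Form M k) :
    c.boundary.integral θ = ∑ i : Fin (k + 1), (-1 : ℝ) ^ (i : ℕ) *
      ((c.face i 1 (by norm_num)).integral θ - (c.face i 0 (by norm_num)).integral θ) := by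
  rw [← SmoothChain.integralHom_apply, SmoothCube.boundary, map_sum]
  refine Finset.sum_congr rfl fun i _ => ?_
  rw [map_zsmul, map_sub, zsmul_eq_mul, SmoothChain.integralHom_single,
    SmoothChain.integralHom_single]
  simp

theorem SmoothChain.boundary_integral {k : ℕ} (N : SmoothChain M (k + 1)) (θ : Form M k) :
    N.boundary.integral θ = N.sum fun c n => (n : ℝ) * c.boundary.integral θ := by
  rw [← SmoothChain.integralHom_apply, SmoothChain.boundary, Finsupp.sum, map_sum]
  refine Finset.sum_congr rfl fun c _ => ?_
  rw [map_zsmul, SmoothChain.integralHom_apply, zsmul_eq_mul]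

/-- By the chain rule through `insertNth`, the coordinate tangent vectors of a face are those of the
cube with the `i`-th one left out. -/
theorem SmoothCube.face_integral {k : ℕ} (c : SmoothCube M (k + 1)) (θ : Form M k)
    (i : Fin (k + 1)) (ε : ℝ) (hε : ε ∈ Set.Icc (0 : ℝ) 1) :
    (c.face i ε hε).integral θ = ∫ t in Set.Icc (0 : Fin k → ℝ) 1,
      θ.pullBack c.toFun (i.insertNth ε t)
        (i.removeNth fun j => (Pi.single j (1 : ℝ) : Fin (k + 1) → ℝ)) := by
  refine setIntegral_congr_fun measurableSet_Icc fun t ht => ?_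
  have hmem : (i.insertNth ε t : Fin (k + 1) → ℝ) ∈ Set.Icc (0 : Fin (k + 1) → ℝ) 1 := by
    constructor
    · intro j
      refine Fin.succAboveCases i ?_ (fun l => ?_) j
      · simpa using hε.1
      · simpa using ht.1 l
    · intro j
      refine Fin.succAboveCases i ?_ (fun l => ?_) j
      · simpa using hε.2
      · simpa using ht.2 l
  let L : (Fin k → ℝ) →L[ℝ] (Fin (k + 1) → ℝ) := ContinuousLinearMap.pi fun j =>
    i.succAboveCases (0 : (Fin k → ℝ) →L[ℝ] ℝ) (fun l => ContinuousLinearMap.proj l) j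
  have hL : HasFDerivAt (fun t : Fin k → ℝ => (i.insertNth ε t : Fin (k + 1) → ℝ)) L t := by
    rw [hasFDerivAt_pi']
    intro j
    refine Fin.succAboveCases i ?_ (fun l => ?_) j
    · simpa [L, ContinuousLinearMap.proj_pi] using hasFDerivAt_const ε t
    · simpa [L, ContinuousLinearMap.proj_pi] using hasFDerivAt_apply (𝕜 := ℝ) l t
  have hLs : ∀ l, L (Pi.single l 1) = Pi.single (i.succAbove l) 1 := by
    intro l
    funext j
    refine Fin.succAboveCases i ?_ (fun m => ?_) j
    · simp [L, (Fin.succAbove_ne i l).symm]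
    · simp [L, Pi.single_apply]
  have hc : mfderiv 𝓘(ℝ, Fin k → ℝ) 𝓘(ℝ, E4) (c.face i ε hε).toFun t =
      (mfderiv 𝓘(ℝ, Fin (k + 1) → ℝ) 𝓘(ℝ, E4) c.toFun (i.insertNth ε t)).comp L := by
    rw [← hL.fderiv, ← mfderiv_eq_fderiv]
    exact mfderiv_comp t ((c.smooth _ hmem).mdifferentiableAt (by norm_num))
      hL.differentiableAt.mdifferentiableAt
  refine congrArg (θ (c.toFun (i.insertNth ε t))) (funext fun l => ?_)
  rw [hc]
  exact congrArg _ (hLs l)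

variable [IsManifold 𝓘(ℝ, E4) ∞ M]

/-- **Stokes' theorem** for a cube. -/
theorem SmoothCube.stokes {k : ℕ} (c : SmoothCube M (k + 1)) {θ : Form M k} (hθ : θ.IsSmooth) :
    c.boundary.integral θ = c.integral θ.d := by
  rw [c.boundary_integral]
  set e : Fin (k + 1) → (Fin (k + 1) → ℝ) := fun j => Pi.single j 1 with he
  have hd : ∀ t ∈ Set.Icc (0 : Fin (k + 1) → ℝ) 1, DifferentiableAt ℝ (θ.pullBack c.toFun) t :=
    fun t ht => hθ.differentiableAt_pullBack (c.smooth t ht)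
  -- The vector field on the cube whose divergence is the coefficient of `dθ`. The divergence
  -- theorem for it is Stokes' theorem, the sign `(-1)^i` being that of the `i`-th face.
  let f : Fin (k + 1) → (Fin (k + 1) → ℝ) → ℝ := fun i t =>
    (-1 : ℝ) ^ (i : ℕ) * θ.pullBack c.toFun t (i.removeNth e)
  have hf : ∀ t ∈ Set.Icc (0 : Fin (k + 1) → ℝ) 1, ∀ i, DifferentiableAt ℝ (f i) t :=
    fun t ht i => ((hd t ht).continuousAlternatingMap_apply_const _).const_mul _
  have hdiv : ∀ t ∈ Set.Icc (0 : Fin (k + 1) → ℝ) 1,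
      ∑ i, fderiv ℝ (f i) t (e i) = θ.d.pullBack c.toFun t e := by
    intro t ht
    rw [← hθ.extDeriv_pullBack (c.smooth t ht), extDeriv_apply (hd t ht)]
    refine Finset.sum_congr rfl fun i _ => ?_
    simp only [f]
    rw [fderiv_const_mul ((hd t ht).continuousAlternatingMap_apply_const _)]
    simp
  have hcont : ContinuousOn (fun t => θ.d.pullBack c.toFun t e) (Set.Icc 0 1) := fun t ht =>
    ((hθ.d.differentiableAt_pullBack (c.smooth t ht)).continuousAlternatingMap_apply_const
      e).continuousAt.continuousWithinAt
  have key := integral_divergence_of_hasFDerivAt_off_countable' (0 : Fin (k + 1) → ℝ) 1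
    (zero_le_one) f (fun i t => fderiv ℝ (f i) t) ∅ Set.countable_empty
    (fun i t ht => (hf t ht i).continuousAt.continuousWithinAt)
    (fun t ht i => (hf t ⟨fun j => (ht.1 j trivial).1.le, fun j => (ht.1 j trivial).2.le⟩
      i).hasFDerivAt)
    ((hcont.integrableOn_compact isCompact_Icc).congr_fun (fun t ht => (hdiv t ht).symm)
      measurableSet_Icc)
  have hL : c.integral θ.d = ∫ t in Set.Icc (0 : Fin (k + 1) → ℝ) 1,
      ∑ i, fderiv ℝ (f i) t (e i) :=
    setIntegral_congr_fun measurableSet_Icc fun t ht => (hdiv t ht).symm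
  rw [hL, key]
  refine Finset.sum_congr rfl fun i _ => ?_
  rw [c.face_integral, c.face_integral, mul_sub, ← integral_const_mul, ← integral_const_mul]
  rfl

/-- **Stokes' theorem** for a chain. -/
theorem SmoothChain.stokes {k : ℕ} (N : SmoothChain M (k + 1)) {θ : Form M k} (hθ : θ.IsSmooth) :
    N.boundary.integral θ = N.integral θ.d := by
  rw [N.boundary_integral]
  exact Finset.sum_congr rfl fun c _ => congrArg (fun z => (N c : ℝ) * z) (c.stokes hθ)

end Stokes

/-! ### Smoothness of chart expressions -/

section Smoothness

variable {M : Type*} [TopologicalSpace M] [ChartedSpace E4 M] [IsManifold 𝓘(ℝ, E4) ∞ M]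

/-- A coordinate vector field is the tangent map of the inverse chart applied to a constant section.
Its smoothness gives that of the metric components. -/
theorem contMDiffAt_chartSymmDeriv {x₀ : M} {y : E4} (hy : y ∈ (chartAt E4 x₀).target) (e : E4) :
    ContMDiffAt 𝓘(ℝ, E4) 𝓘(ℝ, E4).tangent ∞
      (fun y => (⟨(chartAt E4 x₀).symm y, chartSymmDeriv x₀ y e⟩ : TangentBundle 𝓘(ℝ, E4) M)) y := by
  have ho := (chartAt E4 x₀).open_target
  have h1 : ContMDiffOn 𝓘(ℝ, E4) 𝓘(ℝ, E4) ∞ (chartAt E4 x₀).symm (chartAt E4 x₀).target :=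
    fun z hz => (contMDiffAt_chart_symm hz).contMDiffWithinAt
  have h2 := h1.contMDiffOn_tangentMapWithin (m := ∞) (by norm_cast) ho.uniqueMDiffOn
  have h3 : ContMDiffAt 𝓘(ℝ, E4) 𝓘(ℝ, E4).tangent ∞
      (fun z => (⟨z, e⟩ : TangentBundle 𝓘(ℝ, E4) E4)) y :=
    contMDiffAt_vectorSpace_iff_contDiffAt (V := fun _ => e).2 contDiffAt_const
  have h4 : ContMDiffAt 𝓘(ℝ, E4) 𝓘(ℝ, E4).tangent ∞
      (fun z => tangentMapWithin 𝓘(ℝ, E4) 𝓘(ℝ, E4) (chartAt E4 x₀).symm (chartAt E4 x₀).target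
        (⟨z, e⟩ : TangentBundle 𝓘(ℝ, E4) E4)) y := by
    refine ContMDiffAt.comp y (h2.contMDiffAt ?_) h3
    exact (FiberBundle.continuous_proj E4 (TangentSpace 𝓘(ℝ, E4))).continuousAt.preimage_mem_nhds
      (ho.mem_nhds hy)
  refine h4.congr_of_eventuallyEq ?_
  filter_upwards [ho.mem_nhds hy] with z hz
  simp only [tangentMapWithin, mfderivWithin_of_isOpen ho hz]
  rfl

theorem IsSmoothVectorField.comp_chart_symm {A : ∀ x : M, TS x} (hA : IsSmoothVectorField A)
    {x₀ : M} {y : E4} (hy : y ∈ (chartAt E4 x₀).target) :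
    ContMDiffAt 𝓘(ℝ, E4) 𝓘(ℝ, E4).tangent ∞ (fun y => (⟨(chartAt E4 x₀).symm y,
      A ((chartAt E4 x₀).symm y)⟩ : TangentBundle 𝓘(ℝ, E4) M)) y :=
  ContMDiffAt.comp y (hA _) (contMDiffAt_chart_symm hy)

theorem IsSmoothVectorField.contDiffAt_vecInChart {A : ∀ x : M, TS x}
    (hA : IsSmoothVectorField A) {x₀ : M} {y : E4} (hy : y ∈ (chartAt E4 x₀).target) :
    ContDiffAt ℝ ∞ (vecInChart A x₀) y := by
  have ho := (chartAt E4 x₀).open_source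
  have h1 : ContMDiffOn 𝓘(ℝ, E4) 𝓘(ℝ, E4) ∞ (chartAt E4 x₀) (chartAt E4 x₀).source :=
    fun z hz => (contMDiffAt_chart hz).contMDiffWithinAt
  have h2 := h1.contMDiffOn_tangentMapWithin (m := ∞) (by norm_cast) ho.uniqueMDiffOn
  have h4 : ContMDiffAt 𝓘(ℝ, E4) 𝓘(ℝ, E4).tangent ∞
      (fun z => tangentMapWithin 𝓘(ℝ, E4) 𝓘(ℝ, E4) (chartAt E4 x₀) (chartAt E4 x₀).source
        (⟨(chartAt E4 x₀).symm z, A ((chartAt E4 x₀).symm z)⟩ : TangentBundle 𝓘(ℝ, E4) M)) y := by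
    refine ContMDiffAt.comp y (h2.contMDiffAt ?_) (hA.comp_chart_symm hy)
    exact (FiberBundle.continuous_proj E4
      (TangentSpace 𝓘(ℝ, E4) (M := M))).continuousAt.preimage_mem_nhds
      (ho.mem_nhds ((chartAt E4 x₀).map_target hy))
  have h5 := ((contMDiff_snd_tangentBundle_modelSpace E4 𝓘(ℝ, E4)).contMDiffAt.comp y h4).contDiffAt
  refine h5.congr_of_eventuallyEq ?_
  filter_upwards [(chartAt E4 x₀).open_target.mem_nhds hy] with z hz
  simp only [Function.comp, tangentMapWithin,
    mfderivWithin_of_isOpen ho ((chartAt E4 x₀).map_target hz)]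
  rfl

theorem Spacetime.contDiffAt_g_apply (S : Spacetime M) {x₀ : M} {y : E4}
    {V W : ∀ y : E4, TS ((chartAt E4 x₀).symm y)} (hy : y ∈ (chartAt E4 x₀).target)
    (hV : ContMDiffAt 𝓘(ℝ, E4) 𝓘(ℝ, E4).tangent ∞
      (fun y => (⟨(chartAt E4 x₀).symm y, V y⟩ : TangentBundle 𝓘(ℝ, E4) M)) y)
    (hW : ContMDiffAt 𝓘(ℝ, E4) 𝓘(ℝ, E4).tangent ∞
      (fun y => (⟨(chartAt E4 x₀).symm y, W y⟩ : TangentBundle 𝓘(ℝ, E4) M)) y) :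
    ContDiffAt ℝ ∞ (fun y => S.g ((chartAt E4 x₀).symm y) (V y) (W y)) y := by
  have : ContMDiffAt 𝓘(ℝ, E4) (𝓘(ℝ, E4).prod 𝓘(ℝ)) ∞
      (fun y => Bundle.TotalSpace.mk' ℝ (E := Bundle.Trivial M ℝ) ((chartAt E4 x₀).symm y)
        (S.g ((chartAt E4 x₀).symm y) (V y) (W y))) y := by
    apply ContMDiffAt.clm_bundle_apply₂ (F₁ := E4) (F₂ := E4)
    · exact ContMDiffAt.comp y S.smooth.contMDiffAt (contMDiffAt_chart_symm hy)
    · exact hV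
    · exact hW
  simp only [Bundle.contMDiffAt_totalSpace] at this
  exact this.2.contDiffAt

theorem Spacetime.contDiffAt_gChart (S : Spacetime M) {x₀ : M} {y : E4}
    (hy : y ∈ (chartAt E4 x₀).target) (μ ν : Fin 4) :
    ContDiffAt ℝ ∞ (fun y => S.gChart x₀ y μ ν) y :=
  S.contDiffAt_g_apply hy (contMDiffAt_chartSymmDeriv hy _) (contMDiffAt_chartSymmDeriv hy _)

theorem sum_stdVec (v : E4) : ∑ ρ, v ρ • stdVec ρ = v := by
  ext i
  simp [stdVec, Pi.single_apply]

theorem oneForm_eq_sum (η : E4 [⋀^Fin 1]→L[ℝ] ℝ) :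
    η = ∑ ρ : Fin 4, η (fun _ => stdVec ρ) •
      ContinuousAlternatingMap.ofSubsingleton ℝ E4 ℝ (0 : Fin 1) (EuclideanSpace.proj ρ) := by
  obtain ⟨L, rfl⟩ := (ContinuousAlternatingMap.ofSubsingleton ℝ E4 ℝ (0 : Fin 1)).surjective η
  ext v
  have h := congrArg L (sum_stdVec (v 0))
  rw [map_sum] at h
  simpa [mul_comm] using h.symm

theorem Spacetime.isSmooth_flat (S : Spacetime M) {A : ∀ x : M, TS x}
    (hA : IsSmoothVectorField A) : (S.flat A).IsSmooth := by
  intro x₀ y hy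
  refine ContDiffAt.contDiffWithinAt ?_
  rw [funext fun y => oneForm_eq_sum ((S.flat A).inChart x₀ y)]
  refine ContDiffAt.sum fun ρ _ => ContDiffAt.fun_smul ?_ contDiffAt_const
  exact S.contDiffAt_g_apply hy (hA.comp_chart_symm hy) (contMDiffAt_chartSymmDeriv hy _)

theorem contDiffAt_apply {k : ℕ} {η : E4 → E4 [⋀^Fin k]→L[ℝ] ℝ} {y : E4}
    (h : ContDiffAt ℝ ∞ η y) (v : Fin k → E4) : ContDiffAt ℝ ∞ (fun y => η y v) y :=
  ContDiffAt.continuousLinearMap_comp (ContinuousAlternatingMap.apply ℝ E4 ℝ v) h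

end Smoothness

/-! ### The Hodge star in an arbitrary basis -/

section HodgeAlgebra

variable {V W : Type*} [AddCommGroup V] [Module ℝ V] [TopologicalSpace V]
  [AddCommGroup W] [Module ℝ W] [TopologicalSpace W]

theorem contractFirst_apply {n p q : ℕ} (h : p + q = n) (τ : V [⋀^Fin n]→L[ℝ] ℝ) (m : Fin p → V)
    (v : Fin q → V) : contractFirst h τ m v = τ (Fin.append m v ∘ Fin.cast h.symm) := rfl

/-- With the last slots frozen, the contraction is multilinear in the inserted vectors, so these can
be expanded in a basis. -/
theorem exists_multilinear_contractFirst {n p q : ℕ} (h : p + q = n) (τ : V [⋀^Fin n]→L[ℝ] ℝ)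
    (v : Fin q → V) : ∃ F : MultilinearMap ℝ (fun _ : Fin p => V) ℝ,
      ∀ m, contractFirst h τ m v = F m := by
  subst h
  let F' := (τ.toMultilinearMap.domDomCongr finSumFinEquiv.symm).currySum
  refine ⟨⟨fun m => F' m v, fun m i x y => by simp, fun m i c x => by simp⟩, fun m => ?_⟩
  refine congrArg τ (funext fun i => ?_)
  refine Fin.addCases (fun j => ?_) (fun j => ?_) i <;> simp

omit [TopologicalSpace V] in
/-- The contraction of two multilinear maps with the help of a matrix and a family of vectors. -/
theorem sum_contract_eq {p : ℕ} (Θ F : MultilinearMap ℝ (fun _ : Fin p => V) ℝ)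
    (B : Matrix (Fin 4) (Fin 4) ℝ) (b : Fin 4 → V) :
    ∑ ν : Fin p → Fin 4, Θ (fun i => ∑ μ, B (ν i) μ • b μ) * F (fun i => b (ν i)) =
      ∑ ν : Fin p → Fin 4, ∑ r : Fin p → Fin 4, (∏ i, B (ν i) (r i)) *
        (Θ (fun i => b (r i)) * F (fun i => b (ν i))) := by
  refine Finset.sum_congr rfl fun ν _ => ?_
  rw [MultilinearMap.map_sum, Finset.sum_mul]
  refine Finset.sum_congr rfl fun r _ => ?_
  rw [MultilinearMap.map_smul_univ, smul_eq_mul, mul_assoc]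

-- The contraction pairs each slot of `Θ` with the same slot of `F`, so a change of basis acts on
-- each pair separately and turns `B'` into `Pᵀ B' P`.
omit [TopologicalSpace V] in
theorem sum_contract_change {p : ℕ} (Θ F : MultilinearMap ℝ (fun _ : Fin p => V) ℝ)
    {B B' P : Matrix (Fin 4) (Fin 4) ℝ} {b b' : Fin 4 → V} (hb : ∀ ν, b' ν = ∑ μ, P ν μ • b μ)
    (hB : Pᵀ * B' * P = B) :
    ∑ ν : Fin p → Fin 4, Θ (fun i => ∑ μ, B' (ν i) μ • b' μ) * F (fun i => b' (ν i)) =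
      ∑ ν : Fin p → Fin 4, Θ (fun i => ∑ μ, B (ν i) μ • b μ) * F (fun i => b (ν i)) := by
  have h1 : ∀ ν, ∑ μ, B' ν μ • b' μ = ∑ μ, (B' * P) ν μ • b μ := by
    intro ν
    simp only [hb, Finset.smul_sum, smul_smul, Matrix.mul_apply, Finset.sum_smul]
    exact Finset.sum_comm
  have h2 : ∀ (ν : Fin p → Fin 4), F (fun i => b' (ν i)) =
      ∑ s : Fin p → Fin 4, (∏ i, P (ν i) (s i)) * F (fun i => b (s i)) := by
    intro ν
    simp only [hb]
    rw [MultilinearMap.map_sum]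
    exact Finset.sum_congr rfl fun s _ => by rw [MultilinearMap.map_smul_univ, smul_eq_mul]
  have h3 : ∀ (ν : Fin p → Fin 4), Θ (fun i => ∑ μ, B' (ν i) μ • b' μ) =
      ∑ r : Fin p → Fin 4, (∏ i, (B' * P) (ν i) (r i)) * Θ (fun i => b (r i)) := by
    intro ν
    simp only [h1]
    rw [MultilinearMap.map_sum]
    exact Finset.sum_congr rfl fun s _ => by rw [MultilinearMap.map_smul_univ, smul_eq_mul]
  -- A sum over multi-indices of a product over slots is the product of the single-index sums, which
  -- are the entries of `Pᵀ B' P`.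
  have h4 : ∀ s r : Fin p → Fin 4, ∑ ν : Fin p → Fin 4,
      (∏ i, P (ν i) (s i)) * ∏ i, (B' * P) (ν i) (r i) = ∏ i, B (s i) (r i) := by
    intro s r
    have h5 : ∀ i, B (s i) (r i) = ∑ j, P j (s i) * (B' * P) j (r i) := by
      intro i
      rw [← hB, Matrix.mul_assoc, Matrix.mul_apply]
      rfl
    simp only [h5]
    rw [Fintype.prod_sum]
    exact Finset.sum_congr rfl fun ν _ => Finset.prod_mul_distrib.symm
  calc ∑ ν : Fin p → Fin 4, Θ (fun i => ∑ μ, B' (ν i) μ • b' μ) * F (fun i => b' (ν i))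
      = ∑ ν : Fin p → Fin 4, ∑ s : Fin p → Fin 4, ∑ r : Fin p → Fin 4,
          ((∏ i, P (ν i) (s i)) * ∏ i, (B' * P) (ν i) (r i)) *
            (Θ (fun i => b (r i)) * F (fun i => b (s i))) := by
        refine Finset.sum_congr rfl fun ν _ => ?_
        rw [h3, h2, mul_comm, Finset.sum_mul_sum]
        exact Finset.sum_congr rfl fun s _ => Finset.sum_congr rfl fun r _ => by ring
    _ = ∑ s : Fin p → Fin 4, ∑ r : Fin p → Fin 4, ∑ ν : Fin p → Fin 4,
          ((∏ i, P (ν i) (s i)) * ∏ i, (B' * P) (ν i) (r i)) *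
            (Θ (fun i => b (r i)) * F (fun i => b (s i))) := by
        rw [Finset.sum_comm]
        exact Finset.sum_congr rfl fun s _ => Finset.sum_comm
    _ = _ := by
        rw [sum_contract_eq]
        refine Finset.sum_congr rfl fun s _ => Finset.sum_congr rfl fun r _ => ?_
        rw [← Finset.sum_mul, h4]

/-- The Hodge star computed with the basis `b`, the inverse Gram matrix `B` and the volume
form `τ`. -/
def starAt {p q n : ℕ} (h : p + q = n) (B : Matrix (Fin 4) (Fin 4) ℝ) (b : Fin 4 → V)
    (τ : V [⋀^Fin n]→L[ℝ] ℝ) (θ : V [⋀^Fin p]→L[ℝ] ℝ) : V [⋀^Fin q]→L[ℝ] ℝ :=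
  ((p.factorial : ℝ)⁻¹) • ∑ ν : Fin p → Fin 4,
    θ (fun i => ∑ μ, B (ν i) μ • b μ) • contractFirst h τ (fun i => b (ν i))

theorem starAt_apply {p q n : ℕ} (h : p + q = n) (B : Matrix (Fin 4) (Fin 4) ℝ) (b : Fin 4 → V)
    (τ : V [⋀^Fin n]→L[ℝ] ℝ) (θ : V [⋀^Fin p]→L[ℝ] ℝ) (v : Fin q → V) :
    starAt h B b τ θ v = ((p.factorial : ℝ)⁻¹) * ∑ ν : Fin p → Fin 4,
      θ (fun i => ∑ μ, B (ν i) μ • b μ) * contractFirst h τ (fun i => b (ν i)) v := by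
  simp [starAt]

theorem starAt_change {p q n : ℕ} (h : p + q = n) {B B' P : Matrix (Fin 4) (Fin 4) ℝ}
    {b b' : Fin 4 → V} (hb : ∀ ν, b' ν = ∑ μ, P ν μ • b μ) (hB : Pᵀ * B' * P = B)
    (τ : V [⋀^Fin n]→L[ℝ] ℝ) (θ : V [⋀^Fin p]→L[ℝ] ℝ) :
    starAt (q := q) h B' b' τ θ = starAt h B b τ θ := by
  ext v
  obtain ⟨F, hF⟩ := exists_multilinear_contractFirst h τ v
  simp only [starAt_apply, hF]
  exact congrArg _ (sum_contract_change θ.toMultilinearMap F hb hB)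

theorem starAt_comp {p q n : ℕ} (h : p + q = n) (B : Matrix (Fin 4) (Fin 4) ℝ) (e : Fin 4 → W)
    (L : W →L[ℝ] V) (τ : V [⋀^Fin n]→L[ℝ] ℝ) (θ : V [⋀^Fin p]→L[ℝ] ℝ) :
    (starAt (q := q) h B (fun ν => L (e ν)) τ θ).compContinuousLinearMap L =
      starAt h B e (τ.compContinuousLinearMap L) (θ.compContinuousLinearMap L) := by
  ext v
  simp only [ContinuousAlternatingMap.compContinuousLinearMap_apply, starAt_apply,
    contractFirst_apply, Function.comp_def, map_sum, map_smul]
  refine congrArg _ (Finset.sum_congr rfl fun ν _ => congrArg _ (congrArg τ (funext fun i => ?_)))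
  generalize Fin.cast h.symm i = j
  refine Fin.addCases (fun j => ?_) (fun j => ?_) j <;> simp

end HodgeAlgebra

/-! ### The Hodge star in a fixed chart of the manifold -/

section HodgeChart

variable {M : Type*} [TopologicalSpace M] [ChartedSpace E4 M] [IsManifold 𝓘(ℝ, E4) ∞ M]
  (S : Spacetime M)

/-- In finite dimension a one-sided inverse of an endomorphism is two-sided. -/
theorem chartSymmDeriv_comp_mfderiv {x₀ : M} {y : E4} (hy : y ∈ (chartAt E4 x₀).target)
    (v : TS ((chartAt E4 x₀).symm y)) : chartSymmDeriv x₀ y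
      (mfderiv 𝓘(ℝ, E4) 𝓘(ℝ, E4) (chartAt E4 x₀) ((chartAt E4 x₀).symm y) v) = v := by
  have h := mfderiv_chart_comp_symm hy
  have h' : (mfderiv 𝓘(ℝ, E4) 𝓘(ℝ, E4) (chartAt E4 x₀) ((chartAt E4 x₀).symm y) :
      E4 →L[ℝ] E4).toLinearMap ∘ₗ (chartSymmDeriv x₀ y : E4 →L[ℝ] E4).toLinearMap =
        LinearMap.id := by
    ext1 w
    exact congrArg (fun L => L w) h
  exact congrArg (fun L : E4 →ₗ[ℝ] E4 => L v) ((LinearMap.comp_eq_id_comm ℝ E4).1 h')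

namespace Spacetime

theorem gram_change {x₀ : M} {y : E4} (hy : y ∈ (chartAt E4 x₀).target) :
    ∃ P : Matrix (Fin 4) (Fin 4) ℝ,
      (∀ ν, coordVec ((chartAt E4 x₀).symm y) ν = ∑ μ, P ν μ • chartSymmDeriv x₀ y (stdVec μ)) ∧
      S.gram ((chartAt E4 x₀).symm y) = P * S.gChart x₀ y * Pᵀ := by
  let c : E4 → Fin 4 → ℝ := fun w => w
  -- The Jacobian of the transition from the preferred chart at the point to the chart at `x₀`, one
  -- row per coordinate vector.
  let P : Matrix (Fin 4) (Fin 4) ℝ := Matrix.of fun ν => c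
    (mfderiv 𝓘(ℝ, E4) 𝓘(ℝ, E4) (chartAt E4 x₀) ((chartAt E4 x₀).symm y)
      (coordVec ((chartAt E4 x₀).symm y) ν))
  have hP : ∀ ν, coordVec ((chartAt E4 x₀).symm y) ν =
      ∑ μ, P ν μ • chartSymmDeriv x₀ y (stdVec μ) := by
    intro ν
    simp only [← map_smul, ← map_sum]
    refine (chartSymmDeriv_comp_mfderiv hy _).symm.trans (congrArg _ ?_)
    exact (sum_stdVec _).symm
  refine ⟨P, hP, ?_⟩
  ext μ ν
  simp only [gram, Matrix.of_apply, hP, map_sum, map_smul, _root_.sum_apply,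
    _root_.smul_apply, Matrix.mul_apply, Matrix.transpose_apply, gChart,
    smul_eq_mul, Finset.sum_mul, Finset.mul_sum]
  exact Finset.sum_congr rfl fun a _ => Finset.sum_congr rfl fun b _ => by ring

/-- An orthonormal frame makes the Gram matrix congruent to `diag(1,-1,-1,-1)`, whose determinant is
nonzero. -/
theorem isUnit_gram_det (x : M) : IsUnit (S.gram x).det := by
  obtain ⟨b, hb⟩ := S.signature x
  let c : E4 → Fin 4 → ℝ := fun w => w
  let Q : Matrix (Fin 4) (Fin 4) ℝ := Matrix.of fun i => c (b i)
  have hQ : ∀ i, b i = ∑ μ, Q i μ • coordVec x μ := fun i => (sum_stdVec (b i)).symm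
  have h : Q * S.gram x * Qᵀ = Matrix.diagonal ![1, -1, -1, -1] := by
    ext i j
    rw [← hb i j, hQ i, hQ j]
    simp only [gram, Matrix.of_apply, map_sum, map_smul, _root_.sum_apply,
      _root_.smul_apply, Matrix.mul_apply, Matrix.transpose_apply,
      smul_eq_mul, Finset.sum_mul, Finset.mul_sum]
    exact Finset.sum_congr rfl fun a _ => Finset.sum_congr rfl fun b _ => by ring
  have hd := congrArg Matrix.det h
  rw [Matrix.det_mul, Matrix.det_mul, Matrix.det_diagonal] at hd
  simp only [Fin.prod_univ_four] at hd
  norm_num at hd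
  refine isUnit_iff_ne_zero.2 fun h0 => ?_
  simp [h0] at hd

theorem isUnit_gChart_det {x₀ : M} {y : E4} (hy : y ∈ (chartAt E4 x₀).target) :
    IsUnit (S.gChart x₀ y).det := by
  obtain ⟨P, -, hP⟩ := S.gram_change hy
  have h := S.isUnit_gram_det ((chartAt E4 x₀).symm y)
  rw [hP, Matrix.det_mul, Matrix.det_mul] at h
  exact isUnit_of_mul_isUnit_right (isUnit_of_mul_isUnit_left h)

/-- `hodge` uses a basis attached to each point. Independence of the basis (`starAt_change`) and
naturality under linear maps (`starAt_comp`) give a single formula on a whole chart, which can be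
differentiated. -/
theorem inChart_hodge {p q : ℕ} (h : p + q = 4) (θ : Form M p) {x₀ : M} {y : E4}
    (hy : y ∈ (chartAt E4 x₀).target) : (S.hodge h θ).inChart x₀ y =
      starAt h (S.gChart x₀ y)⁻¹ stdVec (S.vol.inChart x₀ y) (θ.inChart x₀ y) := by
  obtain ⟨P, hb, hP⟩ := S.gram_change hy
  have hu := S.isUnit_gram_det ((chartAt E4 x₀).symm y)
  rw [hP, Matrix.det_mul, Matrix.det_mul, Matrix.det_transpose] at hu
  have hPu : IsUnit P.det := isUnit_of_mul_isUnit_right hu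
  have hB : Pᵀ * (S.gram ((chartAt E4 x₀).symm y))⁻¹ * P = (S.gChart x₀ y)⁻¹ := by
    have hPt : IsUnit Pᵀ.det := by rwa [Matrix.det_transpose]
    rw [hP, Matrix.mul_inv_rev, Matrix.mul_inv_rev, ← Matrix.mul_assoc,
      Matrix.mul_nonsing_inv _ hPt, Matrix.one_mul, Matrix.mul_assoc,
      Matrix.nonsing_inv_mul _ hPu, Matrix.mul_one]
  have h1 := starAt_change (q := q) h hb hB (S.vol ((chartAt E4 x₀).symm y))
    (θ ((chartAt E4 x₀).symm y))
  exact (congrArg (fun F => F.compContinuousLinearMap (chartSymmDeriv x₀ y)) h1).trans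
    (starAt_comp h _ stdVec (chartSymmDeriv x₀ y) _ _)

end Spacetime

end HodgeChart

/-! ### The Hodge star of forms on `ℝ⁴` -/

section Levi

/-- The standard basis of `ℝ⁴`. -/
def stdBasis : Module.Basis (Fin 4) ℝ E4 := (EuclideanSpace.basisFun (Fin 4) ℝ).toBasis

theorem stdBasis_apply (i : Fin 4) : stdBasis i = stdVec i := by
  simp [stdBasis, stdVec]

theorem volume_apply (τ : E4 [⋀^Fin 4]→L[ℝ] ℝ) (w : Fin 4 → E4) :
    τ w = τ stdVec * (Matrix.of fun i j => w i j).det := by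
  have h := congrArg (fun f => f w) (τ.toAlternatingMap.eq_smul_basis_det stdBasis)
  have h2 : stdBasis.toMatrix w = (Matrix.of fun i j => w i j)ᵀ := by
    ext i j
    simp [stdBasis, Module.Basis.toMatrix_apply]
  have h3 : (stdBasis : Fin 4 → E4) = stdVec := funext stdBasis_apply
  simpa [Module.Basis.det_apply, h2, h3, Matrix.det_transpose] using h

/-- The Vandermonde product, `12` times the sign symbol of `Fin 4`. -/
def vdm (ν : Fin 4 → Fin 4) : ℤ :=
  ((ν 1 : ℕ) - (ν 0 : ℕ) : ℤ) * ((ν 2 : ℕ) - (ν 0 : ℕ)) * ((ν 3 : ℕ) - (ν 0 : ℕ)) *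
    ((ν 2 : ℕ) - (ν 1 : ℕ)) * ((ν 3 : ℕ) - (ν 1 : ℕ)) * ((ν 3 : ℕ) - (ν 2 : ℕ))

/-- Selecting rows along `ν` is left multiplication by a 0-1 matrix `O`. Applying `O` to the
Vandermonde matrix of `0,1,2,3`, of determinant `12`, gives `12 det O = vdm ν`. The sign symbol thus
becomes an integer polynomial, and its contractions can be decided by evaluation. -/
theorem det_submatrix_eq (A : Matrix (Fin 4) (Fin 4) ℝ) (ν : Fin 4 → Fin 4) :
    12 * (A.submatrix ν id).det = vdm ν * A.det := by
  have h0 : ∀ u : Fin 4 → Fin 4, (Matrix.vandermonde fun i => ((u i : ℕ) : ℝ)).det = vdm u := by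
    intro u
    rw [Matrix.det_vandermonde]
    have i0 : Finset.Ioi (0 : Fin 4) = {1, 2, 3} := by decide
    have i1 : Finset.Ioi (1 : Fin 4) = {2, 3} := by decide
    have i2 : Finset.Ioi (2 : Fin 4) = {3} := by decide
    have i3 : Finset.Ioi (3 : Fin 4) = ∅ := by decide
    simp [Fin.prod_univ_four, vdm, i0, i1, i2, i3]
    left
    ring
  let O : Matrix (Fin 4) (Fin 4) ℝ := Matrix.of fun i j => if ν i = j then 1 else 0
  have h1 : O * A = A.submatrix ν id := by
    ext i j
    simp [O, Matrix.mul_apply]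
  have h2 : O * (Matrix.vandermonde fun i : Fin 4 => ((i : ℕ) : ℝ)) =
      Matrix.vandermonde fun i => ((ν i : ℕ) : ℝ) := by
    ext i j
    simp [O, Matrix.mul_apply, Matrix.vandermonde]
  have h3 := congrArg Matrix.det h2
  have h4 := h0 id
  have h5 : vdm id = 12 := by decide
  simp only [id, h5] at h4
  rw [Matrix.det_mul, h0 ν, h4] at h3
  rw [← h1, Matrix.det_mul, ← h3]
  push_cast
  ring

/-- The value is `-864 = -(12² · 3!)`: there are `3!` orderings of the other indices, and moving one
index past three others costs a sign. -/
theorem sum_vdm_three : ∀ c l : Fin 4, ∑ ν : Fin 3 → Fin 4,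
    vdm (Fin.append (fun _ : Fin 1 => c) ν) * vdm (Fin.append ν (fun _ : Fin 1 => l)) =
      if c = l then -864 else 0 := by
  decide +kernel

theorem sum_vdm_four : ∑ ν : Fin 4 → Fin 4, vdm ν * vdm ν = 3456 := by
  decide +kernel

theorem volume_comp (τ : E4 [⋀^Fin 4]→L[ℝ] ℝ) (B : Matrix (Fin 4) (Fin 4) ℝ)
    (ν : Fin 4 → Fin 4) :
    12 * τ (fun i => ∑ μ, B (ν i) μ • stdVec μ) = τ stdVec * B.det * vdm ν := by
  have h : (Matrix.of fun i j => (∑ μ, B (ν i) μ • stdVec μ : E4) j) = B.submatrix ν id := by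
    ext i j
    simp [stdVec, Pi.single_apply]
  rw [volume_apply, h]
  linear_combination τ stdVec * det_submatrix_eq B ν

theorem volume_comp_stdVec (τ : E4 [⋀^Fin 4]→L[ℝ] ℝ) (ν : Fin 4 → Fin 4) :
    12 * τ (fun i => stdVec (ν i)) = τ stdVec * vdm ν := by
  simpa [Matrix.one_apply] using volume_comp τ 1 ν

theorem append_comp {α β : Type*} (f : α → β) {p q : ℕ} (u : Fin p → α) (v : Fin q → α) :
    Fin.append (fun i => f (u i)) (fun i => f (v i)) = fun i => f (Fin.append u v i) := by
  funext i
  refine Fin.addCases (fun j => ?_) (fun j => ?_) i <;> simp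

variable {B G : Matrix (Fin 4) (Fin 4) ℝ} {τ : E4 [⋀^Fin 4]→L[ℝ] ℝ}

/-- For `B = g⁻¹` the hypothesis says `v² = -det g`. The sum of squared sign symbols is `4!`,
cancelled by the prefactor, so only this Lorentzian sign is left. -/
theorem starAt_volume (hB : τ stdVec ^ 2 * B.det = -1) :
    starAt (n := 4) (p := 4) (q := 0) rfl B stdVec τ τ =
      ContinuousAlternatingMap.constOfIsEmpty ℝ E4 (Fin 0) (-1 : ℝ) := by
  ext v
  have h1 : ∀ ν : Fin 4 → Fin 4, τ (fun i => ∑ μ, B (ν i) μ • stdVec μ) *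
      contractFirst (n := 4) (q := 0) rfl τ (fun i => stdVec (ν i)) v =
        (τ stdVec ^ 2 * B.det) * ((vdm ν * vdm ν : ℤ) : ℝ) / 144 := by
    intro ν
    have h2 : contractFirst (n := 4) (q := 0) rfl τ (fun i => stdVec (ν i)) v =
        τ (fun i => stdVec (ν i)) := by
      rw [contractFirst_apply]
      refine congrArg τ (funext fun i => ?_)
      exact Fin.append_left (fun i => stdVec (ν i)) v i
    have h3 := volume_comp τ B ν
    have h4 := volume_comp_stdVec τ ν
    rw [h2]
    push_cast
    linear_combination (1 / 12) * τ (fun i => stdVec (ν i)) * h3 +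
      (1 / 144) * τ stdVec * B.det * vdm ν * h4
  rw [starAt_apply]
  simp only [h1]
  rw [← Finset.sum_div, ← Finset.mul_sum, ← Int.cast_sum, sum_vdm_four, hB]
  norm_num [Nat.factorial]

theorem sum_fin_one {α : Type*} [AddCommMonoid α] (f : (Fin 1 → Fin 4) → α) :
    ∑ ν, f ν = ∑ a, f (fun _ => a) :=
  Fintype.sum_equiv (Equiv.funUnique (Fin 1) (Fin 4)) _ _ fun ν =>
    congrArg f (funext fun i => by rw [Subsingleton.elim i 0]; rfl)

theorem sum_fin_two {α : Type*} [AddCommMonoid α] (f : (Fin 2 → Fin 4) → α) :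
    ∑ ν, f ν = ∑ a, ∑ b, f ![a, b] := by
  rw [← Fintype.sum_prod_type']
  exact Fintype.sum_equiv (finTwoArrowEquiv (Fin 4)) _ _ fun ν =>
    congrArg f (funext fun i => by fin_cases i <;> rfl)

theorem starAt_one (θ : E4 [⋀^Fin 1]→L[ℝ] ℝ) :
    starAt (n := 4) (q := 3) rfl B stdVec τ θ =
      ∑ a, (∑ c, B a c * θ (fun _ => stdVec c)) •
        contractFirst (n := 4) rfl τ (fun _ => stdVec a) := by
  obtain ⟨L, rfl⟩ := (ContinuousAlternatingMap.ofSubsingleton ℝ E4 ℝ (0 : Fin 1)).surjective θ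
  rw [starAt, sum_fin_one]
  simp

theorem starAt_two (θ : E4 [⋀^Fin 2]→L[ℝ] ℝ) :
    starAt (n := 4) (q := 2) rfl B stdVec τ θ = (1 / 2 : ℝ) • ∑ a, ∑ b,
      (∑ c, ∑ d, B a c * B b d * θ ![stdVec c, stdVec d]) •
        contractFirst (n := 4) rfl τ ![stdVec a, stdVec b] := by
  have h1 : ∀ ν : Fin 2 → Fin 4, θ (fun i => ∑ μ, B (ν i) μ • stdVec μ) =
      ∑ c, ∑ d, B (ν 0) c * B (ν 1) d * θ ![stdVec c, stdVec d] := by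
    intro ν
    refine (MultilinearMap.map_sum θ.toMultilinearMap _).trans ?_
    rw [sum_fin_two]
    refine Finset.sum_congr rfl fun c _ => Finset.sum_congr rfl fun d _ => ?_
    refine (MultilinearMap.map_smul_univ θ.toMultilinearMap _ _).trans ?_
    rw [Fin.prod_univ_two, smul_eq_mul]
    refine congrArg₂ _ rfl (congrArg θ (funext fun i => ?_))
    fin_cases i <;> rfl
  have h2 : ∀ a b : Fin 4, (fun i => stdVec (![a, b] i)) = ![stdVec a, stdVec b] := by
    intro a b
    funext i
    fin_cases i <;> rfl
  rw [starAt, sum_fin_two]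
  simp only [h1, h2]
  simp [Nat.factorial]

theorem starAt_starAt_one (hB : τ stdVec ^ 2 * B.det = -1) (hs : Bᵀ = B)
    (θ : E4 [⋀^Fin 1]→L[ℝ] ℝ) :
    starAt (n := 4) (p := 3) (q := 1) rfl B stdVec τ
      (starAt (n := 4) (q := 3) rfl B stdVec τ θ) = θ := by
  rw [oneForm_eq_sum (starAt (n := 4) (p := 3) (q := 1) rfl B stdVec τ _), oneForm_eq_sum θ]
  refine Finset.sum_congr rfl fun l _ => congrArg (fun z : ℝ => z • _) ?_
  rw [← oneForm_eq_sum θ]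
  set t : Fin 4 → ℝ := fun c => θ (fun _ => stdVec c)
  -- Raising all four indices of the volume form multiplies it by `det B`; what remains is the sign
  -- symbol with `c` in first place.
  have h1 : ∀ ν : Fin 3 → Fin 4, starAt (n := 4) (q := 3) rfl B stdVec τ θ
      (fun i => ∑ μ, B (ν i) μ • stdVec μ) = ∑ c, t c * (τ stdVec * B.det *
        vdm (Fin.append (fun _ : Fin 1 => c) ν) / 12) := by
    intro ν
    have h2 : ∀ c, ∑ a, B c a * contractFirst (n := 4) (p := 1) (q := 3) rfl τ (fun _ => stdVec a)
        (fun i => ∑ μ, B (ν i) μ • stdVec μ) =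
          τ stdVec * B.det * vdm (Fin.append (fun _ : Fin 1 => c) ν) / 12 := by
      intro c
      obtain ⟨F, hF⟩ := exists_multilinear_contractFirst (n := 4) (p := 1) (q := 3) rfl τ
        (fun i => ∑ μ, B (ν i) μ • stdVec μ)
      have h3 := volume_comp τ B (Fin.append (fun _ : Fin 1 => c) ν)
      have h4 : F (fun _ => ∑ a, B c a • stdVec a) =
          τ (fun i => ∑ μ, B (Fin.append (fun _ : Fin 1 => c) ν i) μ • stdVec μ) := by
        rw [← hF, contractFirst_apply]
        exact congrArg τ (append_comp (fun k => ∑ μ, B k μ • stdVec μ) (fun _ : Fin 1 => c) ν)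
      have h5 : F (fun _ => ∑ a, B c a • stdVec a) =
          ∑ a, B c a * F (fun _ => stdVec a) := by
        rw [MultilinearMap.map_sum, sum_fin_one]
        refine Finset.sum_congr rfl fun a _ => ?_
        rw [MultilinearMap.map_smul_univ]
        simp
      simp only [hF]
      rw [← h5, h4]
      linear_combination (1 / 12) * h3
    rw [starAt_one]
    simp only [ContinuousAlternatingMap.sum_apply, ContinuousAlternatingMap.smul_apply,
      ← h2, smul_eq_mul, Finset.sum_mul, Finset.mul_sum]
    rw [Finset.sum_comm]
    refine Finset.sum_congr rfl fun c _ => Finset.sum_congr rfl fun a _ => ?_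
    have : B a c = B c a := congrFun (congrFun hs c) a
    rw [this]
    ring
  have h6 : ∀ ν : Fin 3 → Fin 4, 12 * contractFirst (n := 4) (p := 3) (q := 1) rfl τ
      (fun i => stdVec (ν i)) (fun _ => stdVec l) =
        τ stdVec * vdm (Fin.append ν (fun _ : Fin 1 => l)) := by
    intro ν
    rw [← volume_comp_stdVec, contractFirst_apply]
    refine congrArg (fun z => 12 * τ z) ?_
    exact append_comp stdVec ν (fun _ : Fin 1 => l)
  have h7 : ∀ ν : Fin 3 → Fin 4, (starAt (n := 4) (q := 3) rfl B stdVec τ θ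
      (fun i => ∑ μ, B (ν i) μ • stdVec μ)) * contractFirst (n := 4) (p := 3) (q := 1) rfl τ
      (fun i => stdVec (ν i)) (fun _ => stdVec l) = ∑ c, t c * ((τ stdVec ^ 2 * B.det) / 144) *
        ((vdm (Fin.append (fun _ : Fin 1 => c) ν) *
          vdm (Fin.append ν (fun _ : Fin 1 => l)) : ℤ) : ℝ) := by
    intro ν
    rw [h1, Finset.sum_mul]
    refine Finset.sum_congr rfl fun c _ => ?_
    push_cast
    linear_combination t c * (τ stdVec * B.det *
        vdm (Fin.append (fun _ : Fin 1 => c) ν) / 144) * h6 ν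
  rw [starAt_apply]
  simp only [h7]
  rw [Finset.sum_comm]
  -- The constants combine to `(-1/144) · (-864) / 3! = 1`: the sign of the index move cancels the
  -- Lorentzian one.
  simp only [← Finset.mul_sum, ← Int.cast_sum, sum_vdm_three, hB]
  simp [Nat.factorial]
  ring

end Levi

/-! ### The exterior derivative of the Hodge star in coordinates -/

section ExtDerivStar

theorem alternatingMap_five_eq_zero (f : E4 [⋀^Fin 5]→L[ℝ] ℝ) (v : Fin 5 → E4) : f v = 0 := by
  refine f.toAlternatingMap.map_linearDependent v fun h => ?_
  have := h.fintype_card_le_finrank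
  simp at this

/-- The product of a linear form and a volume form vanishes. -/
theorem wedge_volume_eq_zero (φ : E4 →L[ℝ] ℝ) (τ : E4 [⋀^Fin 4]→L[ℝ] ℝ) (v : Fin 5 → E4) :
    ∑ i : Fin 5, (-1 : ℝ) ^ (i : ℕ) * (φ (v i) * τ (i.removeNth v)) = 0 := by
  have h := alternatingMap_five_eq_zero (.alternatizeUncurryFin (φ.smulRight τ)) v
  rw [ContinuousAlternatingMap.alternatizeUncurryFin_apply] at h
  simpa using h

theorem contractFirst_one_apply (τ : E4 [⋀^Fin 4]→L[ℝ] ℝ) (a : E4) (v : Fin 3 → E4) :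
    contractFirst (n := 4) rfl τ (fun _ : Fin 1 => a) v = τ ![a, v 0, v 1, v 2] := by
  rw [contractFirst_apply]
  refine congrArg τ (funext fun i => ?_)
  fin_cases i <;> rfl

theorem contractFirst_two_apply (τ : E4 [⋀^Fin 4]→L[ℝ] ℝ) (a b : E4) (v : Fin 2 → E4) :
    contractFirst (n := 4) rfl τ ![a, b] v = τ ![a, b, v 0, v 1] := by
  rw [contractFirst_apply]
  refine congrArg τ (funext fun i => ?_)
  fin_cases i <;> rfl

/-- The vanishing 5-form `φ ∧ τ`, evaluated with one or two fixed vectors in front, gives the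
antiderivation rules `φ ∧ i_a τ = φ(a) τ` and its two-vector analogue. -/
theorem wedge_volume_expand (φ : E4 →L[ℝ] ℝ) (τ : E4 [⋀^Fin 4]→L[ℝ] ℝ) (a b c d e : E4) :
    φ a * τ ![b, c, d, e] - φ b * τ ![a, c, d, e] + φ c * τ ![a, b, d, e]
      - φ d * τ ![a, b, c, e] + φ e * τ ![a, b, c, d] = 0 := by
  have h := wedge_volume_eq_zero φ τ ![a, b, c, d, e]
  have h0 : (0 : Fin 5).removeNth ![a, b, c, d, e] = ![b, c, d, e] := by
    funext i; fin_cases i <;> rfl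
  have h1 : (1 : Fin 5).removeNth ![a, b, c, d, e] = ![a, c, d, e] := by
    funext i; fin_cases i <;> rfl
  have h2 : (2 : Fin 5).removeNth ![a, b, c, d, e] = ![a, b, d, e] := by
    funext i; fin_cases i <;> rfl
  have h3 : (3 : Fin 5).removeNth ![a, b, c, d, e] = ![a, b, c, e] := by
    funext i; fin_cases i <;> rfl
  have h4 : (4 : Fin 5).removeNth ![a, b, c, d, e] = ![a, b, c, d] := by
    funext i; fin_cases i <;> rfl
  rw [Fin.sum_univ_five, h0, h1, h2, h3, h4] at h
  simp at h
  linear_combination h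

theorem wedge_contract_one (φ : E4 →L[ℝ] ℝ) (τ : E4 [⋀^Fin 4]→L[ℝ] ℝ) (a : E4) :
    ContinuousAlternatingMap.alternatizeUncurryFin
      (φ.smulRight (contractFirst (n := 4) (q := 3) rfl τ (fun _ : Fin 1 => a))) = φ a • τ := by
  ext v
  rw [ContinuousAlternatingMap.alternatizeUncurryFin_apply, Fin.sum_univ_four]
  have hv : v = ![v 0, v 1, v 2, v 3] := by funext i; fin_cases i <;> rfl
  have h := wedge_volume_expand φ τ a (v 0) (v 1) (v 2) (v 3)
  rw [← hv] at h
  simp [contractFirst_one_apply, Fin.removeNth, Fin.succAbove]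
  have t0 : Fin.tail v 0 = v 1 := rfl
  have t1 : Fin.tail v 1 = v 2 := rfl
  have t2 : Fin.tail v 2 = v 3 := rfl
  rw [t0, t1, t2]
  linear_combination -h

theorem wedge_contract_two (φ : E4 →L[ℝ] ℝ) (τ : E4 [⋀^Fin 4]→L[ℝ] ℝ) (a b : E4) :
    ContinuousAlternatingMap.alternatizeUncurryFin
      (φ.smulRight (contractFirst (n := 4) (q := 2) rfl τ ![a, b])) =
        φ b • contractFirst (n := 4) (q := 3) rfl τ (fun _ : Fin 1 => a) -
          φ a • contractFirst (n := 4) (q := 3) rfl τ (fun _ : Fin 1 => b) := by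
  ext v
  rw [ContinuousAlternatingMap.alternatizeUncurryFin_apply, Fin.sum_univ_three]
  have h := wedge_volume_expand φ τ a b (v 0) (v 1) (v 2)
  simp [contractFirst_one_apply, contractFirst_two_apply, Fin.removeNth, Fin.succAbove]
  have t0 : Fin.tail v 0 = v 1 := rfl
  have t1 : Fin.tail v 1 = v 2 := rfl
  rw [t0, t1]
  linear_combination h

/-- 4-forms on `ℝ⁴` form a line. A varying volume form is thus a scalar function times a frozen
`τ₀`, and `d` acts on scalar coefficients only. -/
theorem volume_eq_smul {τ₀ : E4 [⋀^Fin 4]→L[ℝ] ℝ} (h : τ₀ stdVec = 1)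
    (τ : E4 [⋀^Fin 4]→L[ℝ] ℝ) : τ = τ stdVec • τ₀ := by
  ext w
  rw [ContinuousAlternatingMap.smul_apply, volume_apply τ, volume_apply τ₀, h, one_mul, smul_eq_mul]

theorem contractFirst_smul {p q : ℕ} (h : p + q = 4) (c : ℝ) (τ : E4 [⋀^Fin 4]→L[ℝ] ℝ)
    (m : Fin p → E4) : contractFirst h (c • τ) m = c • contractFirst h τ m := by
  ext v
  simp [contractFirst_apply]

theorem extDeriv_sum_smul_const {ι : Type*} [Fintype ι] {k : ℕ} {f : ι → E4 → ℝ}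
    (η : ι → E4 [⋀^Fin k]→L[ℝ] ℝ) {y : E4} (hf : ∀ i, DifferentiableAt ℝ (f i) y) :
    extDeriv (fun z => ∑ i, f i z • η i) y =
      ∑ i, ContinuousAlternatingMap.alternatizeUncurryFin ((fderiv ℝ (f i) y).smulRight (η i)) := by
  have h : HasFDerivAt (fun z => ∑ i, f i z • η i)
      (∑ i, (fderiv ℝ (f i) y).smulRight (η i)) y :=
    HasFDerivAt.fun_sum fun i _ => (hf i).hasFDerivAt.smul_const (η i)
  rw [extDeriv, h.fderiv]
  exact map_sum (ContinuousAlternatingMap.alternatizeUncurryFinCLM (n := k) ℝ E4 ℝ) _ _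

variable {B : E4 → Matrix (Fin 4) (Fin 4) ℝ} {τ : E4 → E4 [⋀^Fin 4]→L[ℝ] ℝ} {y : E4}

/-- With `τ₀` frozen at `y`, the star is `W^a i_a τ₀`, and `dW^a ∧ i_a τ₀ = (∂_a W^a) τ₀`. -/
theorem extDeriv_starAt_one {η : E4 → E4 [⋀^Fin 1]→L[ℝ] ℝ} (hv : τ y stdVec ≠ 0)
    (hW : ∀ a, DifferentiableAt ℝ
      (fun z => τ z stdVec * ∑ c, B z a c * η z (fun _ => stdVec c)) y) :
    extDeriv (fun z => starAt (n := 4) (q := 3) rfl (B z) stdVec (τ z) (η z)) y =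
      ((τ y stdVec)⁻¹ * ∑ a, pd a
        (fun z => τ z stdVec * ∑ c, B z a c * η z (fun _ => stdVec c)) y) • τ y := by
  set τ₀ := (τ y stdVec)⁻¹ • τ y with hτ₀
  have h1 : τ₀ stdVec = 1 := by simp [hτ₀, hv]
  have h2 : (fun z => starAt (n := 4) (q := 3) rfl (B z) stdVec (τ z) (η z)) = fun z => ∑ a,
      (τ z stdVec * ∑ c, B z a c * η z (fun _ => stdVec c)) •
        contractFirst (n := 4) (q := 3) rfl τ₀ (fun _ => stdVec a) := by
    funext z
    rw [starAt_one]
    refine Finset.sum_congr rfl fun a _ => ?_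
    conv_lhs => rw [volume_eq_smul h1 (τ z)]
    rw [contractFirst_smul, smul_smul, mul_comm]
  rw [h2, extDeriv_sum_smul_const _ hW]
  simp only [wedge_contract_one]
  rw [← Finset.sum_smul, hτ₀, smul_smul, mul_comm]
  rfl

/-- With `τ₀` frozen at `y`, the star is `½ W^{ab} i_{ab} τ₀` with `W` antisymmetric, and its
derivative is `-(∂_a W^{ab}) i_b τ₀`. -/
theorem extDeriv_starAt_two {η : E4 → E4 [⋀^Fin 2]→L[ℝ] ℝ} (hv : τ y stdVec ≠ 0)
    (hW : ∀ a b, DifferentiableAt ℝ (fun z => τ z stdVec *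
      ∑ c, ∑ d, B z a c * B z b d * η z ![stdVec c, stdVec d]) y) :
    extDeriv (fun z => starAt (n := 4) (q := 2) rfl (B z) stdVec (τ z) (η z)) y =
      ∑ b, (-(τ y stdVec)⁻¹ * ∑ a, pd a (fun z => τ z stdVec *
        ∑ c, ∑ d, B z a c * B z b d * η z ![stdVec c, stdVec d]) y) •
          contractFirst (n := 4) (q := 3) rfl (τ y) (fun _ => stdVec b) := by
  set τ₀ := (τ y stdVec)⁻¹ • τ y with hτ₀
  have h1 : τ₀ stdVec = 1 := by simp [hτ₀, hv]
  set W : Fin 4 → Fin 4 → E4 → ℝ := fun a b z => τ z stdVec *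
      ∑ c, ∑ d, B z a c * B z b d * η z ![stdVec c, stdVec d] with hWdef
  have hanti : ∀ a b, W b a = -W a b := by
    intro a b
    funext z
    have : ∀ c d : Fin 4, η z ![stdVec d, stdVec c] = -η z ![stdVec c, stdVec d] := by
      intro c d
      have h := (η z).toAlternatingMap.map_swap ![stdVec c, stdVec d] (i := 0) (j := 1) (by decide)
      rw [← ContinuousAlternatingMap.coe_toAlternatingMap, ← h]
      refine congrArg _ (funext fun i => ?_)
      fin_cases i <;> rfl
    simp only [hWdef, Pi.neg_apply, ← mul_neg, ← Finset.sum_neg_distrib]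
    rw [Finset.sum_comm]
    refine congrArg _ (Finset.sum_congr rfl fun c _ => Finset.sum_congr rfl fun d _ => ?_)
    rw [this c d]
    ring
  have h2 : (fun z => starAt (n := 4) (q := 2) rfl (B z) stdVec (τ z) (η z)) =
      fun z => ∑ i : Fin 4 × Fin 4, W i.1 i.2 z •
        ((1 / 2 : ℝ) • contractFirst (n := 4) (q := 2) rfl τ₀ ![stdVec i.1, stdVec i.2]) := by
    funext z
    rw [starAt_two, Finset.smul_sum, Fintype.sum_prod_type]
    refine Finset.sum_congr rfl fun a _ => ?_
    rw [Finset.smul_sum]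
    refine Finset.sum_congr rfl fun b _ => ?_
    conv_lhs => rw [volume_eq_smul h1 (τ z)]
    rw [contractFirst_smul, smul_smul, smul_smul, smul_smul]
    congr 1
    simp only [hWdef]
    ring
  have h3 : ∀ a b, ContinuousAlternatingMap.alternatizeUncurryFin
      ((fderiv ℝ (W a b) y).smulRight
        ((1 / 2 : ℝ) • contractFirst (n := 4) (q := 2) rfl τ₀ ![stdVec a, stdVec b])) =
      (1 / 2 : ℝ) • (pd b (W a b) y • contractFirst (n := 4) (q := 3) rfl τ₀ (fun _ => stdVec a) -
        pd a (W a b) y • contractFirst (n := 4) (q := 3) rfl τ₀ (fun _ => stdVec b)) := by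
    intro a b
    rw [pd, pd, ← wedge_contract_two, ← ContinuousAlternatingMap.alternatizeUncurryFin_smul]
    congr 1
    ext1 w
    simp only [ContinuousLinearMap.smulRight_apply, _root_.smul_apply]
    rw [smul_comm]
  have h4 : ∀ a b, pd b (W a b) y = -pd b (W b a) y := by
    intro a b
    rw [hanti b a, pd, pd]
    simp [fderiv_neg]
  rw [h2, extDeriv_sum_smul_const (f := fun i : Fin 4 × Fin 4 => W i.1 i.2) _
    fun i => hW i.1 i.2, Fintype.sum_prod_type]
  simp only [h3, ← Finset.smul_sum, Finset.sum_sub_distrib]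
  -- By antisymmetry of `W`, the two terms of `wedge_contract_two` sum to the same quantity, which
  -- cancels the factor `½`.
  have h5 : ∑ a, ∑ b, pd b (W a b) y • contractFirst (n := 4) (q := 3) rfl τ₀ (fun _ => stdVec a) =
      -∑ a, ∑ b, pd a (W a b) y • contractFirst (n := 4) (q := 3) rfl τ₀ (fun _ => stdVec b) := by
    rw [Finset.sum_comm]
    simp only [h4]
    rw [← Finset.sum_neg_distrib]
    refine Finset.sum_congr rfl fun b _ => ?_
    rw [← Finset.sum_neg_distrib]
    exact Finset.sum_congr rfl fun a _ => by ext v; simp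
  rw [h5, ← neg_add', smul_neg, ← two_smul ℝ, smul_smul, Finset.sum_comm]
  norm_num
  rw [← Finset.sum_neg_distrib]
  refine Finset.sum_congr rfl fun b _ => ?_
  rw [← Finset.sum_smul, hτ₀, contractFirst_smul, smul_smul, ← neg_smul]
  congr 1
  ring

end ExtDerivStar

/-! ### Partial derivatives of functions, vectors and matrices -/

section Calculus

variable {y : E4} {f g : E4 → ℝ} {α β : Fin 4}

theorem pd_add (hf : ContDiffAt ℝ ∞ f y) (hg : ContDiffAt ℝ ∞ g y) :
    pd α (fun z => f z + g z) y = pd α f y + pd α g y := by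
  rw [pd, fderiv_fun_add (hf.differentiableAt (by norm_num)) (hg.differentiableAt (by norm_num))]
  rfl

theorem pd_sub (hf : ContDiffAt ℝ ∞ f y) (hg : ContDiffAt ℝ ∞ g y) :
    pd α (fun z => f z - g z) y = pd α f y - pd α g y := by
  rw [pd, fderiv_fun_sub (hf.differentiableAt (by norm_num)) (hg.differentiableAt (by norm_num))]
  rfl

theorem pd_neg : pd α (fun z => -f z) y = -pd α f y := by
  rw [pd, fderiv_fun_neg]
  rfl

theorem pd_mul (hf : ContDiffAt ℝ ∞ f y) (hg : ContDiffAt ℝ ∞ g y) :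
    pd α (fun z => f z * g z) y = pd α f y * g y + f y * pd α g y := by
  rw [pd, fderiv_fun_mul (hf.differentiableAt (by norm_num)) (hg.differentiableAt (by norm_num))]
  simp [pd]
  ring

theorem pd_sum {ι : Type*} {s : Finset ι} {F : ι → E4 → ℝ}
    (h : ∀ i ∈ s, ContDiffAt ℝ ∞ (F i) y) :
    pd α (fun z => ∑ i ∈ s, F i z) y = ∑ i ∈ s, pd α (F i) y := by
  rw [pd, fderiv_fun_sum fun i hi => (h i hi).differentiableAt (by norm_num)]
  simp [pd]

theorem pd_congr (h : f =ᶠ[𝓝 y] g) : pd α f y = pd α g y := by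
  rw [pd, h.fderiv_eq, pd]

theorem contDiffAt_pd (hf : ContDiffAt ℝ ∞ f y) : ContDiffAt ℝ ∞ (pd α f) y :=
  (hf.fderiv_right (m := ∞) (by norm_cast)).clm_apply contDiffAt_const

theorem pd_comm (hf : ContDiffAt ℝ ∞ f y) : pd α (pd β f) y = pd β (pd α f) y := by
  have hd : DifferentiableAt ℝ (fderiv ℝ f) y :=
    (hf.fderiv_right (m := 1) (by norm_cast)).differentiableAt (by norm_num)
  have h : ∀ v w : E4, fderiv ℝ (fun z => fderiv ℝ f z v) y w = fderiv ℝ (fderiv ℝ f) y w v := by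
    intro v w
    rw [fderiv_clm_apply hd (differentiableAt_const v)]
    simp
  have hs := (hf.of_le (m := 2) (by norm_cast)).isSymmSndFDerivAt (by simp)
  exact (h _ _).trans ((hs _ _).trans (h _ _).symm)

/-- A matrix-valued function has smooth entries at a point. -/
def SmoothMat (F : E4 → Matrix (Fin 4) (Fin 4) ℝ) (y : E4) : Prop :=
  ∀ i j, ContDiffAt ℝ ∞ (fun z => F z i j) y

/-- A vector-valued function has smooth entries at a point. -/
def SmoothVec (u : E4 → Fin 4 → ℝ) (y : E4) : Prop :=
  ∀ i, ContDiffAt ℝ ∞ (fun z => u z i) y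

/-- The entrywise partial derivative of a matrix. -/
def pdMat (α : Fin 4) (F : E4 → Matrix (Fin 4) (Fin 4) ℝ) (y : E4) : Matrix (Fin 4) (Fin 4) ℝ :=
  Matrix.of fun i j => pd α (fun z => F z i j) y

/-- The entrywise partial derivative of a vector. -/
def pdVec (α : Fin 4) (u : E4 → Fin 4 → ℝ) (y : E4) : Fin 4 → ℝ :=
  fun i => pd α (fun z => u z i) y

variable {F K : E4 → Matrix (Fin 4) (Fin 4) ℝ} {u w : E4 → Fin 4 → ℝ}

theorem SmoothMat.mul (hF : SmoothMat F y) (hK : SmoothMat K y) :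
    SmoothMat (fun z => F z * K z) y := fun i j => by
  simp only [Matrix.mul_apply]
  exact ContDiffAt.sum fun k _ => (hF i k).mul (hK k j)

theorem SmoothMat.sub (hF : SmoothMat F y) (hK : SmoothMat K y) :
    SmoothMat (fun z => F z - K z) y := fun i j => (hF i j).sub (hK i j)

theorem SmoothMat.transpose (hF : SmoothMat F y) : SmoothMat (fun z => (F z)ᵀ) y :=
  fun i j => hF j i

theorem SmoothMat.mulVec (hF : SmoothMat F y) (hu : SmoothVec u y) :
    SmoothVec (fun z => F z *ᵥ u z) y := fun i => by
  simp only [Matrix.mulVec, dotProduct]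
  exact ContDiffAt.sum fun k _ => (hF i k).mul (hu k)

theorem SmoothVec.pdVec (hu : SmoothVec u y) : SmoothVec (pdVec α u) y :=
  fun i => contDiffAt_pd (hu i)

theorem pdMat_mul (hF : SmoothMat F y) (hK : SmoothMat K y) :
    pdMat α (fun z => F z * K z) y = pdMat α F y * K y + F y * pdMat α K y := by
  ext i j
  simp only [pdMat, Matrix.of_apply, Matrix.mul_apply, Matrix.add_apply]
  rw [pd_sum fun k _ => (hF i k).mul (hK k j), ← Finset.sum_add_distrib]
  exact Finset.sum_congr rfl fun k _ => pd_mul (hF i k) (hK k j)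

theorem pdMat_add (hF : SmoothMat F y) (hK : SmoothMat K y) :
    pdMat α (fun z => F z + K z) y = pdMat α F y + pdMat α K y := by
  ext i j
  exact pd_add (hF i j) (hK i j)

theorem pdMat_sub (hF : SmoothMat F y) (hK : SmoothMat K y) :
    pdMat α (fun z => F z - K z) y = pdMat α F y - pdMat α K y := by
  ext i j
  exact pd_sub (hF i j) (hK i j)

theorem pdMat_transpose : pdMat α (fun z => (F z)ᵀ) y = (pdMat α F y)ᵀ := rfl

theorem pdMat_congr (h : F =ᶠ[𝓝 y] K) : pdMat α F y = pdMat α K y := by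
  ext i j
  exact pd_congr (h.mono fun z hz => congrFun (congrFun hz i) j)

theorem pdMat_comm (hF : SmoothMat F y) : pdMat α (pdMat β F) y = pdMat β (pdMat α F) y := by
  ext i j
  exact pd_comm (hF i j)

theorem pdVec_mulVec (hF : SmoothMat F y) (hu : SmoothVec u y) :
    pdVec α (fun z => F z *ᵥ u z) y = pdMat α F y *ᵥ u y + F y *ᵥ pdVec α u y := by
  funext i
  simp only [pdVec, pdMat, Matrix.mulVec, dotProduct, Pi.add_apply, Matrix.of_apply]
  rw [pd_sum fun k _ => (hF i k).mul (hu k), ← Finset.sum_add_distrib]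
  exact Finset.sum_congr rfl fun k _ => pd_mul (hF i k) (hu k)

theorem pdVec_sub (hu : SmoothVec u y) (hw : SmoothVec w y) :
    pdVec α (fun z => u z - w z) y = pdVec α u y - pdVec α w y := by
  funext i
  exact pd_sub (hu i) (hw i)

theorem pdVec_comm (hu : SmoothVec u y) : pdVec α (pdVec β u) y = pdVec β (pdVec α u) y := by
  funext i
  exact pd_comm (hu i)

theorem SmoothMat.det (hF : SmoothMat F y) : ContDiffAt ℝ ∞ (fun z => (F z).det) y := by
  simp only [Matrix.det_apply]
  exact ContDiffAt.sum fun σ _ => (contDiffAt_prod fun i _ => hF (σ i) i).const_smul _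

theorem SmoothMat.inv (hF : SmoothMat F y) (hu : IsUnit (F y).det) :
    SmoothMat (fun z => (F z)⁻¹) y := by
  intro i j
  -- Cramer's rule: each entry of the inverse is a quotient of determinants, hence smooth.
  have h : (fun z => (F z)⁻¹ i j) = fun z =>
      ((F z).det)⁻¹ * ((F z).updateRow j (Pi.single i 1)).det := by
    funext z
    rw [Matrix.inv_def, Matrix.smul_apply, Matrix.adjugate_apply, Ring.inverse_eq_inv', smul_eq_mul]
  rw [h]
  refine (hF.det.inv hu.ne_zero).mul (SmoothMat.det fun k l => ?_)
  simp only [Matrix.updateRow_apply]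
  split_ifs
  · exact contDiffAt_const
  · exact hF k l

theorem eventually_isUnit_det (hF : SmoothMat F y) (hu : IsUnit (F y).det) :
    ∀ᶠ z in 𝓝 y, IsUnit (F z).det := by
  filter_upwards [hF.det.continuousAt.eventually_ne hu.ne_zero] with z hz
  exact isUnit_iff_ne_zero.2 hz

/-- The derivative of the inverse matrix. -/
theorem pdMat_inv (hF : SmoothMat F y) (hu : IsUnit (F y).det) :
    pdMat α (fun z => (F z)⁻¹) y = -((F y)⁻¹ * pdMat α F y * (F y)⁻¹) := by
  have h1 : pdMat α (fun z => (F z)⁻¹ * F z) y = 0 := by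
    rw [pdMat_congr (K := fun _ => 1) ((eventually_isUnit_det hF hu).mono fun z hz =>
      Matrix.nonsing_inv_mul _ hz)]
    ext i j
    simp [pdMat, pd]
  rw [pdMat_mul (hF.inv hu) hF] at h1
  have h2 := congrArg (fun X => X * (F y)⁻¹) h1
  simp only [Matrix.add_mul, Matrix.zero_mul] at h2
  rw [Matrix.mul_assoc, Matrix.mul_nonsing_inv _ hu, Matrix.mul_one] at h2
  exact eq_neg_of_add_eq_zero_left h2

/-- Jacobi's formula. -/
theorem pd_det (hF : SmoothMat F y) (hu : IsUnit (F y).det) :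
    pd α (fun z => (F z).det) y = (F y).det * ((F y)⁻¹ * pdMat α F y).trace := by
  have h1 : pd α (fun z => (F z).det) y =
      ∑ i, ((F y).updateCol i fun k => pdMat α F y k i).det := by
    simp only [Matrix.det_apply']
    rw [pd_sum fun σ _ => contDiffAt_const.mul (contDiffAt_prod fun i _ => hF (σ i) i),
      Finset.sum_comm]
    refine Finset.sum_congr rfl fun σ _ => ?_
    rw [← Finset.mul_sum, pd_mul contDiffAt_const (contDiffAt_prod fun i _ => hF (σ i) i)]
    have h2 : pd α (fun _ => ((Equiv.Perm.sign σ : ℤ) : ℝ)) y = 0 := by simp [pd]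
    rw [h2, zero_mul, zero_add]
    congr 1
    rw [pd, fderiv_finsetProd fun i _ => (hF (σ i) i).differentiableAt (by norm_num)]
    simp only [_root_.sum_apply, _root_.smul_apply, smul_eq_mul]
    refine Finset.sum_congr rfl fun i _ => ?_
    rw [← Finset.mul_prod_erase _ _ (Finset.mem_univ i), mul_comm]
    refine congrArg₂ _ (by simp [pdMat, pd]) (Finset.prod_congr rfl fun j hj => ?_)
    rw [Matrix.updateCol_ne (Finset.ne_of_mem_erase hj)]
  rw [h1, Matrix.trace, Finset.mul_sum]
  refine Finset.sum_congr rfl fun i _ => ?_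
  -- The determinant with its `i`-th column differentiated is a Cramer determinant, i.e. a diagonal
  -- entry of the adjugate times the derivative.
  rw [← Matrix.cramer_apply, Matrix.cramer_eq_adjugate_mulVec, Matrix.diag_apply, Matrix.mul_apply,
    Matrix.mulVec, dotProduct, Finset.mul_sum]
  refine Finset.sum_congr rfl fun k _ => ?_
  rw [Matrix.inv_def, Matrix.smul_apply, Ring.inverse_eq_inv', smul_eq_mul, ← mul_assoc,
    ← mul_assoc, mul_inv_cancel₀ hu.ne_zero, one_mul]

end Calculus

/-! ### The Levi-Civita connection in coordinates -/

section LeviCivita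

/-- The matrices `(Γ_α)^μ_κ = Γ^μ_{ακ}` of the connection. -/
def connMat (G : E4 → Matrix (Fin 4) (Fin 4) ℝ) (α : Fin 4) (y : E4) : Matrix (Fin 4) (Fin 4) ℝ :=
  Matrix.of fun μ κ => christoffel G μ α κ y

/-- The matrices `(R_{αγ})^μ_ν = R^μ_{ν αγ}` of the curvature. -/
def curvMat (G : E4 → Matrix (Fin 4) (Fin 4) ℝ) (α γ : Fin 4) (y : E4) :
    Matrix (Fin 4) (Fin 4) ℝ :=
  Matrix.of fun μ ν => riemann G μ ν α γ y

variable {G : E4 → Matrix (Fin 4) (Fin 4) ℝ} {U : Set E4}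

theorem curvMat_eq (α γ : Fin 4) (y : E4) : curvMat G α γ y =
    pdMat α (connMat G γ) y - pdMat γ (connMat G α) y +
      (connMat G α y * connMat G γ y - connMat G γ y * connMat G α y) := by
  ext μ ν
  simp [curvMat, riemann, pdMat, connMat, Matrix.mul_apply, Finset.sum_sub_distrib]

/-- A smooth symmetric nondegenerate matrix function on an open set. -/
structure IsMetricOn (G : E4 → Matrix (Fin 4) (Fin 4) ℝ) (U : Set E4) : Prop where
  isOpen : IsOpen U
  symm : ∀ y, (G y)ᵀ = G y
  smooth : ∀ y ∈ U, SmoothMat G y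
  isUnit : ∀ y ∈ U, IsUnit (G y).det

namespace IsMetricOn

variable (h : IsMetricOn G U) {y : E4} (hy : y ∈ U)
include h

theorem apply_symm (z : E4) (μ ν : Fin 4) : G z μ ν = G z ν μ :=
  (congrFun (congrFun (h.symm z) ν) μ)

theorem pd_symm (α μ ν : Fin 4) :
    pd α (fun z => G z μ ν) y = pd α (fun z => G z ν μ) y := by
  simp only [h.apply_symm _ μ ν]

theorem christoffel_symm (ρ μ ν : Fin 4) : christoffel G ρ μ ν y = christoffel G ρ ν μ y := by
  simp only [christoffel, h.pd_symm _ μ ν]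
  refine congrArg _ (Finset.sum_congr rfl fun σ _ => ?_)
  ring

theorem inv_symm (z : E4) : ((G z)⁻¹)ᵀ = (G z)⁻¹ := by
  rw [Matrix.transpose_nonsing_inv, h.symm]

include hy

theorem smooth_inv : SmoothMat (fun z => (G z)⁻¹) y := (h.smooth y hy).inv (h.isUnit y hy)

theorem smooth_connMat (α : Fin 4) : SmoothMat (connMat G α) y := fun μ κ => by
  refine contDiffAt_const.mul (ContDiffAt.sum fun σ _ => (h.smooth_inv hy μ σ).mul ?_)
  have hs := h.smooth y hy
  exact ((contDiffAt_pd (hs _ _)).add (contDiffAt_pd (hs _ _))).sub (contDiffAt_pd (hs _ _))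

/-- Lowering the upper index cancels the inverse metric and leaves the Christoffel symbols of the
first kind. -/
theorem mul_connMat (α μ ν : Fin 4) : (G y * connMat G α y) ν μ =
    (1 / 2) * (pd α (fun z => G z ν μ) y + pd μ (fun z => G z ν α) y
      - pd ν (fun z => G z α μ) y) := by
  have h1 : connMat G α y = (G y)⁻¹ * Matrix.of fun σ κ => (1 / 2) *
      (pd α (fun z => G z σ κ) y + pd κ (fun z => G z σ α) y - pd σ (fun z => G z α κ) y) := by
    ext μ κ
    simp only [connMat, christoffel, Matrix.of_apply, Matrix.mul_apply, Finset.mul_sum]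
    exact Finset.sum_congr rfl fun σ _ => by ring
  rw [h1, ← Matrix.mul_assoc, Matrix.mul_nonsing_inv _ (h.isUnit y hy), Matrix.one_mul,
    Matrix.of_apply]

/-- The metric is covariantly constant. -/
theorem pdMat_metric (α : Fin 4) :
    pdMat α G y = (connMat G α y)ᵀ * G y + G y * connMat G α y := by
  have h1 : (connMat G α y)ᵀ * G y = (G y * connMat G α y)ᵀ := by
    rw [Matrix.transpose_mul, h.symm]
  rw [h1]
  ext μ ν
  rw [Matrix.add_apply, Matrix.transpose_apply, h.mul_connMat hy, h.mul_connMat hy, pdMat,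
    Matrix.of_apply, h.pd_symm α ν μ, h.pd_symm μ α ν, h.pd_symm ν α μ]
  ring

theorem pdMat_inv (α : Fin 4) : pdMat α (fun z => (G z)⁻¹) y =
    -((G y)⁻¹ * (connMat G α y)ᵀ + connMat G α y * (G y)⁻¹) := by
  rw [Komar.pdMat_inv (h.smooth y hy) (h.isUnit y hy), h.pdMat_metric hy]
  have h1 := Matrix.mul_nonsing_inv _ (h.isUnit y hy)
  have h2 := Matrix.nonsing_inv_mul _ (h.isUnit y hy)
  rw [Matrix.mul_add, Matrix.add_mul, ← Matrix.mul_assoc, Matrix.mul_assoc _ (G y), h1,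
    Matrix.mul_one, ← Matrix.mul_assoc, h2, Matrix.one_mul]

/-- The logarithmic derivative of the volume density. -/
theorem pd_volume {v : E4 → ℝ} (hv : ContDiffAt ℝ ∞ v y) (hvG : ∀ z ∈ U, v z ^ 2 = -(G z).det)
    (α : Fin 4) : pd α v y = v y * (connMat G α y).trace := by
  have hv0 : v y ≠ 0 := by
    intro h0
    have := hvG y hy
    rw [h0] at this
    exact (h.isUnit y hy).ne_zero (by linarith)
  -- Differentiating `v² = -det G` with Jacobi's formula and then dividing by `v ≠ 0` avoids square
  -- roots and any choice of sign of `v`.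
  have h1 : pd α (fun z => v z * v z) y = pd α (fun z => -(G z).det) y := by
    refine pd_congr ?_
    filter_upwards [h.isOpen.mem_nhds hy] with z hz
    rw [← hvG z hz, sq]
  have h2 : ((G y)⁻¹ * pdMat α G y).trace = 2 * (connMat G α y).trace := by
    rw [h.pdMat_metric hy, Matrix.mul_add, Matrix.trace_add, ← Matrix.mul_assoc,
      ← Matrix.mul_assoc, Matrix.trace_mul_comm, ← Matrix.mul_assoc,
      Matrix.mul_nonsing_inv _ (h.isUnit y hy), Matrix.nonsing_inv_mul _ (h.isUnit y hy),
      Matrix.one_mul, Matrix.one_mul, Matrix.trace_transpose]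
    ring
  rw [pd_mul hv hv, pd_neg, pd_det (h.smooth y hy) (h.isUnit y hy), h2] at h1
  have h3 := hvG y hy
  have h4 : v y * (pd α v y - v y * (connMat G α y).trace) = 0 := by
    linear_combination (1 / 2) * h1 - (connMat G α y).trace * h3
  rcases mul_eq_zero.1 h4 with h5 | h5
  · exact absurd h5 hv0
  · linarith

/-- The curvature is skew-symmetric with respect to the metric. -/
theorem curvMat_skew (α γ : Fin 4) :
    G y * curvMat G α γ y = -((curvMat G α γ y)ᵀ * G y) := by
  -- Skewness is the equality of mixed partials of `G`, with each first derivative replaced by `Γᵀ G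
  -- + G Γ`.
  have h1 : ∀ β δ : Fin 4, pdMat β (pdMat δ G) y =
      (pdMat β (connMat G δ) y)ᵀ * G y + (connMat G δ y)ᵀ * pdMat β G y +
        (pdMat β G y * connMat G δ y + G y * pdMat β (connMat G δ) y) := by
    intro β δ
    have hc := h.smooth_connMat hy δ
    have hs := h.smooth y hy
    rw [pdMat_congr (K := fun z => (connMat G δ z)ᵀ * G z + G z * connMat G δ z)
      (by filter_upwards [h.isOpen.mem_nhds hy] with z hz using h.pdMat_metric hz δ),
      pdMat_add (hc.transpose.mul hs) (hs.mul hc), pdMat_mul hc.transpose hs, pdMat_mul hs hc]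
    rfl
  have h2 := h1 α γ
  rw [pdMat_comm (h.smooth y hy), h1 γ α, h.pdMat_metric hy, h.pdMat_metric hy] at h2
  rw [curvMat_eq]
  simp only [Matrix.transpose_add, Matrix.transpose_sub, Matrix.transpose_mul]
  rw [← sub_eq_zero] at h2 ⊢
  rw [← neg_eq_zero, ← h2]
  noncomm_ring

end IsMetricOn

end LeviCivita

/-! ### Covariant derivatives of 1-forms in coordinates -/

section Covariant

/-- The matrix of the components `D_β a_ρ`. -/
def covMat (G : E4 → Matrix (Fin 4) (Fin 4) ℝ) (a : E4 → Fin 4 → ℝ) (y : E4) :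
    Matrix (Fin 4) (Fin 4) ℝ :=
  Matrix.of fun β ρ => covD G (fun σ z => a z σ) β ρ y

/-- The matrix of the components `D_γ D_β a_ρ` for a fixed index `γ`. -/
def covMat2 (G : E4 → Matrix (Fin 4) (Fin 4) ℝ) (a : E4 → Fin 4 → ℝ) (γ : Fin 4) (y : E4) :
    Matrix (Fin 4) (Fin 4) ℝ :=
  Matrix.of fun β ρ => covD2 G (fun σ z => a z σ) γ β ρ y

/-- The divergence `g^{αβ} D_α a_β`. -/
def divergence (G : E4 → Matrix (Fin 4) (Fin 4) ℝ) (a : E4 → Fin 4 → ℝ) (y : E4) : ℝ :=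
  ((G y)⁻¹ * covMat G a y).trace

variable {G : E4 → Matrix (Fin 4) (Fin 4) ℝ} {U : Set E4} {a : E4 → Fin 4 → ℝ} {y : E4}

theorem covMat_row (γ : Fin 4) (y : E4) :
    covMat G a y γ = pdVec γ a y - (connMat G γ y)ᵀ *ᵥ a y := by
  funext ρ
  simp [covMat, covD, pdVec, connMat, Matrix.mulVec, dotProduct]

theorem covMat2_eq (γ : Fin 4) (y : E4) : covMat2 G a γ y =
    pdMat γ (covMat G a) y - (connMat G γ y)ᵀ * covMat G a y - covMat G a y * connMat G γ y := by
  ext β ρ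
  simp only [covMat2, covD2, pdMat, covMat, connMat, Matrix.sub_apply, Matrix.mul_apply,
    Matrix.of_apply, Matrix.transpose_apply]
  congr 1
  exact Finset.sum_congr rfl fun κ _ => mul_comm _ _

theorem pd_trace {F : E4 → Matrix (Fin 4) (Fin 4) ℝ} (hF : SmoothMat F y) (α : Fin 4) :
    pd α (fun z => (F z).trace) y = (pdMat α F y).trace := by
  simp only [Matrix.trace, Matrix.diag_apply]
  rw [pd_sum fun i _ => hF i i]
  rfl

theorem covMat_sub_transpose_apply (h : IsMetricOn G U) (β ρ : Fin 4) (y : E4) :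
    (covMat G a y - (covMat G a y)ᵀ) β ρ =
      pd β (fun z => a z ρ) y - pd ρ (fun z => a z β) y := by
  simp only [covMat, covD, Matrix.sub_apply, Matrix.transpose_apply, Matrix.of_apply,
    h.christoffel_symm _ β ρ]
  ring

theorem curvMat_swap (α γ : Fin 4) (y : E4) : curvMat G α γ y = -curvMat G γ α y := by
  rw [curvMat_eq, curvMat_eq]
  abel

theorem ricci_eq (ν σ : Fin 4) (y : E4) : ricci G y ν σ = ∑ μ, curvMat G σ μ y μ ν := rfl

namespace IsMetricOn

variable (h : IsMetricOn G U) (hy : y ∈ U) (ha : SmoothVec a y)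
include h hy ha

theorem smooth_covMat : SmoothMat (covMat G a) y := fun β ρ =>
  (contDiffAt_pd (ha ρ)).sub (ContDiffAt.sum fun κ _ => (h.smooth_connMat hy β κ ρ).mul (ha κ))

/-- The Ricci identity. -/
theorem covD2_comm (α γ : Fin 4) : covMat2 G a α y γ - covMat2 G a γ y α =
    -((curvMat G α γ y)ᵀ *ᵥ a y) := by
  have h1 : ∀ α γ : Fin 4, pdMat α (covMat G a) y γ = pdVec α (pdVec γ a) y -
      ((pdMat α (connMat G γ) y)ᵀ *ᵥ a y + (connMat G γ y)ᵀ *ᵥ pdVec α a y) := by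
    intro α γ
    have hc := (h.smooth_connMat hy γ).transpose
    rw [← pdMat_transpose, ← pdVec_mulVec hc ha, ← pdVec_sub ha.pdVec (hc.mulVec ha)]
    funext ρ
    exact pd_congr (Eventually.of_forall fun z => congrFun (covMat_row γ z) ρ)
  have h2 : ∀ α γ : Fin 4, covMat2 G a α y γ = pdMat α (covMat G a) y γ -
      ((connMat G α y)ᵀ * covMat G a y) γ - (connMat G α y)ᵀ *ᵥ covMat G a y γ := by
    intro α γ
    rw [covMat2_eq]
    funext ρ
    simp only [Matrix.sub_apply, Pi.sub_apply]
    congr 1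
    simp only [Matrix.mul_apply, Matrix.mulVec, dotProduct, Matrix.transpose_apply]
    exact Finset.sum_congr rfl fun κ _ => mul_comm _ _
  -- Absence of torsion: the connection terms acting on the derivative index coincide and cancel in
  -- the commutator.
  have h3 : ((connMat G α y)ᵀ * covMat G a y) γ = ((connMat G γ y)ᵀ * covMat G a y) α := by
    funext ρ
    simp only [Matrix.mul_apply, Matrix.transpose_apply, connMat, Matrix.of_apply,
      h.christoffel_symm _ α γ]
  rw [h2 α γ, h2 γ α, h1, h1, h3, covMat_row, covMat_row, pdVec_comm ha, curvMat_eq]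
  simp only [Matrix.transpose_add, Matrix.transpose_sub, Matrix.transpose_mul, Matrix.add_mulVec,
    Matrix.sub_mulVec, Matrix.mulVec_sub, ← Matrix.mulVec_mulVec]
  abel

/-- The derivative of the divergence. -/
theorem pd_divergence (γ : Fin 4) : pd γ (divergence G a) y =
    ((G y)⁻¹ * covMat2 G a γ y).trace := by
  have hi := h.smooth_inv hy
  have hc := h.smooth_covMat hy ha
  have h1 : pd γ (divergence G a) y = pd γ (fun z => ((G z)⁻¹ * covMat G a z).trace) y := rfl
  rw [h1, pd_trace (hi.mul hc), pdMat_mul hi hc, h.pdMat_inv hy, covMat2_eq]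
  simp only [Matrix.mul_sub, Matrix.neg_mul, Matrix.add_mul, Matrix.trace_add, Matrix.trace_sub,
    Matrix.trace_neg]
  have h2 : ((G y)⁻¹ * (covMat G a y * connMat G γ y)).trace =
      (connMat G γ y * (G y)⁻¹ * covMat G a y).trace := by
    rw [← Matrix.mul_assoc, Matrix.trace_mul_comm, Matrix.mul_assoc]
  rw [h2, Matrix.mul_assoc ((G y)⁻¹) (connMat G γ y)ᵀ]
  ring

-- Skewness of the curvature gives `g⁻¹ R_{αγ}ᵀ = R_{γα} g⁻¹`, and contracting the upper index with
-- `α` is the Ricci tensor in the convention `R_{νσ} = R^μ_{νσμ}`.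
omit ha in
theorem trace_inv_curvMat (γ : Fin 4) :
    ∑ α, ((G y)⁻¹ *ᵥ ((curvMat G α γ y)ᵀ *ᵥ a y)) α =
      ∑ l, ricci G y l γ * ((G y)⁻¹ *ᵥ a y) l := by
  have h1 : ∀ α, (G y)⁻¹ *ᵥ ((curvMat G α γ y)ᵀ *ᵥ a y) =
      curvMat G γ α y *ᵥ ((G y)⁻¹ *ᵥ a y) := by
    intro α
    have h2 := h.curvMat_skew hy γ α
    have h3 : (curvMat G α γ y)ᵀ = G y * curvMat G γ α y * (G y)⁻¹ := by
      rw [h2, Matrix.neg_mul, Matrix.mul_assoc, Matrix.mul_nonsing_inv _ (h.isUnit y hy),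
        Matrix.mul_one, curvMat_swap, Matrix.transpose_neg]
    rw [h3, Matrix.mulVec_mulVec, Matrix.mulVec_mulVec, ← Matrix.mul_assoc, ← Matrix.mul_assoc,
      Matrix.nonsing_inv_mul _ (h.isUnit y hy), Matrix.one_mul]
  simp only [h1]
  simp only [Matrix.mulVec, dotProduct, ricci_eq, Finset.sum_mul]
  exact Finset.sum_comm

/-- The contracted Ricci identity. -/
theorem sum_inv_covMat2 (γ : Fin 4) :
    ∑ α, ∑ μ, (G y)⁻¹ α μ * (covMat2 G a α y μ γ - covMat2 G a α y γ μ) =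
      ∑ α, ∑ μ, (G y)⁻¹ α μ * covMat2 G a α y μ γ - pd γ (divergence G a) y +
        ∑ l, ricci G y l γ * ((G y)⁻¹ *ᵥ a y) l := by
  rw [← h.trace_inv_curvMat hy, h.pd_divergence hy ha]
  have h1 : ((G y)⁻¹ * covMat2 G a γ y).trace =
      ∑ α, ∑ μ, (G y)⁻¹ α μ * covMat2 G a γ y α μ := by
    rw [Matrix.trace, Finset.sum_comm]
    refine Finset.sum_congr rfl fun α _ => ?_
    rw [Matrix.diag_apply, Matrix.mul_apply]
    refine Finset.sum_congr rfl fun μ _ => ?_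
    rw [show (G y)⁻¹ α μ = (G y)⁻¹ μ α from congrFun (congrFun (h.inv_symm y) μ) α]
  have h2 : ∀ α μ, covMat2 G a α y γ μ = covMat2 G a γ y α μ -
      ((curvMat G α γ y)ᵀ *ᵥ a y) μ := by
    intro α μ
    have h3 := congrFun (h.covD2_comm hy ha α γ) μ
    simp only [Pi.sub_apply, Pi.neg_apply] at h3
    linarith
  have h4 : ∀ α, ((G y)⁻¹ *ᵥ ((curvMat G α γ y)ᵀ *ᵥ a y)) α =
      ∑ μ, (G y)⁻¹ α μ * ((curvMat G α γ y)ᵀ *ᵥ a y) μ := fun _ => rfl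
  rw [h1]
  simp only [h2, h4, ← Finset.sum_sub_distrib, ← Finset.sum_add_distrib]
  exact Finset.sum_congr rfl fun α _ => Finset.sum_congr rfl fun μ _ => by ring

variable {v : E4 → ℝ} (hv : ContDiffAt ℝ ∞ v y) (hvG : ∀ z ∈ U, v z ^ 2 = -(G z).det)
include hv hvG

/-- The formula `v⁻¹ ∂_α (v a^α) = D_α a^α`: the logarithmic derivative of `v` is the contracted
connection, and symmetry of the lower indices makes it cancel the connection term of the raised
components. -/
theorem sum_pd_volume_mul : ∑ α, pd α (fun z => v z * ((G z)⁻¹ *ᵥ a z) α) y =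
    v y * divergence G a y := by
  have hi := h.smooth_inv hy
  have h1 : ∀ α, pdVec α (fun z => (G z)⁻¹ *ᵥ a z) y =
      (G y)⁻¹ *ᵥ covMat G a y α - connMat G α y *ᵥ ((G y)⁻¹ *ᵥ a y) := by
    intro α
    rw [pdVec_mulVec hi ha, h.pdMat_inv hy, covMat_row]
    simp only [Matrix.neg_mulVec, Matrix.add_mulVec, Matrix.mulVec_sub, ← Matrix.mulVec_mulVec]
    abel
  have h2 : ∀ α, pd α (fun z => v z * ((G z)⁻¹ *ᵥ a z) α) y =
      v y * ((G y)⁻¹ *ᵥ covMat G a y α) α + v y * ((connMat G α y).trace * ((G y)⁻¹ *ᵥ a y) α -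
        (connMat G α y *ᵥ ((G y)⁻¹ *ᵥ a y)) α) := by
    intro α
    have h3 := congrFun (h1 α) α
    rw [pd_mul hv (hi.mulVec ha α), h.pd_volume hy hv hvG]
    rw [pdVec, Pi.sub_apply] at h3
    rw [h3]
    ring
  have h4 : ∑ α, (connMat G α y).trace * ((G y)⁻¹ *ᵥ a y) α =
      ∑ α, (connMat G α y *ᵥ ((G y)⁻¹ *ᵥ a y)) α := by
    generalize (G y)⁻¹ *ᵥ a y = u
    simp only [Matrix.trace, Matrix.diag_apply, Finset.sum_mul, Matrix.mulVec, dotProduct]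
    rw [Finset.sum_comm]
    refine Finset.sum_congr rfl fun α _ => Finset.sum_congr rfl fun κ _ => ?_
    simp only [connMat, Matrix.of_apply, h.christoffel_symm _ κ α]
  simp only [h2]
  rw [Finset.sum_add_distrib, ← Finset.mul_sum, ← Finset.mul_sum, Finset.sum_sub_distrib, h4,
    sub_self, mul_zero, add_zero, divergence, Matrix.trace_mul_comm, Matrix.trace]
  refine congrArg _ (Finset.sum_congr rfl fun α _ => ?_)
  rw [Matrix.diag_apply, Matrix.mul_apply, Matrix.mulVec, dotProduct]
  refine Finset.sum_congr rfl fun μ _ => ?_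
  rw [show (G y)⁻¹ α μ = (G y)⁻¹ μ α from congrFun (congrFun (h.inv_symm y) μ) α, mul_comm]

/-- The analogous divergence formula for the antisymmetric tensor `F^{αb}`, raised from `F_{αβ} =
D_α a_β - D_β a_α`. It leads to the inhomogeneous Maxwell equation. -/
theorem sum_pd_volume_mul_two (b : Fin 4) :
    ∑ α, pd α (fun z => v z *
      ((G z)⁻¹ * (covMat G a z - (covMat G a z)ᵀ) * (G z)⁻¹) α b) y =
    v y * ∑ γ, (G y)⁻¹ b γ * ∑ α, ∑ μ, (G y)⁻¹ α μ *
      (covMat2 G a α y μ γ - covMat2 G a α y γ μ) := by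
  have hi := h.smooth_inv hy
  have hc := h.smooth_covMat hy ha
  have hF := hc.sub hc.transpose
  set P := (G y)⁻¹ * (covMat G a y - (covMat G a y)ᵀ) * (G y)⁻¹ with hP
  have h1 : ∀ α, pdMat α (fun z => (G z)⁻¹ * (covMat G a z - (covMat G a z)ᵀ) * (G z)⁻¹) y =
      (G y)⁻¹ * (covMat2 G a α y - (covMat2 G a α y)ᵀ) * (G y)⁻¹ -
        connMat G α y * P - P * (connMat G α y)ᵀ := by
    intro α
    rw [pdMat_mul (hi.mul hF) hi, pdMat_mul hi hF, pdMat_sub hc hc.transpose, pdMat_transpose,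
      h.pdMat_inv hy, covMat2_eq, hP]
    simp only [Matrix.transpose_sub, Matrix.transpose_mul, Matrix.transpose_transpose]
    noncomm_ring
  have h2 : ∀ α, pd α (fun z => v z *
      ((G z)⁻¹ * (covMat G a z - (covMat G a z)ᵀ) * (G z)⁻¹) α b) y =
      v y * ((G y)⁻¹ * (covMat2 G a α y - (covMat2 G a α y)ᵀ) * (G y)⁻¹) α b +
        v y * ((connMat G α y).trace * P α b - (connMat G α y * P) α b) -
          v y * (P * (connMat G α y)ᵀ) α b := by
    intro α
    have h3 := congrFun (congrFun (h1 α) α) b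
    rw [pd_mul hv ((hi.mul hF).mul hi α b), h.pd_volume hy hv hvG]
    rw [pdMat, Matrix.of_apply, Matrix.sub_apply, Matrix.sub_apply] at h3
    rw [h3]
    simp only [← hP]
    ring
  have h4 : ∑ α, (connMat G α y).trace * P α b = ∑ α, (connMat G α y * P) α b := by
    simp only [Matrix.trace, Matrix.diag_apply, Finset.sum_mul, Matrix.mul_apply]
    rw [Finset.sum_comm]
    refine Finset.sum_congr rfl fun α _ => Finset.sum_congr rfl fun κ _ => ?_
    simp only [connMat, Matrix.of_apply, h.christoffel_symm _ κ α]
  have hPt : ∀ i j, P i j = -P j i := by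
    intro i j
    have : Pᵀ = -P := by
      rw [hP]
      simp only [Matrix.transpose_mul, Matrix.transpose_sub, Matrix.transpose_transpose,
        h.inv_symm]
      noncomm_ring
    have h5 := congrFun (congrFun this j) i
    simpa using h5
  -- The connection on the free index contracts an antisymmetric `P` with a symmetric `Γ`.
  have h6 : ∑ α, (P * (connMat G α y)ᵀ) α b = 0 := by
    have h7 : ∑ α, (P * (connMat G α y)ᵀ) α b = -∑ α, (P * (connMat G α y)ᵀ) α b := by
      simp only [Matrix.mul_apply, Matrix.transpose_apply, connMat, Matrix.of_apply]
      rw [← Finset.sum_neg_distrib]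
      conv_lhs => rw [Finset.sum_comm]
      refine Finset.sum_congr rfl fun α _ => ?_
      rw [← Finset.sum_neg_distrib]
      refine Finset.sum_congr rfl fun κ _ => ?_
      rw [hPt, h.christoffel_symm _ κ α]
      ring
    linarith
  simp only [h2]
  rw [Finset.sum_sub_distrib, Finset.sum_add_distrib, ← Finset.mul_sum, ← Finset.mul_sum,
    ← Finset.mul_sum, Finset.sum_sub_distrib, h4, h6, sub_self, mul_zero, add_zero,
    sub_zero]
  refine congrArg _ ?_
  simp only [Matrix.mul_apply, Matrix.sub_apply, Matrix.transpose_apply, Finset.sum_mul,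
    Finset.mul_sum]
  rw [Finset.sum_comm]
  refine Finset.sum_congr rfl fun γ _ => Finset.sum_congr rfl fun α _ =>
    Finset.sum_congr rfl fun μ _ => ?_
  rw [show (G y)⁻¹ γ b = (G y)⁻¹ b γ from congrFun (congrFun (h.inv_symm y) b) γ]
  ring

end IsMetricOn

end Covariant

/-! ### Smoothness of the Hodge star -/

section HodgeSmooth

variable {B : E4 → Matrix (Fin 4) (Fin 4) ℝ} {τ : E4 → E4 [⋀^Fin 4]→L[ℝ] ℝ} {y : E4}

theorem contDiffAt_contractFirst {p q : ℕ} (h : p + q = 4) (hτ : ContDiffAt ℝ ∞ τ y)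
    (hv : τ y stdVec ≠ 0) (m : Fin p → E4) :
    ContDiffAt ℝ ∞ (fun z => contractFirst h (τ z) m) y := by
  set τ₀ := (τ y stdVec)⁻¹ • τ y with hτ₀
  have h1 : τ₀ stdVec = 1 := by simp [hτ₀, hv]
  have h2 : (fun z => contractFirst h (τ z) m) = fun z => τ z stdVec • contractFirst h τ₀ m := by
    funext z
    conv_lhs => rw [volume_eq_smul h1 (τ z)]
    rw [contractFirst_smul]
  rw [h2]
  exact (contDiffAt_apply hτ _).fun_smul contDiffAt_const

theorem contDiffAt_starAt_one {η : E4 → E4 [⋀^Fin 1]→L[ℝ] ℝ} (hB : SmoothMat B y)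
    (hτ : ContDiffAt ℝ ∞ τ y) (hv : τ y stdVec ≠ 0) (hη : ContDiffAt ℝ ∞ η y) :
    ContDiffAt ℝ ∞ (fun z => starAt (n := 4) (q := 3) rfl (B z) stdVec (τ z) (η z)) y := by
  simp only [starAt_one]
  refine ContDiffAt.sum fun a _ => ContDiffAt.fun_smul (ContDiffAt.sum fun c _ => ?_)
    (contDiffAt_contractFirst rfl hτ hv _)
  exact (hB a c).mul (contDiffAt_apply hη _)

theorem contDiffAt_starAt_two {η : E4 → E4 [⋀^Fin 2]→L[ℝ] ℝ} (hB : SmoothMat B y)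
    (hτ : ContDiffAt ℝ ∞ τ y) (hv : τ y stdVec ≠ 0) (hη : ContDiffAt ℝ ∞ η y) :
    ContDiffAt ℝ ∞ (fun z => starAt (n := 4) (q := 2) rfl (B z) stdVec (τ z) (η z)) y := by
  simp only [starAt_two]
  refine contDiffAt_const.fun_smul (ContDiffAt.sum fun a _ => ContDiffAt.sum fun b _ =>
    ContDiffAt.fun_smul (ContDiffAt.sum fun c _ => ContDiffAt.sum fun d _ => ?_)
    (contDiffAt_contractFirst rfl hτ hv _))
  exact ((hB a c).mul (hB b d)).mul (contDiffAt_apply hη _)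

end HodgeSmooth

/-! ### From coordinate formulas to forms on the manifold: divergence and codifferential -/

section Glue

variable {M : Type*} [TopologicalSpace M] [ChartedSpace E4 M] [IsManifold 𝓘(ℝ, E4) ∞ M]

theorem Form.eq_inChart {k : ℕ} (θ : Form M k) (x : M) :
    (θ x : E4 [⋀^Fin k]→L[ℝ] ℝ) = θ.inChart x (chartAt E4 x x) :=
  ContinuousAlternatingMap.ext fun v => θ.apply_eq_inChart x v

/-- The components of a 1-form in the preferred chart at `x₀`. -/
def Form.comps (θ : Form M 1) (x₀ : M) (y : E4) (σ : Fin 4) : ℝ :=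
  θ.inChart x₀ y (fun _ => stdVec σ)

omit [IsManifold 𝓘(ℝ, E4) ∞ M] in
theorem Form.IsSmooth.smoothVec_comps {θ : Form M 1} {x₀ : M} {y : E4} (hθ : θ.IsSmooth)
    (hy : y ∈ (chartAt E4 x₀).target) : SmoothVec (θ.comps x₀) y :=
  fun _ => contDiffAt_apply (hθ.contDiffAt x₀ hy) _

namespace Spacetime

variable (S : Spacetime M) {x₀ : M} {y : E4}

theorem isMetricOn (x₀ : M) : IsMetricOn (S.gChart x₀) (chartAt E4 x₀).target where
  isOpen := (chartAt E4 x₀).open_target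
  symm y := by
    ext μ ν
    exact S.symm _ _ _
  smooth y hy μ ν := S.contDiffAt_gChart hy μ ν
  isUnit y hy := S.isUnit_gChart_det hy

theorem vol_inChart_sq (x₀ : M) (y : E4) :
    (S.vol.inChart x₀ y stdVec) ^ 2 = -(S.gChart x₀ y).det :=
  S.vol_sq _ _

theorem vol_inChart_ne_zero (hy : y ∈ (chartAt E4 x₀).target) :
    S.vol.inChart x₀ y stdVec ≠ 0 := by
  intro h
  have h1 := S.vol_inChart_sq x₀ y
  rw [h] at h1
  exact (S.isUnit_gChart_det hy).ne_zero (by linarith)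

theorem gram_eq_gChart (x : M) : S.gram x = S.gChart x (chartAt E4 x x) := by
  have key : ∀ (z : M) (hz : z = x) (L : E4 →L[ℝ] TS z), (∀ w : E4, (L w : E4) = w) →
      ∀ u w : E4, S.g z (L u) (L w) = S.g x u w := by
    rintro z rfl L hL u w
    have h1 : L u = u := hL u
    have h2 : L w = w := hL w
    rw [h1, h2]
  ext μ ν
  exact (key _ ((chartAt E4 x).left_inv (mem_chart_source E4 x)) _
    (mfderiv_chart_symm_self x) _ _).symm

theorem vol_sq_mul_det_inv (x : M) :
    (S.vol x (stdVec : Fin 4 → E4)) ^ 2 * ((S.gram x)⁻¹).det = -1 := by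
  have h : (S.vol x (stdVec : Fin 4 → E4)) ^ 2 = -(S.gram x).det := S.vol_sq x (coordVec x)
  rw [h, Matrix.det_nonsing_inv, Ring.inverse_eq_inv', neg_mul,
    mul_inv_cancel₀ (S.isUnit_gram_det x).ne_zero]

theorem gram_inv_symm (x : M) : ((S.gram x)⁻¹)ᵀ = (S.gram x)⁻¹ := by
  rw [gram_eq_gChart]
  exact (S.isMetricOn x).inv_symm _

theorem hodge_smul {p q : ℕ} (h : p + q = 4) (c : ℝ) (θ : Form M p) :
    S.hodge h (c • θ) = c • S.hodge h θ := by
  funext x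
  ext v
  simp only [hodge, Pi.smul_apply, ContinuousAlternatingMap.smul_apply,
    ContinuousAlternatingMap.sum_apply, smul_eq_mul, Finset.mul_sum]
  exact Finset.sum_congr rfl fun ν _ => by ring

theorem hodge_apply_eq_zero {p q : ℕ} (h : p + q = 4) {θ : Form M p} {x : M} (hx : θ x = 0) :
    S.hodge h θ x = 0 := by
  simp [hodge, hx]

theorem hodge_apply_eq {p q : ℕ} (h : p + q = 4) (θ : Form M p) (x : M) :
    (S.hodge h θ x : E4 [⋀^Fin q]→L[ℝ] ℝ) =
      starAt (V := E4) h (S.gram x)⁻¹ stdVec (S.vol x) (θ x) := rfl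

theorem hodge_hodge_apply_eq {p q r : ℕ} (h : p + q = 4) (h' : q + r = 4) (θ : Form M p) (x : M) :
    (S.hodge h' (S.hodge h θ) x : E4 [⋀^Fin r]→L[ℝ] ℝ) =
      starAt (V := E4) h' (S.gram x)⁻¹ stdVec (S.vol x)
        (starAt (V := E4) h (S.gram x)⁻¹ stdVec (S.vol x) (θ x)) := rfl

theorem codiff_eq (k : ℕ) {l : ℕ} (h : k + l + 1 = 4) (θ : Form M (k + 1)) :
    S.codiff k h θ = (-1 : ℝ) ^ (k + 1) • (((-1 : ℝ) ^ ((l + 1) * k) * (-1)) •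
      S.hodge (p := l + 1) (q := k) (by omega)
        (S.hodge (p := k + 1) (q := l) (by omega) θ).d) := rfl

theorem hodge_hodge_one (θ : Form M 1) :
    S.hodge (p := 3) (q := 1) rfl (S.hodge (p := 1) (q := 3) rfl θ) = θ := by
  funext x
  have h := starAt_starAt_one (B := (S.gram x)⁻¹) (τ := S.vol x) (S.vol_sq_mul_det_inv x)
    (S.gram_inv_symm x) (θ x)
  exact (S.hodge_hodge_apply_eq (p := 1) (q := 3) (r := 1) rfl rfl θ x).trans h

theorem isSmooth_hodge_one {θ : Form M 1} (hθ : θ.IsSmooth) :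
    (S.hodge (p := 1) (q := 3) rfl θ).IsSmooth := by
  intro x₀ y hy
  refine ContDiffAt.contDiffWithinAt (ContDiffAt.congr_of_eventuallyEq
    (contDiffAt_starAt_one ((S.isMetricOn x₀).smooth_inv hy) (S.vol_smooth.contDiffAt x₀ hy)
      (S.vol_inChart_ne_zero hy) (hθ.contDiffAt x₀ hy)) ?_)
  filter_upwards [(chartAt E4 x₀).open_target.mem_nhds hy] with z hz
    using S.inChart_hodge rfl θ hz

theorem isSmooth_hodge_two {θ : Form M 2} (hθ : θ.IsSmooth) :
    (S.hodge (p := 2) (q := 2) rfl θ).IsSmooth := by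
  intro x₀ y hy
  refine ContDiffAt.contDiffWithinAt (ContDiffAt.congr_of_eventuallyEq
    (contDiffAt_starAt_two ((S.isMetricOn x₀).smooth_inv hy) (S.vol_smooth.contDiffAt x₀ hy)
      (S.vol_inChart_ne_zero hy) (hθ.contDiffAt x₀ hy)) ?_)
  filter_upwards [(chartAt E4 x₀).open_target.mem_nhds hy] with z hz
    using S.inChart_hodge rfl θ hz

theorem inChart_d_hodge_one {θ : Form M 1} (hθ : θ.IsSmooth)
    (hy : y ∈ (chartAt E4 x₀).target) :
    (S.hodge (p := 1) (q := 3) rfl θ).d.inChart x₀ y =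
      divergence (S.gChart x₀) (θ.comps x₀) y • S.vol.inChart x₀ y := by
  have hm := S.isMetricOn x₀
  have ha := hθ.smoothVec_comps hy
  have hv := contDiffAt_apply (S.vol_smooth.contDiffAt x₀ hy) stdVec
  have h1 : (S.hodge (p := 1) (q := 3) rfl θ).inChart x₀ =ᶠ[𝓝 y] fun z =>
      starAt (n := 4) (q := 3) rfl (S.gChart x₀ z)⁻¹ stdVec (S.vol.inChart x₀ z) (θ.inChart x₀ z) := by
    filter_upwards [(chartAt E4 x₀).open_target.mem_nhds hy] with z hz
      using S.inChart_hodge rfl θ hz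
  rw [(S.isSmooth_hodge_one hθ).inChart_d hy, h1.extDeriv_eq,
    extDeriv_starAt_one (S.vol_inChart_ne_zero hy) fun a =>
      (hv.mul ((hm.smooth_inv hy).mulVec ha a)).differentiableAt (by norm_num)]
  refine congrArg (fun c : ℝ => c • S.vol.inChart x₀ y) ?_
  have h2 := hm.sum_pd_volume_mul hy ha hv fun z _ => S.vol_inChart_sq x₀ z
  refine (congrArg (fun c : ℝ => (S.vol.inChart x₀ y stdVec)⁻¹ * c) h2).trans ?_
  rw [← mul_assoc, inv_mul_cancel₀ (S.vol_inChart_ne_zero hy), one_mul]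

/-- The divergence of a 1-form. -/
def div (θ : Form M 1) (x : M) : ℝ :=
  divergence (S.gChart x) (θ.comps x) (chartAt E4 x x)

theorem d_hodge_one {θ : Form M 1} (hθ : θ.IsSmooth) :
    (S.hodge (p := 1) (q := 3) rfl θ).d = fmul (S.div θ) S.vol := by
  funext x
  refine (Form.eq_inChart _ x).trans ((S.inChart_d_hodge_one hθ (mem_chart_target E4 x)).trans ?_)
  exact congrArg (fun τ => S.div θ x • τ) (Form.eq_inChart S.vol x).symm

/-- Both sides are the coefficient of the same 4-form `d⋆θ` relative to the volume form, so the
divergence does not depend on the chart. This allows `δθ` to be differentiated. -/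
theorem div_chart_symm {θ : Form M 1} (hθ : θ.IsSmooth) (hy : y ∈ (chartAt E4 x₀).target) :
    S.div θ ((chartAt E4 x₀).symm y) = divergence (S.gChart x₀) (θ.comps x₀) y := by
  have h := S.inChart_d_hodge_one hθ hy
  rw [S.d_hodge_one hθ] at h
  exact mul_right_cancel₀ (S.vol_inChart_ne_zero hy)
    (congrArg (fun η : E4 [⋀^Fin 4]→L[ℝ] ℝ => η stdVec) h)

theorem hodge_fmul_vol (f : M → ℝ) (x : M) : S.hodge (p := 4) (q := 0) rfl (fmul f S.vol) x =
    (ContinuousAlternatingMap.constOfIsEmpty ℝ E4 (Fin 0) (-f x) : E4 [⋀^Fin 0]→L[ℝ] ℝ) := by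
  have h1 := starAt_volume (τ := S.vol x) (S.vol_sq_mul_det_inv x)
  have h2 : S.hodge (p := 4) (q := 0) rfl (fmul f S.vol) x =
      f x • S.hodge (p := 4) (q := 0) rfl S.vol x := by
    ext v
    simp only [hodge, fmul, ContinuousAlternatingMap.smul_apply,
      ContinuousAlternatingMap.sum_apply, smul_eq_mul, Finset.mul_sum]
    exact Finset.sum_congr rfl fun ν _ => by ring
  rw [h2]
  have h3 : (S.hodge (p := 4) (q := 0) rfl S.vol x : E4 [⋀^Fin 0]→L[ℝ] ℝ) =
      ContinuousAlternatingMap.constOfIsEmpty ℝ E4 (Fin 0) (-1 : ℝ) :=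
    (S.hodge_apply_eq (p := 4) (q := 0) rfl S.vol x).trans h1
  rw [h3]
  ext v
  change f x * (-1) = -f x
  ring

/-- The degree sign and the signature sign cancel; the remaining minus comes from `⋆τ = -1`. -/
theorem codiff_zero_apply {θ : Form M 1} (hθ : θ.IsSmooth) (x : M) :
    S.codiff 0 (l := 3) rfl θ x =
      (ContinuousAlternatingMap.constOfIsEmpty ℝ E4 (Fin 0) (-S.div θ x) :
        E4 [⋀^Fin 0]→L[ℝ] ℝ) := by
  rw [S.codiff_eq 0 (l := 3) rfl θ, S.d_hodge_one hθ]
  simp only [Pi.smul_apply]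
  rw [S.hodge_fmul_vol]
  ext v
  change (-1 : ℝ) ^ (0 + 1) * (((-1 : ℝ) ^ ((3 + 1) * 0) * (-1)) * (-S.div θ x)) = -S.div θ x
  norm_num

theorem d_codiff_zero_apply {θ : Form M 1} (hθ : θ.IsSmooth) (x : M) (γ : Fin 4) :
    (S.codiff 0 (l := 3) rfl θ).d x (fun _ => stdVec γ) =
      -pd γ (divergence (S.gChart x) (θ.comps x)) (chartAt E4 x x) := by
  have h1 : (S.codiff 0 (l := 3) rfl θ).inChart x =ᶠ[𝓝 (chartAt E4 x x)] fun z =>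
      ContinuousAlternatingMap.constOfIsEmpty ℝ E4 (Fin 0)
        (-divergence (S.gChart x) (θ.comps x) z) := by
    filter_upwards [(chartAt E4 x).open_target.mem_nhds (mem_chart_target E4 x)] with z hz
    rw [← S.div_chart_symm hθ hz]
    exact congrArg (fun η => η.compContinuousLinearMap (chartSymmDeriv x z))
      (S.codiff_zero_apply hθ ((chartAt E4 x).symm z))
  have h2 := h1.extDeriv_eq.trans (extDeriv_constOfIsEmpty _ _)
  refine (congrArg (fun η : E4 [⋀^Fin 1]→L[ℝ] ℝ => η fun _ => stdVec γ) h2).trans ?_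
  exact pd_neg

end Spacetime

end Glue

/-! ### The Maxwell equation -/

section Maxwell

variable {M : Type*} [TopologicalSpace M] [ChartedSpace E4 M] [IsManifold 𝓘(ℝ, E4) ∞ M]

theorem oneForm_apply (η : E4 [⋀^Fin 1]→L[ℝ] ℝ) (w : E4) :
    η (fun _ => w) = ∑ ρ, w ρ * η (fun _ => stdVec ρ) := by
  obtain ⟨L, rfl⟩ := (ContinuousAlternatingMap.ofSubsingleton ℝ E4 ℝ (0 : Fin 1)).surjective η
  have h := congrArg L (sum_stdVec w)
  rw [map_sum] at h
  simpa using h.symm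

theorem Form.apply_stdVec (θ : Form M 1) (x : M) (σ : Fin 4) :
    θ x (fun _ => stdVec σ) = θ.comps x (chartAt E4 x x) σ :=
  θ.apply_eq_inChart x _

theorem extDeriv_one_apply {η : E4 → E4 [⋀^Fin 1]→L[ℝ] ℝ} {y : E4} (hη : DifferentiableAt ℝ η y)
    (c d : Fin 4) : extDeriv η y ![stdVec c, stdVec d] =
      pd c (fun z => η z fun _ => stdVec d) y - pd d (fun z => η z fun _ => stdVec c) y := by
  have key : ∀ (u : E4) (m : Fin 1 → E4), fderiv ℝ (fun z => η z m) y u = fderiv ℝ η y u m := by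
    intro u m
    have h1 := (ContinuousAlternatingMap.apply ℝ E4 ℝ m).hasFDerivAt.comp y hη.hasFDerivAt
    exact congrArg (fun L => L u) h1.fderiv
  rw [extDeriv_apply hη, Fin.sum_univ_two, pd, pd, key, key]
  have h1 : (Fin.removeNth 0 ![stdVec c, stdVec d] : Fin 1 → E4) = fun _ => stdVec d := by
    ext i : 1
    fin_cases i
    rfl
  have h2 : (Fin.removeNth 1 ![stdVec c, stdVec d] : Fin 1 → E4) = fun _ => stdVec c := by
    ext i : 1
    fin_cases i
    rfl
  rw [h1, h2]
  simp [sub_eq_add_neg, key]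

theorem neg_starAt_one {B : Matrix (Fin 4) (Fin 4) ℝ} {τ : E4 [⋀^Fin 4]→L[ℝ] ℝ}
    (θ : E4 [⋀^Fin 1]→L[ℝ] ℝ) : -starAt (n := 4) (q := 3) rfl B stdVec τ θ =
      ∑ a, (-∑ c, B a c * θ (fun _ => stdVec c)) •
        contractFirst (n := 4) rfl τ (fun _ => stdVec a) := by
  rw [starAt_one]
  ext v
  simp only [ContinuousAlternatingMap.neg_apply, ContinuousAlternatingMap.sum_apply,
    ContinuousAlternatingMap.smul_apply, smul_eq_mul, neg_mul, Finset.sum_neg_distrib]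

omit [IsManifold 𝓘(ℝ, E4) ∞ M] in
theorem Form.neg_one_smul {k : ℕ} (θ : Form M k) : (-1 : ℝ) • θ = -θ := by
  funext x
  ext v
  exact neg_one_mul (θ x v)

theorem trace_toEuclideanCLM (E : Matrix (Fin 4) (Fin 4) ℝ) :
    LinearMap.trace ℝ E4 ((Matrix.toEuclideanCLM (n := Fin 4) (𝕜 := ℝ) E : E4 →L[ℝ] E4) :
      E4 →ₗ[ℝ] E4) = E.trace := by
  have h : ((Matrix.toEuclideanCLM (n := Fin 4) (𝕜 := ℝ) E : E4 →L[ℝ] E4) : E4 →ₗ[ℝ] E4) =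
      Matrix.toLin (PiLp.basisFun 2 ℝ (Fin 4)) (PiLp.basisFun 2 ℝ (Fin 4)) E := by
    rw [← Matrix.toLpLin_eq_toLin]
    rfl
  rw [h, Matrix.trace_toLin_eq]

theorem toEuclideanCLM_stdVec (E : Matrix (Fin 4) (Fin 4) ℝ) (γ α : Fin 4) :
    (Matrix.toEuclideanCLM (n := Fin 4) (𝕜 := ℝ) E (stdVec γ) : E4) α = E α γ := by
  simp [stdVec, Matrix.ofLp_toEuclideanCLM]

/-- In dimension four the trace is `R - 4 · R/2`. -/
theorem trace_einsteinMixed (G : E4 → Matrix (Fin 4) (Fin 4) ℝ) (y : E4)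
    (hs : ((G y)⁻¹)ᵀ = (G y)⁻¹) : (einsteinMixed G y).trace = -scalarCurv G y := by
  have h1 : ((G y)⁻¹ * ricci G y).trace = scalarCurv G y := by
    rw [Matrix.trace, scalarCurv, Finset.sum_comm]
    refine Finset.sum_congr rfl fun α _ => ?_
    rw [Matrix.diag_apply, Matrix.mul_apply]
    refine Finset.sum_congr rfl fun β _ => ?_
    rw [← Matrix.transpose_apply (G y)⁻¹, hs]
  rw [einsteinMixed, Matrix.trace_sub, Matrix.trace_smul, Matrix.trace_one, h1]
  simp
  ring

namespace Spacetime

variable (S : Spacetime M) {T : ∀ x : M, TS x →L[ℝ] TS x}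

theorem box_apply (θ : Form M 1) (x : M) (γ : Fin 4) : S.box θ x (fun _ => stdVec γ) =
    ∑ α, ∑ β, (S.gChart x (chartAt E4 x x))⁻¹ α β *
      covMat2 (S.gChart x) (θ.comps x) α (chartAt E4 x x) β γ := by
  rw [← gram_eq_gChart]
  have h : ∀ c : Fin 4 → ℝ, (∑ ρ : Fin 4, c ρ • (EuclideanSpace.proj ρ : E4 →L[ℝ] ℝ))
      (stdVec γ) = c γ := by
    intro c
    simp [stdVec]
  exact h _

theorem trT_eq (hE : ∀ x : M, S.einstein x = -T x) (x : M) :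
    trT T x = scalarCurv (S.gChart x) (chartAt E4 x x) := by
  have h1 : T x = -S.einstein x := by rw [hE, neg_neg]
  rw [trT, h1]
  refine (map_neg (LinearMap.trace ℝ E4)
    (((Matrix.toEuclideanCLM (n := Fin 4) (𝕜 := ℝ) (einsteinMixed (S.gChart x) (chartAt E4 x x)) :
    E4 →L[ℝ] E4)) : E4 →ₗ[ℝ] E4)).trans ?_
  rw [trace_toEuclideanCLM, trace_einsteinMixed _ _ ((S.isMetricOn x).inv_symm _), neg_neg]

/-- Trace reversal: `T = -(Ric - ½ R)` and `tr T = R`, so `T(θ) = -Ric(θ) + ½ (tr T) θ`. -/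
theorem applyTensor_apply (hE : ∀ x : M, S.einstein x = -T x) (θ : Form M 1) (x : M) (γ : Fin 4) :
    applyTensor T θ x (fun _ => stdVec γ) =
      -∑ l, ricci (S.gChart x) (chartAt E4 x x) l γ *
        ((S.gChart x (chartAt E4 x x))⁻¹ *ᵥ θ.comps x (chartAt E4 x x)) l +
      (1 / 2) * (trT T x * θ.comps x (chartAt E4 x x) γ) := by
  set y := chartAt E4 x x with hy
  set H := (S.gChart x y)⁻¹ with hH
  have hs : Hᵀ = H := (S.isMetricOn x).inv_symm y
  have h1 : T x = -S.einstein x := by rw [hE, neg_neg]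
  have h2 : ∀ α, (show E4 from T x (coordVec x γ)) α = -einsteinMixed (S.gChart x) y α γ := by
    intro α
    rw [h1]
    exact congrArg Neg.neg (toEuclideanCLM_stdVec _ γ α)
  have h3 : applyTensor T θ x (fun _ => stdVec γ) =
      ∑ α, (-einsteinMixed (S.gChart x) y α γ) * θ.comps x y α := by
    refine (oneForm_apply (θ x) (T x (coordVec x γ))).trans ?_
    exact Finset.sum_congr rfl fun α _ => congrArg₂ (· * ·) (h2 α) (θ.apply_stdVec x α)
  rw [h3, S.trT_eq hE]
  have h4 : ∑ l, ricci (S.gChart x) y l γ * (H *ᵥ θ.comps x y) l =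
      ∑ α, (H * ricci (S.gChart x) y) α γ * θ.comps x y α := by
    simp only [Matrix.mulVec, dotProduct, Matrix.mul_apply, Finset.mul_sum, Finset.sum_mul]
    rw [Finset.sum_comm]
    refine Finset.sum_congr rfl fun α _ => Finset.sum_congr rfl fun l _ => ?_
    have : H l α = H α l := by rw [← Matrix.transpose_apply H, hs]
    rw [this]
    ring
  rw [h4]
  simp only [einsteinMixed, Matrix.sub_apply, Matrix.smul_apply, smul_eq_mul, neg_sub, sub_mul,
    Finset.sum_sub_distrib, ← hH, ← hy]
  have h5 : ∑ α, scalarCurv (S.gChart x) y / 2 * (1 : Matrix (Fin 4) (Fin 4) ℝ) α γ *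
      θ.comps x y α = (1 / 2) * (scalarCurv (S.gChart x) y * θ.comps x y γ) := by
    rw [Finset.sum_eq_single γ (fun α _ hα => by simp [Matrix.one_apply_ne hα]) (by simp)]
    simp
    ring
  rw [h5]
  ring

variable {A : ∀ x : M, TS x}

/-- The two matter terms add up to `Ric(A)`, which is what the contracted Ricci identity needs to
turn the current into the divergence of `F`. -/
theorem komarCurrent_apply (hE : ∀ x : M, S.einstein x = -T x) (hA : IsSmoothVectorField A)
    (x : M) (γ : Fin 4) : S.komarCurrent T A x (fun _ => stdVec γ) =
      ∑ α, ∑ μ, (S.gChart x (chartAt E4 x x))⁻¹ α μ *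
        (covMat2 (S.gChart x) ((S.flat A).comps x) α (chartAt E4 x x) μ γ -
          covMat2 (S.gChart x) ((S.flat A).comps x) α (chartAt E4 x x) γ μ) := by
  have hθ := S.isSmooth_flat hA
  have hy := mem_chart_target E4 x
  rw [(S.isMetricOn x).sum_inv_covMat2 hy (hθ.smoothVec_comps hy)]
  have h1 : S.komarCurrent T A x (fun _ => stdVec γ) =
      -applyTensor T (S.flat A) x (fun _ => stdVec γ) +
        (1 / 2 : ℝ) * (trT T x * S.flat A x (fun _ => stdVec γ)) +
        (S.codiff 0 (l := 3) rfl (S.flat A)).d x (fun _ => stdVec γ) +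
        S.box (S.flat A) x (fun _ => stdVec γ) := rfl
  rw [h1, S.applyTensor_apply hE, S.box_apply, S.d_codiff_zero_apply hθ, Form.apply_stdVec]
  ring

/-- The Maxwell equation `d⋆F = -⋆J_A`, from which all global statements follow. At each `x` it
compares coefficients of the 3-forms `i_b τ` in the chart centred at `x`. -/
theorem d_hodge_d_flat (hE : ∀ x : M, S.einstein x = -T x) (hA : IsSmoothVectorField A) :
    (S.hodge (p := 2) (q := 2) rfl (S.flat A).d).d =
      -S.hodge (p := 1) (q := 3) rfl (S.komarCurrent T A) := by
  have hθ := S.isSmooth_flat hA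
  funext x
  have hy := mem_chart_target E4 x
  have hm := S.isMetricOn x
  set y := chartAt E4 x x with hy0
  set G := S.gChart x with hG
  set a := (S.flat A).comps x with ha0
  have ha : SmoothVec a y := hθ.smoothVec_comps hy
  have hv := contDiffAt_apply (S.vol_smooth.contDiffAt x hy) stdVec
  set v : E4 → ℝ := fun z => S.vol.inChart x z stdVec with hv0
  have hvy : v y ≠ 0 := S.vol_inChart_ne_zero hy
  have hi := hm.smooth_inv hy
  have hc := hm.smooth_covMat hy ha
  have h1 : (S.hodge (p := 2) (q := 2) rfl (S.flat A).d).inChart x =ᶠ[𝓝 y] fun z =>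
      starAt (n := 4) (q := 2) rfl (G z)⁻¹ stdVec (S.vol.inChart x z)
        ((S.flat A).d.inChart x z) := by
    filter_upwards [(chartAt E4 x).open_target.mem_nhds hy] with z hz
      using S.inChart_hodge rfl _ hz
  -- The raised components of `F` as a matrix product. The equality is needed near `y`, not only at
  -- `y`, because it is differentiated.
  have h2 : ∀ b c, (fun z => S.vol.inChart x z stdVec *
      ∑ k, ∑ d, (G z)⁻¹ b k * (G z)⁻¹ c d * (S.flat A).d.inChart x z ![stdVec k, stdVec d])
      =ᶠ[𝓝 y] fun z => v z *
        ((G z)⁻¹ * (covMat G a z - (covMat G a z)ᵀ) * (G z)⁻¹) b c := by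
    intro b c
    filter_upwards [(chartAt E4 x).open_target.mem_nhds hy] with z hz
    refine congrArg (v z * ·) ?_
    have h3 : ∀ k d, (S.flat A).d.inChart x z ![stdVec k, stdVec d] =
        (covMat G a z - (covMat G a z)ᵀ) k d := by
      intro k d
      rw [hθ.inChart_d hz, extDeriv_one_apply
        ((hθ.contDiffAt x hz).differentiableAt (by norm_num)), covMat_sub_transpose_apply hm]
      rfl
    simp only [h3, Matrix.mul_apply, Finset.sum_mul]
    rw [Finset.sum_comm]
    refine Finset.sum_congr rfl fun d _ => Finset.sum_congr rfl fun k _ => ?_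
    have : (G z)⁻¹ c d = (G z)⁻¹ d c := by rw [← Matrix.transpose_apply (G z)⁻¹, hm.inv_symm]
    rw [this]
    ring
  have hW : ∀ b c, DifferentiableAt ℝ (fun z => S.vol.inChart x z stdVec *
      ∑ k, ∑ d, (G z)⁻¹ b k * (G z)⁻¹ c d * (S.flat A).d.inChart x z ![stdVec k, stdVec d]) y :=
    fun b c => ((h2 b c).differentiableAt_iff).2
      ((hv.mul (((hi.mul (hc.sub hc.transpose)).mul hi) b c)).differentiableAt (by norm_num))
  have h4 : (S.hodge (p := 2) (q := 2) rfl (S.flat A).d).d x =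
      extDeriv (fun z => starAt (n := 4) (q := 2) rfl (G z)⁻¹ stdVec (S.vol.inChart x z)
        ((S.flat A).d.inChart x z)) y := h1.extDeriv_eq
  have h5 : (S.hodge (p := 1) (q := 3) rfl (S.komarCurrent T A) x : E4 [⋀^Fin 3]→L[ℝ] ℝ) =
      starAt (n := 4) (q := 3) rfl (G y)⁻¹ stdVec (S.vol.inChart x y) (S.komarCurrent T A x) := by
    refine (S.hodge_apply_eq (p := 1) (q := 3) rfl _ x).trans ?_
    rw [S.gram_eq_gChart]
    exact congrArg (fun τ => starAt (n := 4) (q := 3) rfl (G y)⁻¹ stdVec τ (S.komarCurrent T A x))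
      (Form.eq_inChart S.vol x)
  refine (h4.trans (extDeriv_starAt_two hvy hW)).trans ?_
  refine Eq.trans ?_ (congrArg Neg.neg h5).symm
  refine Eq.trans ?_ (neg_starAt_one _).symm
  refine Finset.sum_congr rfl fun b _ => ?_
  refine congrArg (fun r : ℝ => r • contractFirst (n := 4) (q := 3) rfl (S.vol.inChart x y)
    fun _ => stdVec b) ?_
  have h6 : ∑ α, pd α (fun z => S.vol.inChart x z stdVec *
      ∑ k, ∑ d, (G z)⁻¹ α k * (G z)⁻¹ b d * (S.flat A).d.inChart x z ![stdVec k, stdVec d]) y = _ :=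
    (Finset.sum_congr rfl fun α _ => pd_congr (h2 α b)).trans
      (hm.sum_pd_volume_mul_two hy ha hv (fun z _ => S.vol_inChart_sq x z) b)
  rw [h6, neg_mul, ← mul_assoc]
  refine congrArg Neg.neg ?_
  have h7 : (S.vol.inChart x y stdVec)⁻¹ * v y = 1 := inv_mul_cancel₀ hvy
  rw [h7, one_mul]
  refine Finset.sum_congr rfl fun γ _ => congrArg _ ?_
  exact (S.komarCurrent_apply hE hA x γ).symm

theorem codiff_eq_smul (k : ℕ) {l : ℕ} (h : k + l + 1 = 4) {θ : Form M (k + 1)} {ξ : Form M k}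
    (hξ : S.hodge (p := l + 1) (q := k) (by omega)
      (S.hodge (p := k + 1) (q := l) (by omega) θ).d = ξ) :
    S.codiff k h θ = (-1 : ℝ) ^ (k + 1) • (((-1 : ℝ) ^ ((l + 1) * k) * (-1)) • ξ) := by
  rw [S.codiff_eq, hξ]

theorem codiff_d_flat (hE : ∀ x : M, S.einstein x = -T x) (hA : IsSmoothVectorField A) :
    S.codiff 1 (l := 2) rfl (S.flat A).d = -S.komarCurrent T A := by
  have h1 : S.hodge (p := 3) (q := 1) rfl (S.hodge (p := 2) (q := 2) rfl (S.flat A).d).d =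
      (-1 : ℝ) • S.komarCurrent T A := by
    rw [S.d_hodge_d_flat hE hA, ← Form.neg_one_smul, S.hodge_smul, S.hodge_hodge_one]
  rw [S.codiff_eq_smul 1 (l := 2) rfl h1, ← Form.neg_one_smul]
  -- The codifferential signs are `(-1)² · (-1)³ · (-1) = 1`, so here `δ` is simply `⋆d⋆`.
  norm_num

theorem isSmooth_hodge_d_flat (hA : IsSmoothVectorField A) :
    (S.hodge (p := 2) (q := 2) rfl (S.flat A).d).IsSmooth :=
  S.isSmooth_hodge_two (S.isSmooth_flat hA).d

theorem hodge_komarCurrent (hE : ∀ x : M, S.einstein x = -T x) (hA : IsSmoothVectorField A) :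
    S.hodge (p := 1) (q := 3) rfl (S.komarCurrent T A) =
      (-1 : ℝ) • (S.hodge (p := 2) (q := 2) rfl (S.flat A).d).d := by
  rw [S.d_hodge_d_flat hE hA, Form.neg_one_smul, neg_neg]

theorem codiff_komarCurrent (hE : ∀ x : M, S.einstein x = -T x) (hA : IsSmoothVectorField A) :
    S.codiff 0 (l := 3) rfl (S.komarCurrent T A) = 0 := by
  have h1 : (S.hodge (p := 1) (q := 3) rfl (S.komarCurrent T A)).d = 0 := by
    rw [S.hodge_komarCurrent hE hA, Form.d_smul, (S.isSmooth_hodge_d_flat hA).d_d, smul_zero]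
  have h2 : S.hodge (p := 4) (q := 0) rfl
      (S.hodge (p := 1) (q := 3) rfl (S.komarCurrent T A)).d = 0 := by
    rw [h1]
    exact funext fun x => S.hodge_apply_eq_zero rfl rfl
  rw [S.codiff_eq_smul 0 (l := 3) rfl h2]
  funext x
  ext v
  change (-1 : ℝ) ^ (0 + 1) * (((-1 : ℝ) ^ ((3 + 1) * 0) * (-1)) * 0) = 0
  norm_num

end Spacetime

end Maxwell

/-! ### Killing vector fields -/

section LieForm

variable {E : Type*} [NormedAddCommGroup E] [NormedSpace ℝ E]

theorem differentiableAt_sum_smul_const {ι : Type*} [Fintype ι] {F : Type*}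
    [NormedAddCommGroup F] [NormedSpace ℝ F] {f : ι → ι → E → ℝ} {y : E}
    (hf : ∀ i j, DifferentiableAt ℝ (f i j) y) (c : ι → ι → F) :
    DifferentiableAt ℝ (fun z => ∑ i, ∑ j, f i j z • c i j) y :=
  DifferentiableAt.fun_sum fun i _ => DifferentiableAt.fun_sum fun j _ => (hf i j).smul_const _

/-- The field of bilinear forms with components `G` in the basis of linear forms `φ`. -/
def matrixForm {ι : Type*} [Fintype ι] (φ : ι → E →L[ℝ] ℝ) (G : E → Matrix ι ι ℝ) (y : E) :
    E →L[ℝ] E →L[ℝ] ℝ :=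
  ∑ μ, ∑ ν, G y μ ν • (φ μ).smulRight (φ ν)

theorem differentiableAt_matrixForm {ι : Type*} [Fintype ι] {φ : ι → E →L[ℝ] ℝ}
    {G : E → Matrix ι ι ℝ} {y : E} (hG : ∀ i j, DifferentiableAt ℝ (fun z => G z i j) y) :
    DifferentiableAt ℝ (matrixForm φ G) y :=
  differentiableAt_sum_smul_const (F := E →L[ℝ] E →L[ℝ] ℝ) (f := fun i j z => G z i j) hG
    fun i j => (φ i).smulRight (φ j)

/-- The Lie derivative of a field of bilinear forms along a vector field on a vector space. -/
def lieForm (g : E → E →L[ℝ] E →L[ℝ] ℝ) (A : E → E) (y u w : E) : ℝ :=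
  fderiv ℝ g y (A y) u w + g y (fderiv ℝ A y u) w + g y u (fderiv ℝ A y w)

theorem fderiv_bilinear_apply {g : E → E →L[ℝ] E →L[ℝ] ℝ} {g' : E →L[ℝ] E →L[ℝ] E →L[ℝ] ℝ}
    {a b : E → E} {a' b' : E →L[ℝ] E} {y : E} (hg : HasFDerivAt g g' y) (ha : HasFDerivAt a a' y)
    (hb : HasFDerivAt b b' y) (t : E) : fderiv ℝ (fun z => g z (a z) (b z)) y t =
      g' t (a y) (b y) + g y (a' t) (b y) + g y (a y) (b' t) := by
  rw [((hg.clm_apply ha).clm_apply hb).fderiv]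
  simp only [_root_.add_apply, ContinuousLinearMap.comp_apply, ContinuousLinearMap.flip_apply]
  ring

/-- Naturality of the Lie derivative. The second derivatives of `f` arising from `g₁` along `A₁`
match those arising from `A₂`, because `D²f` is symmetric. -/
theorem lieForm_change {g₁ g₂ : E → E →L[ℝ] E →L[ℝ] ℝ} {A₁ A₂ f : E → E} {y : E}
    (hf : ContDiffAt ℝ ∞ f y) (hg₁ : DifferentiableAt ℝ g₁ y) (hg₂ : DifferentiableAt ℝ g₂ (f y))
    (hA₁ : DifferentiableAt ℝ A₁ y) (hA₂ : DifferentiableAt ℝ A₂ (f y))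
    (hg : ∀ᶠ z in 𝓝 y, ∀ u w, g₁ z u w = g₂ (f z) (fderiv ℝ f z u) (fderiv ℝ f z w))
    (hA : ∀ᶠ z in 𝓝 y, A₂ (f z) = fderiv ℝ f z (A₁ z)) (u w : E) :
    lieForm g₁ A₁ y u w = lieForm g₂ A₂ (f y) (fderiv ℝ f y u) (fderiv ℝ f y w) := by
  have hf1 : DifferentiableAt ℝ f y := hf.differentiableAt (by norm_num)
  have hP : DifferentiableAt ℝ (fderiv ℝ f) y :=
    (hf.fderiv_right (m := 1) (by norm_cast)).differentiableAt (by norm_num)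
  have hs : ∀ v w, fderiv ℝ (fderiv ℝ f) y v w = fderiv ℝ (fderiv ℝ f) y w v :=
    (hf.of_le (m := 2) (by norm_cast)).isSymmSndFDerivAt (by simp)
  have hPv : ∀ v, HasFDerivAt (fun z => fderiv ℝ f z v)
      ((fderiv ℝ (fderiv ℝ f) y).flip v) y := fun v =>
    (hP.hasFDerivAt.clm_apply (hasFDerivAt_const v y)).congr_fderiv (by ext t; simp)
  have h1 : ∀ v, fderiv ℝ A₂ (f y) (fderiv ℝ f y v) =
      fderiv ℝ f y (fderiv ℝ A₁ y v) + fderiv ℝ (fderiv ℝ f) y v (A₁ y) := by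
    intro v
    have e1 := (hA₂.hasFDerivAt.comp y hf1.hasFDerivAt).fderiv
    have e2 := (hP.hasFDerivAt.clm_apply hA₁.hasFDerivAt).fderiv
    have e3 : fderiv ℝ (A₂ ∘ f) y = fderiv ℝ (fun z => fderiv ℝ f z (A₁ z)) y :=
      Filter.EventuallyEq.fderiv_eq hA
    rw [e1, e2] at e3
    exact congrArg (fun L => L v) e3
  have h2 : ∀ t, fderiv ℝ g₁ y t u w =
      fderiv ℝ g₂ (f y) (fderiv ℝ f y t) (fderiv ℝ f y u) (fderiv ℝ f y w) +
      g₂ (f y) (fderiv ℝ (fderiv ℝ f) y t u) (fderiv ℝ f y w) +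
      g₂ (f y) (fderiv ℝ f y u) (fderiv ℝ (fderiv ℝ f) y t w) := by
    intro t
    have e1 := fderiv_bilinear_apply hg₁.hasFDerivAt (hasFDerivAt_const u y)
      (hasFDerivAt_const w y) t
    have e0 : HasFDerivAt (g₂ ∘ f) ((fderiv ℝ g₂ (f y)).comp (fderiv ℝ f y)) y :=
      HasFDerivAt.comp (G := E →L[ℝ] E →L[ℝ] ℝ) y hg₂.hasFDerivAt hf1.hasFDerivAt
    have e2 := fderiv_bilinear_apply e0 (hPv u) (hPv w) t
    have e3 : fderiv ℝ (fun z => g₁ z u w) y =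
        fderiv ℝ (fun z => (g₂ ∘ f) z (fderiv ℝ f z u) (fderiv ℝ f z w)) y :=
      Filter.EventuallyEq.fderiv_eq (hg.mono fun z hz => hz u w)
    rw [e3, e2] at e1
    simpa using e1.symm
  have hy := hg.self_of_nhds
  rw [lieForm, lieForm, h2, hy, hy, h1, h1, hA.self_of_nhds, hs u, hs w]
  simp only [map_add, _root_.add_apply]
  ring

theorem lieForm_eq_zero {g : E4 → E4 →L[ℝ] E4 →L[ℝ] ℝ} {A : E4 → E4} {y : E4}
    (h : ∀ μ ν, lieForm g A y (stdVec μ) (stdVec ν) = 0) (u w : E4) : lieForm g A y u w = 0 := by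
  have e : lieForm g A y u w = ∑ μ, ∑ ν, u μ * (w ν * lieForm g A y (stdVec μ) (stdVec ν)) := by
    conv_lhs => rw [← sum_stdVec u, ← sum_stdVec w]
    simp only [lieForm, map_sum, map_smul, _root_.sum_apply, _root_.smul_apply, smul_eq_mul,
      Finset.mul_sum, ← Finset.sum_add_distrib]
    rw [Finset.sum_comm]
    refine Finset.sum_congr rfl fun μ _ => Finset.sum_congr rfl fun ν _ => ?_
    ring
  rw [e]
  simp [h]

end LieForm

/-! ### The Killing equation in charts and the skewness of the covariant derivative -/

section Killing

variable {M : Type*} [TopologicalSpace M] [ChartedSpace E4 M] [IsManifold 𝓘(ℝ, E4) ∞ M]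

omit [IsManifold 𝓘(ℝ, E4) ∞ M] in
theorem vecInChart_chart (A : ∀ x : M, TS x) {x₀ p : M} (hp : p ∈ (chartAt E4 x₀).source) :
    vecInChart A x₀ (chartAt E4 x₀ p) =
      mfderiv 𝓘(ℝ, E4) 𝓘(ℝ, E4) (chartAt E4 x₀) p (A p) := by
  have key : ∀ q, q = p → (mfderiv 𝓘(ℝ, E4) 𝓘(ℝ, E4) (chartAt E4 x₀) q (A q) : E4) =
      mfderiv 𝓘(ℝ, E4) 𝓘(ℝ, E4) (chartAt E4 x₀) p (A p) := by
    rintro q rfl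
    rfl
  exact key _ ((chartAt E4 x₀).left_inv hp)

namespace Spacetime

variable (S : Spacetime M)

/-- The metric in the preferred chart at `x₀`, as a field of bilinear forms. -/
def gForm (x₀ : M) (y : E4) : E4 →L[ℝ] E4 →L[ℝ] ℝ :=
  matrixForm (fun μ => (EuclideanSpace.proj μ : E4 →L[ℝ] ℝ)) (S.gChart x₀) y

theorem gForm_apply (x₀ : M) (y u w : E4) : S.gForm x₀ y u w =
    S.g ((chartAt E4 x₀).symm y) (chartSymmDeriv x₀ y u) (chartSymmDeriv x₀ y w) := by
  conv_rhs => rw [← sum_stdVec u, ← sum_stdVec w]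
  simp only [gForm, matrixForm, gChart, map_sum, map_smul, _root_.sum_apply, _root_.smul_apply, smul_eq_mul,
    Matrix.of_apply, ContinuousLinearMap.smulRight_apply, Finset.mul_sum]
  rw [Finset.sum_comm]
  refine Finset.sum_congr rfl fun μ _ => Finset.sum_congr rfl fun ν _ => ?_
  change _ * (u ν * w μ) = _
  ring

theorem gForm_stdVec (x₀ : M) (y : E4) (μ ν : Fin 4) :
    S.gForm x₀ y (stdVec μ) (stdVec ν) = S.gChart x₀ y μ ν := S.gForm_apply _ _ _ _

theorem differentiableAt_gForm {x₀ : M} {y : E4} (hy : y ∈ (chartAt E4 x₀).target) :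
    DifferentiableAt ℝ (S.gForm x₀) y := by
  exact differentiableAt_matrixForm
    fun μ ν => (S.contDiffAt_gChart hy μ ν).differentiableAt (by norm_num)

theorem gForm_chart {x₀ p : M} (hp : p ∈ (chartAt E4 x₀).source) (u w : TS p) :
    S.gForm x₀ (chartAt E4 x₀ p) (mfderiv 𝓘(ℝ, E4) 𝓘(ℝ, E4) (chartAt E4 x₀) p u)
      (mfderiv 𝓘(ℝ, E4) 𝓘(ℝ, E4) (chartAt E4 x₀) p w) = S.g p u w := by
  refine (S.gForm_apply _ _ _ _).trans ?_
  have key : ∀ (q : M) (hq : q = p) (L : E4 →L[ℝ] TS q),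
      (∀ v : E4, (L (mfderiv 𝓘(ℝ, E4) 𝓘(ℝ, E4) (chartAt E4 x₀) p v) : E4) = v) →
      S.g q (L (mfderiv 𝓘(ℝ, E4) 𝓘(ℝ, E4) (chartAt E4 x₀) p u))
        (L (mfderiv 𝓘(ℝ, E4) 𝓘(ℝ, E4) (chartAt E4 x₀) p w)) = S.g p u w := by
    rintro q rfl L hL
    have h1 : L (mfderiv 𝓘(ℝ, E4) 𝓘(ℝ, E4) (chartAt E4 x₀) q u) = u := hL u
    have h2 : L (mfderiv 𝓘(ℝ, E4) 𝓘(ℝ, E4) (chartAt E4 x₀) q w) = w := hL w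
    rw [h1, h2]
  exact key _ ((chartAt E4 x₀).left_inv hp) _
    fun v => congrArg (fun L => L v) (mfderiv_chart_symm_comp hp)

variable {A : ∀ x : M, TS x}

theorem lieForm_gForm_stdVec (hA : IsSmoothVectorField A) {x₀ : M} {y : E4}
    (hy : y ∈ (chartAt E4 x₀).target) (μ ν : Fin 4) :
    lieForm (S.gForm x₀) (vecInChart A x₀) y (stdVec μ) (stdVec ν) =
      ∑ κ, (vecInChart A x₀ y κ * pd κ (fun z => S.gChart x₀ z μ ν) y
      + S.gChart x₀ y κ ν * pd μ (fun z => vecInChart A x₀ z κ) y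
      + S.gChart x₀ y μ κ * pd ν (fun z => vecInChart A x₀ z κ) y) := by
  have hd : DifferentiableAt ℝ (vecInChart A x₀) y :=
    (hA.contDiffAt_vecInChart hy).differentiableAt (by norm_num)
  have h1 : ∀ (κ : Fin 4) (v : E4), fderiv ℝ (fun z => vecInChart A x₀ z κ) y v =
      fderiv ℝ (vecInChart A x₀) y v κ := by
    intro κ v
    exact congrArg (fun L => L v) ((EuclideanSpace.proj κ : E4 →L[ℝ] ℝ).hasFDerivAt.comp y
      hd.hasFDerivAt).fderiv
  have h2 : ∀ v, fderiv ℝ (fun z => S.gChart x₀ z μ ν) y v =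
      fderiv ℝ (S.gForm x₀) y v (stdVec μ) (stdVec ν) := by
    intro v
    have e := fderiv_bilinear_apply (S.differentiableAt_gForm hy).hasFDerivAt
      (hasFDerivAt_const (stdVec μ) y) (hasFDerivAt_const (stdVec ν) y) v
    simp only [S.gForm_stdVec] at e
    rw [e]
    simp
  rw [lieForm]
  conv_lhs =>
    rw [← sum_stdVec (vecInChart A x₀ y), ← sum_stdVec (fderiv ℝ (vecInChart A x₀) y (stdVec μ)),
      ← sum_stdVec (fderiv ℝ (vecInChart A x₀) y (stdVec ν))]
  simp only [map_sum, map_smul, _root_.sum_apply, _root_.smul_apply, smul_eq_mul,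
    S.gForm_stdVec, pd, h1, h2, ← Finset.sum_add_distrib]
  refine Finset.sum_congr rfl fun κ _ => ?_
  ring

/-- The Killing equation holds in every preferred chart. -/
theorem IsKilling.sum_eq_zero {S : Spacetime M} (hK : S.IsKilling A) (hA : IsSmoothVectorField A)
    {x₀ : M} {y : E4} (hy : y ∈ (chartAt E4 x₀).target) (μ ν : Fin 4) :
    ∑ κ, (vecInChart A x₀ y κ * pd κ (fun z => S.gChart x₀ z μ ν) y
      + S.gChart x₀ y κ ν * pd μ (fun z => vecInChart A x₀ z κ) y
      + S.gChart x₀ y μ κ * pd ν (fun z => vecInChart A x₀ z κ) y) = 0 := by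
  rw [← S.lieForm_gForm_stdVec hA hy]
  set p := (chartAt E4 x₀).symm y with hp
  have hpt := mem_chart_target E4 p
  -- The transition map to the chart centred at `p`. `IsKilling` gives the equation only at chart
  -- centres, so it is used at `p` and carried back by `lieForm_change`.
  set f : E4 → E4 := fun z => chartAt E4 p ((chartAt E4 x₀).symm z) with hf0
  have hev : ∀ᶠ z in 𝓝 y, z ∈ (chartAt E4 x₀).target ∧
      (chartAt E4 x₀).symm z ∈ (chartAt E4 p).source :=
    Filter.Eventually.and ((chartAt E4 x₀).open_target.mem_nhds hy)
      (((chartAt E4 x₀).symm.continuousAt hy).preimage_mem_nhds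
        ((chartAt E4 p).open_source.mem_nhds (mem_chart_source E4 p)))
  have hf : ContDiffAt ℝ ∞ f y := by
    rw [← contMDiffAt_iff_contDiffAt]
    exact (contMDiffAt_chart (mem_chart_source E4 p)).comp y (contMDiffAt_chart_symm hy)
  have hfd : ∀ z ∈ (chartAt E4 x₀).target, (chartAt E4 x₀).symm z ∈ (chartAt E4 p).source →
      ∀ v, fderiv ℝ f z v = mfderiv 𝓘(ℝ, E4) 𝓘(ℝ, E4) (chartAt E4 p) ((chartAt E4 x₀).symm z)
        (chartSymmDeriv x₀ z v) := by
    intro z hz hz' v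
    rw [← mfderiv_eq_fderiv]
    have := mfderiv_comp z ((contMDiffAt_chart hz').mdifferentiableAt (by norm_num))
      ((contMDiffAt_chart_symm hz).mdifferentiableAt (by norm_num))
    exact congrArg (fun L : E4 →L[ℝ] E4 => L v) this
  rw [lieForm_change (g₂ := S.gForm p) (A₂ := vecInChart A p) hf (S.differentiableAt_gForm hy)
    (S.differentiableAt_gForm hpt) ((hA.contDiffAt_vecInChart hy).differentiableAt (by norm_num))
    ((hA.contDiffAt_vecInChart hpt).differentiableAt (by norm_num))]
  · refine lieForm_eq_zero (fun μ ν => ?_) _ _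
    exact (S.lieForm_gForm_stdVec hA hpt μ ν).trans (hK p μ ν)
  · filter_upwards [hev] with z hz u w
    rw [hfd z hz.1 hz.2, hfd z hz.1 hz.2, S.gForm_apply]
    exact (S.gForm_chart hz.2 _ _).symm
  · filter_upwards [hev] with z hz
    rw [hfd z hz.1 hz.2]
    refine (vecInChart_chart A hz.2).trans ?_
    exact congrArg (mfderiv 𝓘(ℝ, E4) 𝓘(ℝ, E4) (chartAt E4 p) ((chartAt E4 x₀).symm z))
      (chartSymmDeriv_comp_mfderiv hz.1 _).symm

theorem comps_flat {x₀ : M} {y : E4} (hy : y ∈ (chartAt E4 x₀).target) (σ : Fin 4) :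
    (S.flat A).comps x₀ y σ = ∑ κ, vecInChart A x₀ y κ * S.gChart x₀ y κ σ := by
  have h1 : (S.flat A).comps x₀ y σ = S.gForm x₀ y (vecInChart A x₀ y) (stdVec σ) := by
    rw [S.gForm_apply, vecInChart, chartSymmDeriv_comp_mfderiv hy]
    rfl
  rw [h1]
  conv_lhs => rw [← sum_stdVec (vecInChart A x₀ y)]
  simp only [map_sum, map_smul, _root_.sum_apply, _root_.smul_apply, smul_eq_mul, S.gForm_stdVec]

/-- With the index of `a` raised, the connection terms become first-kind symbols, and `D_β a_ρ + D_ρ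
a_β` reduces to the coordinate Lie derivative of the metric. -/
theorem IsKilling.covMat_skew {S : Spacetime M} (hK : S.IsKilling A) (hA : IsSmoothVectorField A)
    {x₀ : M} {y : E4} (hy : y ∈ (chartAt E4 x₀).target) :
    (covMat (S.gChart x₀) ((S.flat A).comps x₀) y)ᵀ =
      -covMat (S.gChart x₀) ((S.flat A).comps x₀) y := by
  have hm := S.isMetricOn x₀
  set G := S.gChart x₀ with hG
  set V := vecInChart A x₀ with hV
  have hVs : ∀ κ, ContDiffAt ℝ ∞ (fun z => V z κ) y := fun κ =>
    (EuclideanSpace.proj κ : E4 →L[ℝ] ℝ).contDiff.contDiffAt.comp y (hA.contDiffAt_vecInChart hy)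
  have hd : ∀ β ρ, pd β (fun z => (S.flat A).comps x₀ z ρ) y =
      ∑ κ, (pd β (fun z => V z κ) y * G y κ ρ + V y κ * pd β (fun z => G z κ ρ) y) := by
    intro β ρ
    have e : (fun z => (S.flat A).comps x₀ z ρ) =ᶠ[𝓝 y] fun z => ∑ κ, V z κ * G z κ ρ := by
      filter_upwards [(chartAt E4 x₀).open_target.mem_nhds hy] with z hz using S.comps_flat hz ρ
    rw [pd_congr e, pd_sum fun κ _ => (hVs κ).mul (hm.smooth y hy κ ρ)]
    exact Finset.sum_congr rfl fun κ _ => pd_mul (hVs κ) (hm.smooth y hy κ ρ)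
  have hc : ∀ β ρ, ∑ κ, christoffel G κ β ρ y * (S.flat A).comps x₀ y κ =
      ∑ κ, V y κ * ((1 / 2) * (pd β (fun z => G z κ ρ) y + pd ρ (fun z => G z κ β) y
        - pd κ (fun z => G z β ρ) y)) := by
    intro β ρ
    simp only [← hm.mul_connMat hy β ρ, S.comps_flat hy, Matrix.mul_apply, connMat,
      Matrix.of_apply, Finset.mul_sum]
    rw [Finset.sum_comm]
    exact Finset.sum_congr rfl fun κ _ => Finset.sum_congr rfl fun l _ => by ring
  have key : ∀ β ρ, covMat G ((S.flat A).comps x₀) y ρ β +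
      covMat G ((S.flat A).comps x₀) y β ρ = 0 := by
    intro β ρ
    rw [← hK.sum_eq_zero hA hy β ρ]
    simp only [covMat, covD, Matrix.of_apply, hd, hc]
    rw [← Finset.sum_sub_distrib, ← Finset.sum_sub_distrib, ← Finset.sum_add_distrib]
    refine Finset.sum_congr rfl fun κ _ => ?_
    rw [hm.pd_symm κ ρ β, ← hG, hm.apply_symm y β κ]
    ring
  ext β ρ
  exact eq_neg_of_add_eq_zero_left (key β ρ)

end Spacetime

end Killing

/-! ### The charge of a Killing vector field -/

/-- Skewness must hold on an open set, since it is differentiated once: it kills the gradient of the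
divergence and makes `D_α D_β a_ρ` skew in `β, ρ`. -/
theorem IsMetricOn.sum_inv_covMat2_of_skew {G : E4 → Matrix (Fin 4) (Fin 4) ℝ} {U : Set E4}
    {a : E4 → Fin 4 → ℝ} {y : E4} (h : IsMetricOn G U) (hy : y ∈ U) (ha : SmoothVec a y)
    (hs : ∀ z ∈ U, (covMat G a z)ᵀ = -covMat G a z) (γ : Fin 4) :
    ∑ α, ∑ μ, (G y)⁻¹ α μ * (covMat2 G a α y μ γ - covMat2 G a α y γ μ) =
      2 * ∑ l, ricci G y l γ * ((G y)⁻¹ *ᵥ a y) l := by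
  have hnhds := h.isOpen.mem_nhds hy
  have hdiv : divergence G a =ᶠ[𝓝 y] fun _ => 0 := by
    filter_upwards [hnhds] with z hz
    have h1 : ((G z)⁻¹ * covMat G a z).trace = -((G z)⁻¹ * covMat G a z).trace := by
      conv_lhs => rw [← Matrix.trace_transpose, Matrix.transpose_mul, hs z hz, h.inv_symm,
        Matrix.neg_mul, Matrix.trace_neg, Matrix.trace_mul_comm]
    rw [divergence]
    linarith
  have hpd : pd γ (divergence G a) y = 0 := by
    rw [pd_congr hdiv]
    simp [pd]
  have hskew : ∀ α, (covMat2 G a α y)ᵀ = -covMat2 G a α y := by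
    intro α
    have h1 : (pdMat α (covMat G a) y)ᵀ = -pdMat α (covMat G a) y := by
      ext i j
      have e : (fun z => covMat G a z j i) =ᶠ[𝓝 y] fun z => -covMat G a z i j := by
        filter_upwards [hnhds] with z hz
        exact congrFun (congrFun (hs z hz) i) j
      exact (pd_congr e).trans pd_neg
    rw [covMat2_eq]
    simp only [Matrix.transpose_sub, Matrix.transpose_mul, Matrix.transpose_transpose, h1,
      hs y hy, Matrix.neg_mul, Matrix.mul_neg]
    abel
  have hsw : ∀ α μ, covMat2 G a α y γ μ = -covMat2 G a α y μ γ := fun α μ =>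
    congrFun (congrFun (hskew α) μ) γ
  have key := h.sum_inv_covMat2 hy ha γ
  rw [hpd] at key
  have h2 : ∑ α, ∑ μ, (G y)⁻¹ α μ * (covMat2 G a α y μ γ - covMat2 G a α y γ μ) =
      2 * ∑ α, ∑ μ, (G y)⁻¹ α μ * covMat2 G a α y μ γ := by
    simp only [Finset.mul_sum, hsw]
    exact Finset.sum_congr rfl fun α _ => Finset.sum_congr rfl fun μ _ => by ring
  -- The contraction is `2□a` by skewness and `□a + Ric(a)` by the Ricci identity; eliminating `□a`
  -- gives `2 Ric(a)`.
  linarith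

section Charge

variable {M : Type*} [TopologicalSpace M] [ChartedSpace E4 M] [IsManifold 𝓘(ℝ, E4) ∞ M]

namespace Spacetime

variable (S : Spacetime M) {T : ∀ x : M, TS x →L[ℝ] TS x} {A : ∀ x : M, TS x}

theorem komarCurrent_eq_of_isKilling (hE : ∀ x : M, S.einstein x = -T x)
    (hA : IsSmoothVectorField A) (hK : S.IsKilling A) :
    S.komarCurrent T A = -(2 : ℝ) • applyTensor T (S.flat A) + fmul (trT T) (S.flat A) := by
  have key : ∀ (x : M) (γ : Fin 4), S.komarCurrent T A x (fun _ => stdVec γ) =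
      -(2 : ℝ) * applyTensor T (S.flat A) x (fun _ => stdVec γ) +
        trT T x * S.flat A x (fun _ => stdVec γ) := by
    intro x γ
    have hy := mem_chart_target E4 x
    rw [S.komarCurrent_apply hE hA, (S.isMetricOn x).sum_inv_covMat2_of_skew hy
      ((S.isSmooth_flat hA).smoothVec_comps hy) (fun z hz => hK.covMat_skew hA hz),
      S.applyTensor_apply hE, Form.apply_stdVec]
    ring
  funext x
  ext v
  have hv : v = fun _ => v 0 := funext fun i => congrArg v (Subsingleton.elim i 0)
  rw [hv]
  refine (oneForm_apply (S.komarCurrent T A x) (v 0)).trans ?_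
  refine Eq.trans ?_ (oneForm_apply ((-(2 : ℝ) • applyTensor T (S.flat A) +
    fmul (trT T) (S.flat A)) x) (v 0)).symm
  exact Finset.sum_congr rfl fun γ _ => congrArg (_ * ·) (key x γ)

/-- Smoothness is read off from `⋆J_A = -d⋆F`, so it comes from the metric and the vector field
alone. -/
theorem isSmooth_hodge_komarCurrent (hE : ∀ x : M, S.einstein x = -T x)
    (hA : IsSmoothVectorField A) :
    (S.hodge (p := 1) (q := 3) rfl (S.komarCurrent T A)).IsSmooth := by
  rw [S.hodge_komarCurrent hE hA]
  exact (S.isSmooth_hodge_d_flat hA).d.smul _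

theorem charge_eq (hE : ∀ x : M, S.einstein x = -T x) (hA : IsSmoothVectorField A)
    (hK : S.IsKilling A) (V : SmoothChain M 3) : S.charge T A V =
      -(1 / (8 * Real.pi)) *
        V.integral (S.hodge (p := 1) (q := 3) rfl (S.komarCurrent T A)) := by
  have h1 : applyTensor T (S.flat A) - (1 / 2 : ℝ) • fmul (trT T) (S.flat A) =
      (-(1 / 2) : ℝ) • S.komarCurrent T A := by
    rw [S.komarCurrent_eq_of_isKilling hE hA hK]
    funext x
    ext v
    change applyTensor T (S.flat A) x v - (1 / 2) * fmul (trT T) (S.flat A) x v =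
      -(1 / 2) * (-2 * applyTensor T (S.flat A) x v + fmul (trT T) (S.flat A) x v)
    ring
  rw [charge, h1, S.hodge_smul, SmoothChain.integral_smul, ← mul_assoc]
  congr 1
  have := Real.pi_ne_zero
  field_simp
  norm_num

theorem integral_boundary_hodge_d_flat (hE : ∀ x : M, S.einstein x = -T x)
    (hA : IsSmoothVectorField A) (V : SmoothChain M 3) :
    V.boundary.integral (S.hodge (p := 2) (q := 2) rfl (S.flat A).d) =
      -V.integral (S.hodge (p := 1) (q := 3) rfl (S.komarCurrent T A)) := by
  rw [SmoothChain.stokes V (S.isSmooth_hodge_d_flat hA), S.hodge_komarCurrent hE hA,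
    SmoothChain.integral_smul]
  ring

theorem integral_boundary_hodge_komarCurrent (hE : ∀ x : M, S.einstein x = -T x)
    (hA : IsSmoothVectorField A) (N : SmoothChain M 4) :
    N.boundary.integral (S.hodge (p := 1) (q := 3) rfl (S.komarCurrent T A)) = 0 := by
  rw [SmoothChain.stokes N (S.isSmooth_hodge_komarCurrent hE hA), S.hodge_komarCurrent hE hA,
    Form.d_smul, (S.isSmooth_hodge_d_flat hA).d_d, smul_zero, SmoothChain.integral_zero]

/-- The balance law behind both conservation statements: as `⋆J_A` is closed, the charges differ by
its flux through `W`, which is zero in one case and tends to zero in the other. -/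
theorem charge_sub (hE : ∀ x : M, S.einstein x = -T x) (hA : IsSmoothVectorField A)
    (hK : S.IsKilling A) {N : SmoothChain M 4} {V₁ V₂ W : SmoothChain M 3}
    (h : N.boundary.Same (V₁ - V₂ + W)) : S.charge T A V₂ = S.charge T A V₁ -
      1 / (8 * Real.pi) * W.integral (S.hodge (p := 1) (q := 3) rfl (S.komarCurrent T A)) := by
  have h1 := h _ (S.isSmooth_hodge_komarCurrent hE hA)
  rw [S.integral_boundary_hodge_komarCurrent hE hA, ← SmoothChain.integralHom_apply, map_add,
    map_sub, SmoothChain.integralHom_apply, SmoothChain.integralHom_apply,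
    SmoothChain.integralHom_apply] at h1
  rw [S.charge_eq hE hA hK, S.charge_eq hE hA hK]
  linear_combination (-(1 / (8 * Real.pi))) * h1

end Spacetime

end Charge

end Komar

end

theorem mainTheorem2 {M : Type*} [TopologicalSpace M] [ChartedSpace Komar.E4 M]
    [IsManifold 𝓘(ℝ, Komar.E4) ∞ M] (S : Komar.Spacetime M)
    (T : ∀ x : M, Komar.TS x →L[ℝ] Komar.TS x)
    (hEinstein : ∀ x : M, S.einstein x = -T x)
    (A : ∀ x : M, Komar.TS x) (hA : Komar.IsSmoothVectorField A) :
    S.codiff 1 (l := 2) rfl (S.flat A).d = -S.komarCurrent T A ∧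
    S.codiff 0 (l := 3) rfl (S.komarCurrent T A) = 0 ∧
    (S.IsKilling A →
      S.komarCurrent T A =
        -(2 : ℝ) • Komar.applyTensor T (S.flat A) + Komar.fmul (Komar.trT T) (S.flat A) ∧
      (∀ V : Komar.SmoothChain M 3,
        1 / (8 * Real.pi) * V.boundary.integral (S.hodge (p := 2) (q := 2) rfl (S.flat A).d) =
          S.charge T A V) ∧
      (∀ N : Komar.SmoothChain M 4, S.charge T A N.boundary = 0) ∧
      (∀ (N : Komar.SmoothChain M 4) (V₁ V₂ W : Komar.SmoothChain M 3),
        N.boundary.Same (V₁ - V₂ + W) →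
        (∀ c ∈ W.support, ∀ t ∈ Set.Icc (0 : Fin 3 → ℝ) 1,
          S.komarCurrent T A (c.toFun t) = 0) →
        S.charge T A V₁ = S.charge T A V₂) ∧
      (∀ (N : ℕ → Komar.SmoothChain M 4) (V₁ V₂ W : ℕ → Komar.SmoothChain M 3) (e : ℝ),
        (∀ n, (N n).boundary.Same (V₁ n - V₂ n + W n)) →
        Tendsto (fun n => (W n).integral (S.hodge (p := 1) (q := 3) rfl (S.komarCurrent T A)))
          atTop (𝓝 0) →
        Tendsto (fun n => S.charge T A (V₁ n)) atTop (𝓝 e) →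
        Tendsto (fun n => S.charge T A (V₂ n)) atTop (𝓝 e))) := by
  refine ⟨S.codiff_d_flat hEinstein hA, S.codiff_komarCurrent hEinstein hA, fun hK =>
    ⟨S.komarCurrent_eq_of_isKilling hEinstein hA hK, fun V => ?_, fun N => ?_,
      fun N V₁ V₂ W h hW => ?_, fun N V₁ V₂ W e h hW hV => ?_⟩⟩
  · rw [S.integral_boundary_hodge_d_flat hEinstein hA, S.charge_eq hEinstein hA hK]
    ring
  · rw [S.charge_eq hEinstein hA hK, S.integral_boundary_hodge_komarCurrent hEinstein hA, mul_zero]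
  · rw [S.charge_sub hEinstein hA hK h, Komar.SmoothChain.integral_eq_zero fun c hc t ht =>
      S.hodge_apply_eq_zero _ (hW c hc t ht), mul_zero, sub_zero]
  · simp only [S.charge_sub hEinstein hA hK (h _)]
    simpa using hV.sub (hW.const_mul (1 / (8 * Real.pi)))
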